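/- Let $n\ge 2$ be an even integer, $p$ a prime number, $\nu$ an integer with $1\le\nu\le n-1$, and $\tau\in\mathbb{H}$ a point of the upper half plane. Definitions. Let $\mathcal{MS}(\mathbb{H})$ be the cokernel of the boundary map from singular $2$-chains to singular $1$-chains of $\mathbb{H}$, and let $\{\alpha,\beta\}\in\mathcal{MS}(\mathbb{H})$ be the class of a path from $\alpha$ to $\beta$. Let $\mathcal{M}_n=\bigoplus_{\nu=0}^n\mathbb{Z}e_\nu$ with $e_\nu=X_1^\nu X_2^{n-\nu}$, on which an integral matrix $\gamma=\begin{pmatrix}a&b\\c&d\end{pmatrix}$ of positive determinant acts by $(\gamma P)(X_1,X_2)=P(dX_1-bX_2,-cX_1+aX_2)$, and let $\mathcal{M}_n^\flat=\bigoplus_\nu\mathbb{Z}e_\nu^\flat$ with $e_\nu^\flat=(-1)^{n-\nu}\binom{n}{\nu}X_1^{n-\nu}X_2^\nu$, paired with $\mathcal{M}_n$ by $\langle e_\nu^\flat,e_\mu\rangle=\delta_{\nu\mu}$. Let $\mathrm{Eis}_n$ be the class of the cocycle $\{\alpha,\beta\}\mapsto\int_\alpha^\beta E_{n+2}(z)(X_1-zX_2)^n\,dz\in\mathcal{M}_n^\flat\otimes\mathbb{C}$,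 where $E_{n+2}(z)=1+\frac{2}{\zeta(-1-n)}\sum_{k\ge1}\sigma_{n+1}(k)e^{2\pi ikz}$. It is paired with $\mathcal{MS}(\mathbb{H})\otimes(\mathcal{M}_n\otimes\mathbb{Q})$ by $\langle\phi,\sigma\otimes P\rangle=\langle\phi(\sigma),P\rangle$. For $0\le\mu<n$ put $(X_1^\mu X_2^{n-\mu})^\dagger=X_2^n\,\frac{B_{\mu+1}(X_1/X_2)-B_{\mu+1}}{\mu+1}$ with the Bernoulli polynomials $B_t(x)$ and $B_t=B_t(0)$, and extend $\dagger$ linearly. For $k\ge0$ and $0\le j<p^k$ let $l=\min\{\mathrm{ord}_p(j),k\}$ (so $l=k$ if $j=0$), and let $d$ be the inverse of $j/p^l$ modulo $p^{k-l}$ with $1\le d<p^{k-l}$ if $l<k$, and $d=0$ if $l=k$. Put $E^{(1)}=(p^kX_1-jX_2)^\nu X_2^{n-\nu}$ and $E^{(0)}=(-1)^{\nu+1}(p^lX_2)^\nu(p^{k-l}X_1+dX_2)^{n-\nu}$. For $\tau_0,\tau_1\in\mathbb{H}$, with $w_1=\frac{\tau_1+j}{p^k}$ and $w_0=\frac{p^l\tau_0-d}{p^{k-l}}$,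 put $$\widetilde C_{\nu,k,j}(\tau_0,\tau_1)=\Big\{\tfrac{-1/\tau_0+j}{p^k},\tfrac{\tau_1+j}{p^k}\Big\}\otimes\begin{pmatrix}1&j\\0&p^k\end{pmatrix}e_\nu-\{w_1,w_1+1\}\otimes E^{(1)\dagger}-\{w_0,w_0+1\}\otimes E^{(0)\dagger}.$$ The cycle $\widetilde{T_p^m(C_\nu(\tau))}$ lifting $T_p^m(C_\nu(\tau))$, where $C_\nu(\tau)=\{-1/\tau,\tau\}\otimes e_\nu$, is $$\widetilde{T_p^m(C_\nu(\tau))}=\sum_{A=0}^{\lfloor m/2\rfloor}\Big(\tbinom{m}{A}-\tbinom{m}{A-1}\Big)p^{(n+1)A}\sum_{k=0}^{m-2A}p^{(n-\nu)(m-2A-k)}\sum_{j=0}^{p^k-1}\widetilde C_{\nu,k,j}\Big(\frac{\tau}{p^{m-2A-k}},p^{m-2A-k}\tau\Big).$$ Theorem. For every $m$ the number $\langle\mathrm{Eis}_n,\widetilde{T_p^{m!}(C_\nu(\tau))}\rangle$ is rational, and in the $p$-adic topology $$\lim_{m\to\infty}\big\langle\mathrm{Eis}_n,\widetilde{T_p^{m!}(C_\nu(\tau))}\big\rangle=(1-p^{n+1})\left(\frac{\zeta(-\nu)\zeta(\nu-n)}{(1-p^{n+1})\zeta(-1-n)}-\frac{\zeta(-\nu)}{1-p^{n-\nu}}-\frac{\zeta(\nu-n)}{1-p^\nu}\right),$$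 a rational number. The same limit equals $\frac{1-p^{n+1}}{(1-p^\nu)(1-p^{n-\nu})}D_p(n,\nu)$, where $$D_p(n,\nu)=\frac{L_p(-\nu,\omega^{1+\nu})L_p(\nu-n,\omega^{n-\nu+1})}{L_p(-1-n,\omega^{n+2})}-L_p(-\nu,\omega^{1+\nu})-L_p(\nu-n,\omega^{n-\nu+1})$$ and $L_p(s,\omega^a)$ is the Kubota–Leopoldt $p$-adic $L$-function attached to the $a$-th power of the Teichmüller character $\omega$. -/

import Mathlib

open scoped UpperHalfPlane MatrixGroups TensorProduct

namespace EisPeriod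

/-! ### Singular chains on the upper half plane and the group of modular symbols -/

/-- Singular `q`-simplices of the upper half plane. -/
abbrev Simplex (q : ℕ) : Type := C(stdSimplex ℝ (Fin (q + 1)), ℍ)

/-- Singular `q`-chains of the upper half plane, with integral coefficients. -/
abbrev Chain (q : ℕ) : Type := Simplex q →₀ ℤ

/-- The `i`-th face of a singular simplex. -/
noncomputable def Simplex.face {q : ℕ} (σ : Simplex (q + 1)) (i : Fin (q + 2)) : Simplex q :=
  σ.comp ⟨stdSimplex.map (Fin.succAbove i), stdSimplex.continuous_map _⟩

/-- The boundary operator of the singular chain complex. -/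
noncomputable def boundary (q : ℕ) : Chain (q + 1) →ₗ[ℤ] Chain q :=
  Finsupp.linearCombination ℤ fun σ : Simplex (q + 1) =>
    ∑ i : Fin (q + 2), (-1 : ℤ) ^ (i : ℕ) • Finsupp.single (σ.face i) (1 : ℤ)

/-- `𝓜𝓢(ℍ)`, the cokernel of the boundary map from 2-chains to 1-chains. -/
abbrev MS : Type := Chain 1 ⧸ LinearMap.range (boundary 1)

/-- The straight path from `α` to `β` in the (convex) upper half plane, as a singular simplex. -/
noncomputable def segment (α β : ℍ) : Simplex 1 where
  toFun x := ⟨(x 0 : ℂ) * α + (x 1 : ℂ) * β, by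
    have h0 := stdSimplex.zero_le x 0
    have h1 := stdSimplex.zero_le x 1
    have h := stdSimplex.add_eq_one x
    have ha := α.im_pos
    have hb := β.im_pos
    simp only [Complex.add_im, Complex.mul_im, Complex.ofReal_re, Complex.ofReal_im, zero_mul,
      add_zero, UpperHalfPlane.coe_im]
    rcases h0.eq_or_lt with h0 | h0
    · have : x 1 = 1 := by linarith
      rw [← h0, this]; linarith
    · have := mul_pos h0 ha
      have := mul_nonneg h1 hb.le
      linarith⟩
  continuous_toFun := by
    rw [UpperHalfPlane.isEmbedding_coe.continuous_iff]
    have hc : ∀ i : Fin 2, Continuous fun x : stdSimplex ℝ (Fin 2) => x i := fun i =>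
      (continuous_apply i).comp continuous_subtype_val
    change Continuous fun x : stdSimplex ℝ (Fin 2) => (x 0 : ℂ) * (α : ℂ) + (x 1 : ℂ) * (β : ℂ)
    exact ((Complex.continuous_ofReal.comp (hc 0)).mul continuous_const).add
      ((Complex.continuous_ofReal.comp (hc 1)).mul continuous_const)

/-- The modular symbol `{α, β}`: the class in `𝓜𝓢(ℍ)` of a path from `α` to `β`. -/
noncomputable def symb (α β : ℍ) : MS :=
  Submodule.Quotient.mk (Finsupp.single (segment α β) 1)

/-! ### The action of integral matrices of positive determinant on the upper half plane -/

/-- Integral `2 × 2` matrices of positive determinant. -/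
abbrev M2Plus : Type := {γ : Matrix (Fin 2) (Fin 2) ℤ // 0 < γ.det}

/-- The underlying invertible real matrix. -/
noncomputable def toGL (γ : M2Plus) : GL (Fin 2) ℝ :=
  Matrix.GeneralLinearGroup.mkOfDetNeZero (γ.1.map (Int.cast : ℤ → ℝ)) (by
    have h : (γ.1.map (Int.cast : ℤ → ℝ)).det = ((γ.1.det : ℤ) : ℝ) := by
      simp [Matrix.det_fin_two]
    rw [h]
    exact_mod_cast γ.2.ne')

/-- The action by linear fractional transformations. -/
noncomputable def move (γ : M2Plus) (τ : ℍ) : ℍ := toGL γ • τ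

lemma coe_move (γ : M2Plus) (τ : ℍ) :
    (move γ τ : ℂ) = (γ.1 0 0 * τ + γ.1 0 1) / (γ.1 1 0 * τ + γ.1 1 1) := by
  have h : 0 < (toGL γ).det.val := by
    have h' : (toGL γ).det.val = ((γ.1.det : ℤ) : ℝ) := by
      simp [toGL, Matrix.GeneralLinearGroup.mkOfDetNeZero, Matrix.det_fin_two]
    rw [h']
    exact_mod_cast γ.2
  rw [move, UpperHalfPlane.coe_smul_of_det_pos h]
  simp [UpperHalfPlane.num, UpperHalfPlane.denom, toGL,
    Matrix.GeneralLinearGroup.mkOfDetNeZero]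

/-- The matrix `(p ^ a, b; 0, p ^ c)`. -/
def tri (p : ℕ) [Fact p.Prime] (a : ℕ) (b : ℤ) (c : ℕ) : M2Plus :=
  ⟨!![(p : ℤ) ^ a, b; 0, (p : ℤ) ^ c], by
    have := (Fact.out : p.Prime).pos
    simp only [Matrix.det_fin_two_of, mul_zero, sub_zero]
    positivity⟩

/-- The translation matrix `(1, 1; 0, 1)`. -/
def matT : M2Plus := ⟨!![1, 1; 0, 1], by simp [Matrix.det_fin_two_of]⟩

/-- The inversion matrix `(0, -1; 1, 0)`. -/
def matS : M2Plus := ⟨!![0, -1; 1, 0], by simp [Matrix.det_fin_two_of]⟩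

/-! ### Binary forms of degree `n`; the variables `X₁`, `X₂` are `X 0`, `X 1` -/

/-- Homogeneous polynomials of degree `n` in `X₁, X₂` over `R`. For `R = ℚ` this is `𝓜ₙ ⊗ ℚ`, for
`R = ℂ` it is both `𝓜ₙ ⊗ ℂ` and `𝓜ₙ♭ ⊗ ℂ`. -/
abbrev Form (R : Type) [CommRing R] (n : ℕ) : Type :=
  MvPolynomial.homogeneousSubmodule (Fin 2) R n

/-- The exponent of the monomial `X₁ ^ ν * X₂ ^ (n - ν)`. -/
noncomputable def expo (n : ℕ) (ν : Fin (n + 1)) : Fin 2 →₀ ℕ :=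
  Finsupp.single 0 (ν : ℕ) + Finsupp.single 1 (n - ν)

/-- `e_ν = X₁ ^ ν * X₂ ^ (n - ν)`. -/
noncomputable def e (R : Type) [CommRing R] (n : ℕ) (ν : Fin (n + 1)) : Form R n :=
  ⟨MvPolynomial.X 0 ^ (ν : ℕ) * MvPolynomial.X 1 ^ (n - ν), by
    have h := (MvPolynomial.isHomogeneous_X_pow (R := R) (0 : Fin 2) (ν : ℕ)).mul
      (MvPolynomial.isHomogeneous_X_pow (R := R) (1 : Fin 2) (n - ν))
    rwa [Nat.add_sub_cancel' (Nat.lt_succ_iff.mp ν.2)] at h⟩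

/-- The coefficient of `X₁ ^ ν * X₂ ^ (n - ν)`. -/
noncomputable def coef {R : Type} [CommRing R] {n : ℕ} (ν : Fin (n + 1)) (P : Form R n) : R :=
  MvPolynomial.coeff (expo n ν) (P : MvPolynomial (Fin 2) R)

lemma coef_add {R : Type} [CommRing R] {n : ℕ} (ν : Fin (n + 1)) (P Q : Form R n) :
    coef ν (P + Q) = coef ν P + coef ν Q := MvPolynomial.coeff_add _ _ _

lemma coef_zsmul {R : Type} [CommRing R] {n : ℕ} (ν : Fin (n + 1)) (c : ℤ) (P : Form R n) :
    coef ν (c • P) = c • coef ν P := MvPolynomial.coeff_smul _ _ _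

/-- The left action `(γP)(X₁, X₂) = P(d X₁ - b X₂, - c X₁ + a X₂)` of `γ = (a, b; c, d)`. -/
noncomputable def act {n : ℕ} (γ : M2Plus) (P : Form ℚ n) : Form ℚ n :=
  ⟨MvPolynomial.aeval
      ![MvPolynomial.C (γ.1 1 1 : ℚ) * MvPolynomial.X 0 -
          MvPolynomial.C (γ.1 0 1 : ℚ) * MvPolynomial.X 1,
        MvPolynomial.C (-γ.1 1 0 : ℚ) * MvPolynomial.X 0 +
          MvPolynomial.C (γ.1 0 0 : ℚ) * MvPolynomial.X 1]
      (P : MvPolynomial (Fin 2) ℚ), by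
    have h := MvPolynomial.IsHomogeneous.aeval (n := 1) (S := ℚ) P.2
      ![MvPolynomial.C (γ.1 1 1 : ℚ) * MvPolynomial.X (0 : Fin 2) -
          MvPolynomial.C (γ.1 0 1 : ℚ) * MvPolynomial.X 1,
        MvPolynomial.C (-γ.1 1 0 : ℚ) * MvPolynomial.X 0 +
          MvPolynomial.C (γ.1 0 0 : ℚ) * MvPolynomial.X 1] (by
        intro i
        fin_cases i
        · exact (MvPolynomial.isHomogeneous_C_mul_X _ _).sub
            (MvPolynomial.isHomogeneous_C_mul_X _ _)
        · exact (MvPolynomial.isHomogeneous_C_mul_X _ _).add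
            (MvPolynomial.isHomogeneous_C_mul_X _ _))
    rwa [one_mul] at h⟩

/-- The basis `e_ν♭ = (-1) ^ (n - ν) * binom(n, ν) * X₁ ^ (n - ν) * X₂ ^ ν` of `𝓜ₙ♭ ⊗ ℂ`. -/
noncomputable def eFlat (n : ℕ) (ν : Fin (n + 1)) : Form ℂ n :=
  ((-1 : ℂ) ^ (n - ν : ℕ) * (n.choose ν : ℂ)) • e ℂ n ν.rev

/-- The pairing of `𝓜ₙ♭ ⊗ ℂ` with `𝓜ₙ ⊗ ℚ` for which `(e_ν♭)` and `(e_ν)` are dual bases: the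
coordinate of `P` along `e_ν♭` is the coefficient of `X₁ ^ (n - ν) * X₂ ^ ν` divided by
`(-1) ^ (n - ν) * binom(n, ν)`. -/
noncomputable def formPairing (n : ℕ) : Form ℂ n →ₗ[ℤ] Form ℚ n →ₗ[ℤ] ℂ :=
  LinearMap.mk₂ ℤ
    (fun P Q => ∑ ν : Fin (n + 1),
      coef ν.rev P / ((-1 : ℂ) ^ (n - ν : ℕ) * (n.choose ν : ℂ)) * ((coef ν Q : ℚ) : ℂ))
    (by intro P P' Q; simp only [coef_add, add_div, add_mul, Finset.sum_add_distrib])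
    (by
      intro c P Q
      simp only [coef_zsmul, Finset.smul_sum, zsmul_eq_mul, mul_div_assoc, mul_assoc])
    (by intro P Q Q'; simp only [coef_add, Rat.cast_add, mul_add, Finset.sum_add_distrib])
    (by
      intro c P Q
      simp only [coef_zsmul, Finset.smul_sum, zsmul_eq_mul, Rat.cast_mul, Rat.cast_intCast,
        mul_left_comm])

lemma coef_e {R : Type} [CommRing R] (n : ℕ) (ν μ : Fin (n + 1)) :
    coef ν (e R n μ) = if ν = μ then 1 else 0 := by
  have h1 : ((e R n μ : Form R n) : MvPolynomial (Fin 2) R) =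
      MvPolynomial.monomial (expo n μ) 1 := by
    rw [expo, ← one_mul (1 : R), ← MvPolynomial.monomial_mul, ← MvPolynomial.X_pow_eq_monomial,
      ← MvPolynomial.X_pow_eq_monomial]
    rfl
  have h2 : expo n μ = expo n ν ↔ ν = μ := by
    constructor
    · intro h
      have := DFunLike.congr_fun h 0
      simp [expo] at this
      exact Fin.ext this.symm
    · rintro rfl; rfl
  rw [coef, h1, MvPolynomial.coeff_monomial]
  simp only [h2]

lemma formPairing_eFlat_e (n : ℕ) (ν μ : Fin (n + 1)) :
    formPairing n (eFlat n ν) (e ℚ n μ) = if ν = μ then 1 else 0 := by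
  have hs : ∀ (c : ℂ) (κ : Fin (n + 1)) (P : Form ℂ n), coef κ (c • P) = c * coef κ P := by
    intro c κ P; simp [coef]
  simp only [formPairing, LinearMap.mk₂_apply, eFlat, hs, coef_e, Fin.rev_inj]
  by_cases h : ν = μ
  · subst h
    rw [Finset.sum_eq_single ν]
    · have : (n.choose ν : ℂ) ≠ 0 := by
        exact_mod_cast (Nat.choose_pos (Nat.lt_succ_iff.mp ν.2)).ne'
      simp [this]
    · intro κ _ hκ; simp [hκ]
    · simp
  · rw [if_neg h]
    apply Finset.sum_eq_zero
    intro κ _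
    by_cases h1 : κ = ν
    · subst h1; simp [h]
    · simp [h1]

/-! ### The Eichler-Shimura map and the Eisenstein class -/

/-- The integral `∫ g(z) dz` along the straight path from `a` to `b`. -/
noncomputable def segInt (g : ℂ → ℂ) (a b : ℂ) : ℂ :=
  (b - a) * ∫ t in (0 : ℝ)..1, g (a + t * (b - a))

/-- The form `(X₁ - z X₂) ^ n`. -/
noncomputable def kernelForm (n : ℕ) (z : ℂ) : Form ℂ n :=
  ⟨(MvPolynomial.X 0 - MvPolynomial.C z * MvPolynomial.X 1) ^ n, by
    have h := ((MvPolynomial.isHomogeneous_X ℂ (0 : Fin 2)).sub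
      (MvPolynomial.isHomogeneous_C_mul_X z (1 : Fin 2))).pow n
    rwa [one_mul] at h⟩

/-- `∫ f(z) (X₁ - z X₂) ^ n dz` along the straight path from `α` to `β`, computed coefficientwise;
`f (ofComplex z)` is the value of `f` at a point `z` of the upper half plane. -/
noncomputable def formIntegral (n : ℕ) (f : ℍ → ℂ) (α β : ℍ) : Form ℂ n :=
  ∑ ν : Fin (n + 1),
    segInt (fun z => f (UpperHalfPlane.ofComplex z) * coef ν (kernelForm n z)) α β • e ℂ n ν

lemma segInt_add {g : ℂ → ℂ} (hg : DifferentiableOn ℂ g {z | 0 < z.im}) (a b c : ℍ) :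
    segInt g a b + segInt g b c = segInt g a c := by
  have hconv : Convex ℝ {z : ℂ | 0 < z.im} := convex_halfSpace_im_gt 0
  obtain ⟨G, hG⟩ := hconv.exists_forall_hasDerivWithinAt hg
  have hopen : IsOpen {z : ℂ | 0 < z.im} := isOpen_lt continuous_const Complex.continuous_im
  have key : ∀ x y : ℍ, segInt g x y = G y - G x := by
    intro x y
    have hmem : ∀ t ∈ Set.uIcc (0 : ℝ) 1,
        (x : ℂ) + t * ((y : ℂ) - x) ∈ {z : ℂ | 0 < z.im} := by
      intro t ht
      rw [Set.uIcc_of_le zero_le_one] at ht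
      have h := hconv x.im_pos y.im_pos (sub_nonneg.2 ht.2) ht.1 (by ring)
      convert h using 1
      simp only [Complex.real_smul, Complex.ofReal_sub, Complex.ofReal_one]
      ring
    have hline : ∀ t : ℝ, HasDerivAt (fun t : ℝ => (x : ℂ) + t * ((y : ℂ) - x))
        ((y : ℂ) - x) t := by
      intro t
      have h := ((Complex.ofRealCLM.hasDerivAt (x := t)).mul_const ((y : ℂ) - x)).const_add (x : ℂ)
      simpa using h
    have hderiv : ∀ t ∈ Set.uIcc (0 : ℝ) 1,
        HasDerivAt (fun t : ℝ => G ((x : ℂ) + t * ((y : ℂ) - x)))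
          (((y : ℂ) - x) * g ((x : ℂ) + t * ((y : ℂ) - x))) t := by
      intro t ht
      have h1 : HasDerivAt G (g ((x : ℂ) + t * ((y : ℂ) - x))) ((x : ℂ) + t * ((y : ℂ) - x)) :=
        (hG _ (hmem t ht)).hasDerivAt (hopen.mem_nhds (hmem t ht))
      have h2 := h1.comp t (hline t)
      rw [mul_comm]
      exact h2
    have hcont : ContinuousOn (fun t : ℝ => ((y : ℂ) - x) * g ((x : ℂ) + t * ((y : ℂ) - x)))
        (Set.uIcc (0 : ℝ) 1) := by
      apply continuousOn_const.mul
      apply hg.continuousOn.comp _ hmem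
      exact fun t _ => (hline t).continuousAt.continuousWithinAt
    have h := intervalIntegral.integral_eq_sub_of_hasDerivAt hderiv
      (hcont.intervalIntegrable)
    rw [intervalIntegral.integral_const_mul] at h
    rw [segInt, h]
    simp
  rw [key, key, key]
  ring

lemma differentiable_coef_kernelForm (n : ℕ) (ν : Fin (n + 1)) :
    Differentiable ℂ fun z => coef ν (kernelForm n z) := by
  have h : ∀ z : ℂ, coef ν (kernelForm n z) =
      ∑ m ∈ Finset.range (n + 1), z ^ (n - m) * MvPolynomial.coeff (expo n ν)
        (MvPolynomial.X 0 ^ m * (-MvPolynomial.X 1) ^ (n - m) *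
          (n.choose m : MvPolynomial (Fin 2) ℂ)) := by
    intro z
    have h1 : ((kernelForm n z : Form ℂ n) : MvPolynomial (Fin 2) ℂ) =
        ∑ m ∈ Finset.range (n + 1), MvPolynomial.C (z ^ (n - m)) *
          (MvPolynomial.X 0 ^ m * (-MvPolynomial.X 1) ^ (n - m) *
            (n.choose m : MvPolynomial (Fin 2) ℂ)) := by
      change (MvPolynomial.X 0 - MvPolynomial.C z * MvPolynomial.X 1) ^ n = _
      rw [sub_eq_add_neg, add_pow]
      apply Finset.sum_congr rfl
      intro m _
      rw [← mul_neg, mul_pow, MvPolynomial.C_pow]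
      ring
    rw [coef, h1, MvPolynomial.coeff_sum]
    simp only [MvPolynomial.coeff_C_mul]
  simp only [h]
  fun_prop

lemma formIntegral_add (n : ℕ) {f : ℍ → ℂ}
    (hf : DifferentiableOn ℂ (fun z => f (UpperHalfPlane.ofComplex z)) {z | 0 < z.im})
    (a b c : ℍ) :
    formIntegral n f a b + formIntegral n f b c = formIntegral n f a c := by
  simp only [formIntegral]
  rw [← Finset.sum_add_distrib]
  apply Finset.sum_congr rfl
  intro ν _
  rw [← add_smul, segInt_add]
  exact hf.mul (differentiable_coef_kernelForm n ν).differentiableOn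

/-- The map `r` on singular 1-chains. The integral of a holomorphic form along a path in the upper
half plane depends only on the end points, so the straight path is used. -/
noncomputable def rChain (n : ℕ) (f : ℍ → ℂ) : Chain 1 →ₗ[ℤ] Form ℂ n :=
  Finsupp.linearCombination ℤ fun σ : Simplex 1 =>
    formIntegral n f (σ (stdSimplex.vertex 0)) (σ (stdSimplex.vertex 1))

lemma rChain_boundary (n : ℕ) {f : ℍ → ℂ}
    (hf : DifferentiableOn ℂ (fun z => f (UpperHalfPlane.ofComplex z)) {z | 0 < z.im}) :
    LinearMap.range (boundary 1) ≤ LinearMap.ker (rChain n f) := by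
  rw [LinearMap.range_le_ker_iff]
  ext σ : 2
  have hv : ∀ (i : Fin 3) (j : Fin 2),
      σ.face i (stdSimplex.vertex j) = σ (stdSimplex.vertex (i.succAbove j)) := by
    intro i j
    change σ (stdSimplex.map _ _) = _
    rw [stdSimplex.map_vertex]
  have h := formIntegral_add n hf (σ (stdSimplex.vertex 0)) (σ (stdSimplex.vertex 1))
    (σ (stdSimplex.vertex 2))
  simp only [LinearMap.comp_apply, Finsupp.lsingle_apply, boundary, rChain,
    Finsupp.linearCombination_single, one_smul, map_sum, map_smul, hv,
    LinearMap.zero_apply]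
  change ∑ i : Fin 3, _ = _
  rw [Fin.sum_univ_three]
  have a1 : (0 : Fin 3).succAbove (0 : Fin 2) = 1 := by decide
  have a2 : (0 : Fin 3).succAbove (1 : Fin 2) = 2 := by decide
  have a3 : (1 : Fin 3).succAbove (0 : Fin 2) = 0 := by decide
  have a4 : (1 : Fin 3).succAbove (1 : Fin 2) = 2 := by decide
  have a5 : (2 : Fin 3).succAbove (0 : Fin 2) = 0 := by decide
  have a6 : (2 : Fin 3).succAbove (1 : Fin 2) = 1 := by decide
  rw [a1, a2, a3, a4, a5, a6, ← h]
  simp only [Fin.val_zero, Fin.val_one, Fin.val_two, pow_zero, pow_one, one_smul, neg_smul,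
    neg_one_sq]
  abel

/-- The Eichler-Shimura map: `r(f)({α, β}) = ∫ f(z) (X₁ - z X₂) ^ n dz` over a path from `α` to `β`,
for a modular form `f` of weight `n + 2` and level `SL(2, ℤ)`. -/
noncomputable def eichlerShimura (n : ℕ) (f : ModularForm 𝒮ℒ ((n + 2 : ℕ) : ℤ)) :
    MS →ₗ[ℤ] Form ℂ n :=
  (LinearMap.range (boundary 1)).liftQ (rChain n f)
    (rChain_boundary n (UpperHalfPlane.mdifferentiable_iff.mp f.holo'))

/-- The value of the Eichler-Shimura map on a modular symbol. -/
lemma eichlerShimura_symb (n : ℕ) (f : ModularForm 𝒮ℒ ((n + 2 : ℕ) : ℤ)) (α β : ℍ) :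
    eichlerShimura n f (symb α β) = formIntegral n f α β := by
  have h0 : segment α β (stdSimplex.vertex 0) = α := by
    apply UpperHalfPlane.ext
    simp [segment]
  have h1 : segment α β (stdSimplex.vertex 1) = β := by
    apply UpperHalfPlane.ext
    simp [segment]
  change rChain n f (Finsupp.single (segment α β) 1) = _
  simp [rChain, h0, h1]

/-- The Eisenstein class `Eisₙ = r(E_{n+2})`, as a cocycle, where `E_{n+2}` is the Eisenstein series
of weight `n + 2` and level `SL(2, ℤ)` with constant term `1`. -/
noncomputable def Eis (n : ℕ) (hn : 2 ≤ n) : MS →ₗ[ℤ] Form ℂ n :=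
  eichlerShimura n (ModularForm.E (k := n + 2) (by omega))

/-- The `q`-expansion of the Eisenstein series used in `Eis`. -/
lemma eisenstein_qExpansion (n : ℕ) (hn : 2 ≤ n) (he : Even n) (z : ℍ) :
    ModularForm.E (k := n + 2) (by omega) z =
      1 + 2 / riemannZeta (-1 - (n : ℂ)) * ∑' k : ℕ+, (ArithmeticFunction.sigma (n + 1) k : ℂ) *
        Complex.exp (2 * Real.pi * Complex.I * z) ^ (k : ℕ) := by
  rw [EisensteinSeries.q_expansion_bernoulli (by omega) (by
    rw [Nat.even_add]; simp [he])]
  have hz : riemannZeta (-1 - (n : ℂ)) = -(bernoulli (n + 2) : ℂ) / (n + 2) := by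
    have h := riemannZeta_neg_nat_eq_bernoulli (n + 1)
    have hs : (-1 - (n : ℂ)) = -((n + 1 : ℕ) : ℂ) := by push_cast; ring
    rw [hs, h]
    have : Odd (n + 1) := he.add_one
    push_cast
    rw [this.neg_one_pow]
    ring_nf
  rw [hz]
  have e1 : n + 2 - 1 = n + 1 := by omega
  simp only [e1, zpow_natCast]
  push_cast
  have : (n : ℂ) + 2 ≠ 0 := by exact_mod_cast (by omega : n + 2 ≠ 0)
  rw [div_div_eq_mul_div]
  ring

/-- The pairing `⟨c, σ ⊗ P⟩ = ⟨c(σ), P⟩` of cochains with chains. -/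
noncomputable def pairing {n : ℕ} (c : MS →ₗ[ℤ] Form ℂ n) : MS ⊗[ℤ] Form ℚ n →ₗ[ℤ] ℂ :=
  TensorProduct.lift ((formPairing n).comp c)

/-! ### The cycle lifting `T_p ^ m (C_ν)` -/

/-- The homogenisation `X₂ ^ n * F(X₁ / X₂)` of a polynomial `F` of degree at most `n`. -/
noncomputable def homogenize (n : ℕ) (F : Polynomial ℚ) : Form ℚ n :=
  ∑ i : Fin (n + 1), F.coeff i • e ℚ n i

/-- `(B_t(x) - B_t) / t`, with `B_t(x)` the Bernoulli polynomial and `B_t = B_t(0)`. -/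
noncomputable def bernTilde (t : ℕ) : Polynomial ℚ :=
  Polynomial.C (1 / (t : ℚ)) * (Polynomial.bernoulli t - Polynomial.C (bernoulli t))

/-- The linear map `P ↦ P†` sending `X₁ ^ μ * X₂ ^ (n - μ)` to
`X₂ ^ n * (B_{μ+1}(X₁ / X₂) - B_{μ+1}) / (μ + 1)` for `0 ≤ μ < n`. Its domain consists of the forms
that have no term in `X₁ ^ n`, and that term is ignored. -/
noncomputable def dagger {n : ℕ} (P : Form ℚ n) : Form ℚ n :=
  ∑ μ : Fin n, coef μ.castSucc P • homogenize n (bernTilde (μ + 1))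

section Cycle

variable (p : ℕ) [Fact p.Prime]

/-- `l_k(j) = min (ord_p j) k`, with `l_k(0) = k`. -/
def ell (k j : ℕ) : ℕ := if j = 0 then k else min (padicValNat p j) k

/-- For `N ≥ 1` and `p ∤ j` the integer `1 ≤ d < p ^ N` with `j * d ≡ 1` modulo `p ^ N`; it is `0`
for `N = 0`. -/
def dInv (N j : ℕ) : ℕ := ((j : ZMod (p ^ N))⁻¹).val

/-- `d = d_{k-l}(j')` with `l = l_k(j)` and `j' = j / p ^ l`. -/
def dd (k j : ℕ) : ℕ := dInv p (k - ell p k j) (j / p ^ ell p k j)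

variable {p} in
lemma dInv_spec {N j : ℕ} (hN : 0 < N) (hj : ¬ p ∣ j) :
    1 ≤ dInv p N j ∧ dInv p N j < p ^ N ∧ j * dInv p N j ≡ 1 [MOD p ^ N] := by
  have hp : p.Prime := Fact.out
  have h1 : 1 < p ^ N := Nat.one_lt_pow hN.ne' hp.one_lt
  have hc : j.Coprime (p ^ N) := Nat.Coprime.pow_right N ((hp.coprime_iff_not_dvd.2 hj).symm)
  have : NeZero (p ^ N) := ⟨by omega⟩
  have hmod : j * dInv p N j ≡ 1 [MOD p ^ N] := by
    rw [← ZMod.natCast_eq_natCast_iff]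
    push_cast
    rw [dInv, ZMod.natCast_zmod_val]
    exact ZMod.coe_mul_inv_eq_one j hc
  refine ⟨?_, ZMod.val_lt _, hmod⟩
  rcases Nat.eq_zero_or_pos (dInv p N j) with h0 | h0
  · rw [h0, mul_zero] at hmod
    have := Nat.ModEq.dvd hmod
    have h2 : p ^ N ∣ 1 := by
      have := (Nat.modEq_zero_iff_dvd.1 hmod.symm)
      exact this
    have := Nat.le_of_dvd one_pos h2
    omega
  · exact h0

/-- `(p ^ k X₁ - j X₂) ^ ν * X₂ ^ (n - ν)`. -/
noncomputable def E1 (n : ℕ) (ν : Fin (n + 1)) (k j : ℕ) : Form ℚ n :=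
  ⟨(MvPolynomial.C ((p : ℚ) ^ k) * MvPolynomial.X 0 -
      MvPolynomial.C (j : ℚ) * MvPolynomial.X 1) ^ (ν : ℕ) * MvPolynomial.X 1 ^ (n - ν), by
    have h := (((MvPolynomial.isHomogeneous_C_mul_X ((p : ℚ) ^ k) (0 : Fin 2)).sub
      (MvPolynomial.isHomogeneous_C_mul_X (j : ℚ) (1 : Fin 2))).pow (ν : ℕ)).mul
      (MvPolynomial.isHomogeneous_X_pow (1 : Fin 2) (n - ν))
    rwa [one_mul, Nat.add_sub_cancel' (Nat.lt_succ_iff.mp ν.2)] at h⟩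

/-- `(-1) ^ (ν + 1) * (p ^ l X₂) ^ ν * (p ^ (k - l) X₁ + d X₂) ^ (n - ν)`. -/
noncomputable def E0 (n : ℕ) (ν : Fin (n + 1)) (k j : ℕ) : Form ℚ n :=
  (-1 : ℚ) ^ ((ν : ℕ) + 1) •
  ⟨(MvPolynomial.C ((p : ℚ) ^ ell p k j) * MvPolynomial.X 1) ^ (ν : ℕ) *
      (MvPolynomial.C ((p : ℚ) ^ (k - ell p k j)) * MvPolynomial.X 0 +
        MvPolynomial.C (dd p k j : ℚ) * MvPolynomial.X 1) ^ (n - ν), by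
    have h := ((MvPolynomial.isHomogeneous_C_mul_X ((p : ℚ) ^ ell p k j) (1 : Fin 2)).pow
      (ν : ℕ)).mul (((MvPolynomial.isHomogeneous_C_mul_X ((p : ℚ) ^ (k - ell p k j))
        (0 : Fin 2)).add
      (MvPolynomial.isHomogeneous_C_mul_X (dd p k j : ℚ) (1 : Fin 2))).pow (n - ν))
    rwa [one_mul, one_mul, Nat.add_sub_cancel' (Nat.lt_succ_iff.mp ν.2)] at h⟩

/-- `C_{ν,k,j}(τ₀, τ₁)`, the image of `{-1 / τ₀, τ₁} ⊗ e_ν` under the matrix `(1, j; 0, p ^ k)`. -/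
noncomputable def C1 (n : ℕ) (ν : Fin (n + 1)) (k j : ℕ) (τ₀ τ₁ : ℍ) : MS ⊗[ℤ] Form ℚ n :=
  symb (move (tri p 0 j k) (move matS τ₀)) (move (tri p 0 j k) τ₁) ⊗ₜ
    act (tri p 0 j k) (e ℚ n ν)

/-- The corrected chain `C̃_{ν,k,j}(τ₀, τ₁) = C_{ν,k,j}(τ₀, τ₁) - {w₁, w₁ + 1} ⊗ (E⁽¹⁾)† -
{w₀, w₀ + 1} ⊗ (E⁽⁰⁾)†` with `w₁ = (τ₁ + j) / p ^ k` and `w₀ = (p ^ l τ₀ - d) / p ^ (k - l)`. -/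
noncomputable def C1Tilde (n : ℕ) (ν : Fin (n + 1)) (k j : ℕ) (τ₀ τ₁ : ℍ) :
    MS ⊗[ℤ] Form ℚ n :=
  let w₁ : ℍ := move (tri p 0 j k) τ₁
  let w₀ : ℍ := move (tri p (ell p k j) (-(dd p k j : ℤ)) (k - ell p k j)) τ₀
  C1 p n ν k j τ₀ τ₁ - symb w₁ (move matT w₁) ⊗ₜ dagger (E1 p n ν k j) -
    symb w₀ (move matT w₀) ⊗ₜ dagger (E0 p n ν k j)

/-- `C(A, B) = binom(A + B, B) - binom(A + B, B - 1)`, where `binom(a, -1) = 0`. -/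
def ballot (A B : ℕ) : ℤ :=
  ((A + B).choose B : ℤ) - if B = 0 then 0 else ((A + B).choose (B - 1) : ℤ)

/-- The cycle that lifts `T_p ^ m (C_ν(τ))`. -/
noncomputable def liftCycle (n : ℕ) (ν : Fin (n + 1)) (m : ℕ) (τ : ℍ) : MS ⊗[ℤ] Form ℚ n :=
  ∑ A ∈ Finset.range (m / 2 + 1), (ballot (m - A) A * (p : ℤ) ^ ((n + 1) * A)) •
    ∑ k ∈ Finset.range (m - 2 * A + 1), ((p : ℤ) ^ ((n - ν) * (m - 2 * A - k))) •
      ∑ j ∈ Finset.range (p ^ k),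
        C1Tilde p n ν k j (move (tri p 0 0 (m - 2 * A - k)) τ) (move (tri p (m - 2 * A - k) 0 0) τ)

/-! ### Kubota-Leopoldt `p`-adic `L`-functions -/

/-- The conductor of the Teichmüller character: `4` for `p = 2`, and `p` otherwise. -/
def condT : ℕ := if p = 2 then 4 else p

/-- Existence and uniqueness of the Teichmüller representative of an integer prime to `p`. -/
lemma existsUnique_teichmuller (a : ℕ) (ha : ¬ p ∣ a) :
    ∃! w : ℤ_[p], w ^ Nat.totient (condT p) = 1 ∧ (condT p : ℤ_[p]) ∣ w - a := by
  have hp : p.Prime := Fact.out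
  by_cases h2 : p = 2
  · subst h2
    have hc : condT 2 = 4 := rfl
    have hphi : Nat.totient 4 = 2 := by decide
    rw [hc, hphi]
    have ha4 : a % 4 = 1 ∨ a % 4 = 3 := by omega
    have h4 : ∀ x : ℤ, (((4 : ℕ) : ℤ_[2]) ∣ (x : ℤ_[2])) ↔ (4 : ℤ) ∣ x := by
      intro x
      have h := PadicInt.norm_int_le_pow_iff_dvd (p := 2) (k := x) (n := 2)
      have h' := PadicInt.norm_le_pow_iff_mem_span_pow (p := 2) (x : ℤ_[2]) 2
      rw [Ideal.mem_span_singleton] at h'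
      have e4 : ((4 : ℕ) : ℤ_[2]) = ((2 : ℕ) : ℤ_[2]) ^ 2 := by norm_num
      rw [e4, ← h']
      simpa using h
    have hsq : ∀ w : ℤ_[2], w ^ 2 = 1 → w = 1 ∨ w = -1 := fun w hw => by simpa using hw
    rcases ha4 with h | h
    · refine ⟨1, ⟨one_pow 2, ?_⟩, ?_⟩
      · have := (h4 (1 - a)).2 (by omega)
        simpa using this
      · rintro w ⟨hw, hd⟩
        rcases hsq w hw with rfl | rfl
        · rfl
        · exfalso
          have := (h4 (-1 - a)).1 (by simpa using hd)
          omega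
    · refine ⟨-1, ⟨by norm_num, ?_⟩, ?_⟩
      · have := (h4 (-1 - a)).2 (by omega)
        simpa using this
      · rintro w ⟨hw, hd⟩
        rcases hsq w hw with rfl | rfl
        · exfalso
          have := (h4 (1 - a)).1 (by simpa using hd)
          omega
        · rfl
  · have hc : condT p = p := if_neg h2
    rw [hc, Nat.totient_prime hp]
    have hlt : ∀ x : ℤ_[p], ‖x‖ < 1 ↔ (p : ℤ_[p]) ∣ x := fun x => PadicInt.norm_lt_one_iff_dvd x
    have hunit : ∀ b : ℕ, ¬ p ∣ b → ‖(b : ℤ_[p])‖ = 1 := by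
      intro b hb
      have h1 : ¬ ‖(b : ℤ_[p])‖ < 1 := by
        have := PadicInt.norm_int_lt_one_iff_dvd (p := p) (b : ℤ)
        rw [Int.cast_natCast] at this
        rw [this]
        exact_mod_cast hb
      exact le_antisymm (PadicInt.norm_le_one _) (not_lt.1 h1)
    let F : Polynomial ℤ_[p] := Polynomial.X ^ (p - 1) - 1
    have hF : ∀ x : ℤ_[p], F.aeval x = x ^ (p - 1) - 1 := fun x => by simp [F]
    have hF' : ‖F.derivative.aeval (a : ℤ_[p])‖ = 1 := by
      have e1 : F.derivative.aeval (a : ℤ_[p]) = ((p - 1 : ℕ) : ℤ_[p]) * (a : ℤ_[p]) ^ (p - 1 - 1) := by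
        simp [F, Polynomial.derivative_X_pow]
      have hq : ¬ p ∣ p - 1 := by
        intro h
        have := Nat.le_of_dvd (by have := hp.two_le; omega) h
        have := hp.two_le
        omega
      rw [e1, norm_mul, norm_pow, hunit _ hq, hunit _ ha, one_pow, mul_one]
    have hFa : ‖F.aeval (a : ℤ_[p])‖ < 1 := by
      rw [hF, hlt]
      have h1 : a ^ (p - 1) ≡ 1 [MOD p] := by
        have := Nat.ModEq.pow_totient ((hp.coprime_iff_not_dvd.2 ha).symm)
        rwa [Nat.totient_prime hp] at this
      have h3 : (p : ℤ) ∣ (a : ℤ) ^ (p - 1) - 1 := by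
        have := (Nat.modEq_iff_dvd.1 h1.symm)
        simpa using this
      obtain ⟨y, hy⟩ := h3
      exact ⟨(y : ℤ_[p]), by exact_mod_cast congrArg (Int.cast : ℤ → ℤ_[p]) hy⟩
    obtain ⟨z, hz0, hz1, -, hz2⟩ := hensels_lemma (F := F) (a := (a : ℤ_[p])) (by
      rw [hF', one_pow]; exact hFa)
    rw [hF'] at hz1 hz2
    refine ⟨z, ⟨?_, (hlt _).1 hz1⟩, ?_⟩
    · rw [hF] at hz0
      exact sub_eq_zero.1 hz0
    · rintro w ⟨hw, hd⟩
      exact hz2 w (by rw [hF, hw, sub_self]) ((hlt _).2 hd)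

open Classical in
/-- The Teichmüller character `ω`: for `a` prime to `p`, the unique root of unity `ω(a)` in `ℤ_p` of
order dividing `φ(q)` with `ω(a) ≡ a` modulo `q`, where `q` is the conductor; it is `0` if
`p ∣ a`. -/
noncomputable def teich (a : ℕ) : ℤ_[p] :=
  if ha : ¬ p ∣ a then (existsUnique_teichmuller p a ha).choose else 0

/-- The binomial coefficient `binom(s, j)` for `s` in `ℤ_p`. -/
noncomputable def binom (s : ℤ_[p]) (j : ℕ) : ℚ_[p] := ((Ring.choose s j : ℤ_[p]) : ℚ_[p])

/-- `⟨a⟩ = a / ω(a)`. -/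
noncomputable def angle (a : ℕ) : ℚ_[p] := (a : ℚ_[p]) / (teich p a : ℚ_[p])

/-- `x ^ s = ∑ binom(s, j) (x - 1) ^ j` for a principal unit `x` and `s` in `ℤ_p`. -/
noncomputable def unitPow (x : ℚ_[p]) (s : ℤ_[p]) : ℚ_[p] :=
  ∑' j : ℕ, binom p s j * (x - 1) ^ j

/-- The Kubota-Leopoldt `p`-adic `L`-function `L_p(s, ω ^ i)` for `s ≠ 1` in `ℤ_p`:
`(1 / q) (1 / (s - 1)) ∑_{1 ≤ a ≤ q, p ∤ a} ω(a) ^ i ⟨a⟩ ^ (1 - s) ∑_j binom(1 - s, j) B_j (q / a) ^ j`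
with `q` the conductor of `ω`. -/
noncomputable def Lp (i : ℕ) (s : ℤ_[p]) : ℚ_[p] :=
  1 / (condT p : ℚ_[p]) * (1 / ((s : ℚ_[p]) - 1)) *
    ∑ a ∈ (Finset.Icc 1 (condT p)).filter (fun a => ¬ p ∣ a),
      (teich p a : ℚ_[p]) ^ i * unitPow p (angle p a) (1 - s) *
        ∑' j : ℕ, binom p (1 - s) j * ((bernoulli j : ℚ) : ℚ_[p]) *
          ((condT p : ℚ_[p]) / (a : ℚ_[p])) ^ j

/-- `D_p(n, ν)`. -/
noncomputable def Dp (n ν : ℕ) : ℚ_[p] :=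
  Lp p (1 + ν) (-(ν : ℤ_[p])) * Lp p (n - ν + 1) ((ν : ℤ_[p]) - n) / Lp p (n + 2) (-1 - (n : ℤ_[p]))
    - Lp p (1 + ν) (-(ν : ℤ_[p])) - Lp p (n - ν + 1) ((ν : ℤ_[p]) - n)

end Cycle

end EisPeriod

/-! Pairing the Eisenstein class with {α, β} ⊗ P gives the integral of E(z) P(z, 1) from α to β. The
map † solves the difference equation P†(z + 1) - P†(z) = P(z, 1). As E has period 1, the function
W_P(w) given by the integral of E P† from w to w + 1 is therefore a primitive of E P
(`hasDerivAt_unitPeriod`). In the corrected chain the term at w₁ cancels one end point of the path,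
and what remains is minus the sum of W for E⁽¹⁾ at (-1/τ₀ + j)/p^k and W for E⁽⁰⁾ at w₀. A matrix of
SL(2, ℤ) carries w₀ to the first point, and by modularity of E the two derivatives in τ₀ cancel
(`hasDerivAt_chainPeriod`). The pairing is thus a constant, which can be computed by letting τ₀ = iy
go to i∞.

Split W into a polynomial part, due to the constant term 1 of E, and a tail, due to E - 1. The tails
at w₀ die out. Summed over j, the tails at the other end are governed by the action of U on E
(`sum_unitPeriodTail`) and reduce to the tail of e_ν near the cusp 0. Its finite part is the
regularized period of E from 0 to i∞, a value of the completed L-function, which the functional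
equation of ζ turns into R = ζ(-ν)ζ(ν-n)/ζ(-1-n). The divergent powers of y are discarded together
by `eq_zero_of_tendsto_add_mul_pow`. The polynomial parts leave sums of Bernoulli polynomials,
controlled by the distribution relation. The sum over j is then the explicit rational number
`levelPeriod`.

The rest is p-adic. As k grows, power sums up to p^k tend to 0 and the other terms are geometric
sums or satisfy contracting recursions, so `levelPeriod` converges. The sum over k weighted by
powers of p^(n-ν) divides the limit by 1 - p^(n-ν). Since binom(m!, A) tends to 0 for each fixed A ≥
1, the ballot numbers tend to 1, -1, 0, 0, …, and the sum over A multiplies by 1 - p^(n+1)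
(`tendsto_ballot_sum`). Finally, the series defining the Kubota-Leopoldt functions terminate at the
arguments in question and give zeta values without their Euler factor at p (`Lp_neg_natCast`). -/

namespace EisPeriod

/-! ### Dehomogenization of binary forms -/

/-- The value `P(z, 1)` of a rational binary form. -/
noncomputable def ev {n : ℕ} (P : Form ℚ n) (z : ℂ) : ℂ :=
  MvPolynomial.aeval ![z, 1] (P : MvPolynomial (Fin 2) ℚ)

lemma form_eq_sum {R : Type} [CommRing R] {n : ℕ} (P : Form R n) :
    P = ∑ ν : Fin (n + 1), coef ν P • e R n ν := by
  have he : ∀ ν : Fin (n + 1), ((e R n ν : Form R n) : MvPolynomial (Fin 2) R) =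
      MvPolynomial.monomial (expo n ν) 1 := by
    intro ν
    rw [expo, ← one_mul (1 : R), ← MvPolynomial.monomial_mul, ← MvPolynomial.X_pow_eq_monomial,
      ← MvPolynomial.X_pow_eq_monomial]
    rfl
  apply Subtype.ext
  rw [Submodule.coe_sum]
  ext m
  rw [MvPolynomial.coeff_sum]
  simp only [Submodule.coe_smul, he, MvPolynomial.coeff_smul, MvPolynomial.coeff_monomial,
    smul_eq_mul, mul_ite, mul_one, mul_zero]
  by_cases hm : m.degree = n
  · have h01 : m 0 + m 1 = n := by
      rw [← hm, Finsupp.degree_eq_sum, Fin.sum_univ_two]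
    have hme : m = expo n ⟨m 0, by omega⟩ := by
      ext i
      fin_cases i
      · simp [expo]
      · simp [expo]; omega
    rw [Finset.sum_eq_single ⟨m 0, by omega⟩]
    · rw [if_pos hme.symm, coef, ← hme]
    · intro κ _ hκ
      rw [if_neg]
      intro h
      apply hκ
      apply Fin.ext
      simp [← h, expo]
    · simp
  · rw [MvPolynomial.IsHomogeneous.coeff_eq_zero P.2 hm]
    symm
    apply Finset.sum_eq_zero
    intro κ _
    rw [if_neg]
    rintro rfl
    apply hm
    have := κ.2
    simp [expo, Finsupp.degree_eq_sum]
    omega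

lemma ev_e (n : ℕ) (ν : Fin (n + 1)) (z : ℂ) : ev (e ℚ n ν) z = z ^ (ν : ℕ) := by
  simp [ev, e]

lemma ev_sum {n : ℕ} {ι : Type*} (s : Finset ι) (P : ι → Form ℚ n) (z : ℂ) :
    ev (∑ i ∈ s, P i) z = ∑ i ∈ s, ev (P i) z := by
  simp [ev, map_sum]

lemma ev_smul {n : ℕ} (c : ℚ) (P : Form ℚ n) (z : ℂ) : ev (c • P) z = (c : ℂ) * ev P z := by
  simp [ev, Algebra.smul_def]

lemma ev_eq_sum {n : ℕ} (P : Form ℚ n) (z : ℂ) :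
    ev P z = ∑ ν : Fin (n + 1), ((coef ν P : ℚ) : ℂ) * z ^ (ν : ℕ) := by
  conv_lhs => rw [form_eq_sum P]
  simp only [ev_sum, ev_smul, ev_e]

lemma differentiable_ev {n : ℕ} (P : Form ℚ n) : Differentiable ℂ (ev P) := by
  have : ev P = fun z => ∑ ν : Fin (n + 1), ((coef ν P : ℚ) : ℂ) * z ^ (ν : ℕ) := funext (ev_eq_sum P)
  rw [this]
  fun_prop

/-- Binomial theorem. Evenness of n identifies the sign (-1)^(n-ν) of the dual basis with the sign
(-1)^ν of the expansion, so that pairing with (X₁ - z X₂)^n is evaluation at (z, 1). -/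
lemma coef_kernelForm {n : ℕ} (hn : Even n) (z : ℂ) (ν : Fin (n + 1)) :
    coef ν.rev (kernelForm n z) / ((-1 : ℂ) ^ (n - ν : ℕ) * (n.choose ν : ℂ)) = z ^ (ν : ℕ) := by
  have hle : (ν : ℕ) ≤ n := Nat.lt_succ_iff.mp ν.2
  have h1 : (kernelForm n z : Form ℂ n) =
      ∑ κ : Fin (n + 1), ((-z) ^ (κ : ℕ) * (n.choose κ : ℂ)) • e ℂ n κ.rev := by
    apply Subtype.ext
    rw [Submodule.coe_sum]
    change (MvPolynomial.X 0 - MvPolynomial.C z * MvPolynomial.X 1) ^ n = _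
    rw [sub_eq_add_neg, add_comm, add_pow, Finset.sum_range]
    apply Finset.sum_congr rfl
    intro κ _
    have hκ : (κ : ℕ) ≤ n := Nat.lt_succ_iff.mp κ.2
    rw [Submodule.coe_smul, MvPolynomial.smul_eq_C_mul, ← neg_mul, mul_pow, ← MvPolynomial.C_neg]
    simp only [e, Fin.val_rev, MvPolynomial.C_mul, MvPolynomial.C_pow]
    rw [show n + 1 - (κ + 1 : ℕ) = n - κ by omega, show n - (n - (κ : ℕ)) = κ by omega,
      map_natCast]
    ring
  have hs : ∀ (c : ℂ) (κ : Fin (n + 1)) (P : Form ℂ n), coef κ (c • P) = c * coef κ P := by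
    intro c κ P; simp [coef]
  have hsum : ∀ (κ : Fin (n + 1)) (P : Fin (n + 1) → Form ℂ n),
      coef κ (∑ i, P i) = ∑ i, coef κ (P i) := by
    intro κ P; simp [coef, MvPolynomial.coeff_sum]
  rw [h1, hsum]
  simp only [hs, coef_e, Fin.rev_inj, mul_ite, mul_one, mul_zero, Finset.sum_ite_eq,
    Finset.mem_univ, if_true]
  have hc : (n.choose ν : ℂ) ≠ 0 := by exact_mod_cast (Nat.choose_pos hle).ne'
  have hsign : (-1 : ℂ) ^ (n - ν : ℕ) = (-1) ^ (ν : ℕ) := by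
    have : (-1 : ℂ) ^ (n - ν : ℕ) * (-1) ^ (ν : ℕ) = 1 := by
      rw [← pow_add, Nat.sub_add_cancel hle, hn.neg_one_pow]
    have h2 : (-1 : ℂ) ^ (ν : ℕ) * (-1) ^ (ν : ℕ) = 1 := by
      rw [← mul_pow]; simp
    calc _ = (-1 : ℂ) ^ (n - ν : ℕ) * ((-1) ^ (ν : ℕ) * (-1) ^ (ν : ℕ)) := by rw [h2, mul_one]
      _ = _ := by rw [← mul_assoc, this, one_mul]
  rw [hsign, mul_div_mul_right _ _ hc, neg_pow, mul_div_cancel_left₀ _ (by simp)]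

/-! ### Integrals along segments -/

lemma segment_mem {a b : ℂ} (ha : 0 < a.im) (hb : 0 < b.im) {t : ℝ}
    (ht : t ∈ Set.uIcc (0 : ℝ) 1) : 0 < (a + t * (b - a)).im := by
  rw [Set.uIcc_of_le zero_le_one] at ht
  have h := convex_halfSpace_im_gt 0 ha hb (sub_nonneg.2 ht.2) ht.1 (by ring)
  have e : a + t * (b - a) = (1 - t) • a + t • b := by
    simp only [Complex.real_smul, Complex.ofReal_sub, Complex.ofReal_one]
    ring
  rw [e]
  exact h

lemma intervalIntegrable_segment {g : ℂ → ℂ} (hg : ContinuousOn g {z | 0 < z.im}) {a b : ℂ}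
    (ha : 0 < a.im) (hb : 0 < b.im) :
    IntervalIntegrable (fun t : ℝ => g (a + t * (b - a))) MeasureTheory.volume 0 1 := by
  apply ContinuousOn.intervalIntegrable
  apply hg.comp (by fun_prop)
  intro t ht
  exact segment_mem ha hb ht

lemma segInt_finset_sum {ι : Type*} (s : Finset ι) {g : ι → ℂ → ℂ}
    (hg : ∀ i ∈ s, ContinuousOn (g i) {z | 0 < z.im}) {a b : ℂ}
    (ha : 0 < a.im) (hb : 0 < b.im) :
    segInt (fun z => ∑ i ∈ s, g i z) a b = ∑ i ∈ s, segInt (g i) a b := by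
  simp only [segInt]
  rw [intervalIntegral.integral_finsetSum, Finset.mul_sum]
  intro i hi
  exact intervalIntegrable_segment (hg i hi) ha hb

lemma segInt_const_mul (c : ℂ) (g : ℂ → ℂ) (a b : ℂ) :
    segInt (fun z => c * g z) a b = c * segInt g a b := by
  simp only [segInt, intervalIntegral.integral_const_mul]
  ring

lemma segInt_sub {g h : ℂ → ℂ} (hg : ContinuousOn g {z | 0 < z.im})
    (hh : ContinuousOn h {z | 0 < z.im}) {a b : ℂ} (ha : 0 < a.im) (hb : 0 < b.im) :
    segInt (fun z => g z - h z) a b = segInt g a b - segInt h a b := by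
  simp only [segInt]
  rw [intervalIntegral.integral_sub (intervalIntegrable_segment hg ha hb)
    (intervalIntegrable_segment hh ha hb), mul_sub]

/-- A holomorphic function on the upper half plane has a primitive, which computes its integrals
along segments. -/
lemma exists_primitive {g : ℂ → ℂ} (hg : DifferentiableOn ℂ g {z | 0 < z.im}) :
    ∃ G : ℂ → ℂ, (∀ z : ℂ, 0 < z.im → HasDerivAt G (g z) z) ∧
      ∀ a b : ℂ, 0 < a.im → 0 < b.im → segInt g a b = G b - G a := by
  obtain ⟨G, hG⟩ := (convex_halfSpace_im_gt 0).exists_forall_hasDerivWithinAt hg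
  have hopen : IsOpen {z : ℂ | 0 < z.im} := isOpen_lt continuous_const Complex.continuous_im
  have hG' : ∀ z : ℂ, 0 < z.im → HasDerivAt G (g z) z := fun z hz =>
    (hG z hz).hasDerivAt (hopen.mem_nhds hz)
  refine ⟨G, hG', fun a b ha hb => ?_⟩
  have hline : ∀ t : ℝ, HasDerivAt (fun t : ℝ => a + t * (b - a)) (b - a) t := by
    intro t
    have h := ((Complex.ofRealCLM.hasDerivAt (x := t)).mul_const (b - a)).const_add a
    simpa using h
  have hderiv : ∀ t ∈ Set.uIcc (0 : ℝ) 1,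
      HasDerivAt (fun t : ℝ => G (a + t * (b - a))) (g (a + t * (b - a)) * (b - a)) t :=
    fun t ht => (hG' _ (segment_mem ha hb ht)).comp t (hline t)
  have h := intervalIntegral.integral_eq_sub_of_hasDerivAt hderiv
    ((intervalIntegrable_segment hg.continuousOn ha hb).mul_const _)
  rw [intervalIntegral.integral_mul_const] at h
  rw [segInt, mul_comm, h]
  simp

lemma segInt_of_hasDerivAt {g G : ℂ → ℂ} (hG : ∀ z, HasDerivAt G (g z) z) (hg : Continuous g)
    (a b : ℂ) : segInt g a b = G b - G a := by
  have hline : ∀ t : ℝ, HasDerivAt (fun t : ℝ => a + t * (b - a)) (b - a) t := by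
    intro t
    have h := ((Complex.ofRealCLM.hasDerivAt (x := t)).mul_const (b - a)).const_add a
    simpa using h
  have hderiv : ∀ t ∈ Set.uIcc (0 : ℝ) 1,
      HasDerivAt (fun t : ℝ => G (a + t * (b - a))) (g (a + t * (b - a)) * (b - a)) t :=
    fun t ht => (hG _).comp t (hline t)
  have h := intervalIntegral.integral_eq_sub_of_hasDerivAt hderiv
    (Continuous.intervalIntegrable (by fun_prop) _ _)
  rw [intervalIntegral.integral_mul_const] at h
  rw [segInt, mul_comm, h]
  simp

/-! ### The pairing of an Eichler-Shimura class with a modular symbol -/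

lemma formPairing_formIntegral {n : ℕ} (hn : Even n) {f : ℍ → ℂ}
    (hf : DifferentiableOn ℂ (fun z => f (UpperHalfPlane.ofComplex z)) {z | 0 < z.im})
    (α β : ℍ) (P : Form ℚ n) :
    formPairing n (formIntegral n f α β) P =
      segInt (fun z => f (UpperHalfPlane.ofComplex z) * ev P z) α β := by
  have hs : ∀ (c : ℂ) (κ : Fin (n + 1)) (P : Form ℂ n), coef κ (c • P) = c * coef κ P := by
    intro c κ P; simp [coef]
  have hsum : ∀ (κ : Fin (n + 1)) (P : Fin (n + 1) → Form ℂ n),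
      coef κ (∑ i, P i) = ∑ i, coef κ (P i) := by
    intro κ P; simp [coef, MvPolynomial.coeff_sum]
  have hco : ∀ κ : Fin (n + 1), coef κ (formIntegral n f α β) =
      segInt (fun z => f (UpperHalfPlane.ofComplex z) * coef κ (kernelForm n z)) α β := by
    intro κ
    rw [formIntegral, hsum]
    simp only [hs, coef_e, mul_ite, mul_one, mul_zero, Finset.sum_ite_eq, Finset.mem_univ, if_true]
  simp only [formPairing, LinearMap.mk₂_apply, hco]
  have hev : (fun z => f (UpperHalfPlane.ofComplex z) * ev P z) = fun z =>
      ∑ ν : Fin (n + 1), (((coef ν P : ℚ) : ℂ) / ((-1 : ℂ) ^ (n - ν : ℕ) * (n.choose ν : ℂ))) *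
        (f (UpperHalfPlane.ofComplex z) * coef ν.rev (kernelForm n z)) := by
    funext z
    rw [ev_eq_sum, Finset.mul_sum]
    apply Finset.sum_congr rfl
    intro ν _
    rw [← coef_kernelForm hn z ν]
    ring
  rw [hev, segInt_finset_sum]
  · apply Finset.sum_congr rfl
    intro ν _
    rw [segInt_const_mul]
    ring
  · intro ν _
    exact continuousOn_const.mul
      (hf.mul (differentiable_coef_kernelForm n ν.rev).differentiableOn).continuousOn
  · exact α.im_pos
  · exact β.im_pos

/-! ### The map `P ↦ P†` -/

lemma natDegree_bernoulli_le (t : ℕ) : (Polynomial.bernoulli t).natDegree ≤ t := by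
  rw [Polynomial.natDegree_le_iff_coeff_eq_zero]
  intro N hN
  rw [Polynomial.coeff_bernoulli, if_neg (by omega)]

lemma ev_homogenize {n : ℕ} {F : Polynomial ℚ} (hF : F.natDegree ≤ n) (z : ℂ) :
    ev (homogenize n F) z = Polynomial.aeval z F := by
  rw [homogenize, ev_sum, Polynomial.aeval_eq_sum_range' (Nat.lt_succ_of_le hF),
    Finset.sum_range]
  apply Finset.sum_congr rfl
  intro i _
  rw [ev_smul, ev_e, Algebra.smul_def]
  rfl

lemma natDegree_bernTilde_le (t : ℕ) : (bernTilde t).natDegree ≤ t := by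
  rw [bernTilde]
  refine (Polynomial.natDegree_C_mul_le _ _).trans ?_
  rw [Polynomial.natDegree_sub_C]
  exact natDegree_bernoulli_le t

lemma aeval_bernoulli_add_one (t : ℕ) (z : ℂ) :
    Polynomial.aeval (z + 1) (Polynomial.bernoulli t) =
      Polynomial.aeval z (Polynomial.bernoulli t) + t * z ^ (t - 1) := by
  have h := congrArg (Polynomial.aeval z) (Polynomial.bernoulli_comp_one_add_X t)
  rw [Polynomial.aeval_comp] at h
  simpa [add_comm] using h

lemma aeval_bernTilde (t : ℕ) (z : ℂ) :
    Polynomial.aeval z (bernTilde t) =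
      (Polynomial.aeval z (Polynomial.bernoulli t) - (bernoulli t : ℚ)) / t := by
  rw [bernTilde]
  simp only [map_mul, map_sub, Polynomial.aeval_C]
  simp
  ring

/-- This difference equation is the reason for Bernoulli polynomials in the definition of †. -/
lemma aeval_bernTilde_succ (μ : ℕ) (z : ℂ) :
    Polynomial.aeval (z + 1) (bernTilde (μ + 1)) =
      Polynomial.aeval z (bernTilde (μ + 1)) + z ^ μ := by
  rw [aeval_bernTilde, aeval_bernTilde, aeval_bernoulli_add_one]
  have : ((μ : ℂ) + 1) ≠ 0 := by exact_mod_cast Nat.succ_ne_zero μ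
  push_cast
  field_simp
  ring

lemma hasDerivAt_aeval_bernoulli (t : ℕ) (z : ℂ) :
    HasDerivAt (fun z : ℂ => Polynomial.aeval z (Polynomial.bernoulli (t + 1)) / (t + 1))
      (Polynomial.aeval z (Polynomial.bernoulli t)) z := by
  have h := ((Polynomial.bernoulli (t + 1)).hasDerivAt_aeval z).div_const ((t : ℂ) + 1)
  convert! h using 1
  have : ((t : ℂ) + 1) ≠ 0 := by exact_mod_cast Nat.succ_ne_zero t
  rw [Polynomial.derivative_bernoulli_add_one]
  simp [this]

/-- A primitive of B_t is B_{t+1}/(t + 1), and its increment over a unit step is w^t. -/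
lemma segInt_bernTilde (μ : ℕ) (w : ℂ) :
    segInt (fun z => Polynomial.aeval z (bernTilde (μ + 1))) w (w + 1) =
      (w ^ (μ + 1) - (bernoulli (μ + 1) : ℚ)) / (μ + 1) := by
  set b : ℂ := ((bernoulli (μ + 1) : ℚ) : ℂ) with hb
  have hG : ∀ z : ℂ, HasDerivAt (fun z : ℂ =>
      (Polynomial.aeval z (Polynomial.bernoulli (μ + 1 + 1)) / ((μ + 1 : ℕ) + 1) - b * z) /
        ((μ + 1 : ℕ) : ℂ)) (Polynomial.aeval z (bernTilde (μ + 1))) z := by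
    intro z
    rw [aeval_bernTilde]
    exact ((hasDerivAt_aeval_bernoulli (μ + 1) z).sub
      (by simpa using (hasDerivAt_id z).const_mul b)).div_const _
  rw [segInt_of_hasDerivAt hG (by fun_prop), aeval_bernoulli_add_one]
  have : ((μ : ℂ) + 1) ≠ 0 := by exact_mod_cast Nat.succ_ne_zero μ
  have : ((μ : ℂ) + 1 + 1) ≠ 0 := by exact_mod_cast Nat.succ_ne_zero (μ + 1)
  push_cast
  field_simp
  ring

lemma ev_dagger {n : ℕ} (P : Form ℚ n) (z : ℂ) :
    ev (dagger P) z = ∑ μ : Fin n, ((coef μ.castSucc P : ℚ) : ℂ) *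
      Polynomial.aeval z (bernTilde (μ + 1)) := by
  rw [dagger, ev_sum]
  apply Finset.sum_congr rfl
  intro μ _
  rw [ev_smul, ev_homogenize]
  exact (natDegree_bernTilde_le _).trans μ.2

lemma ev_eq_sum_of_coef_last {n : ℕ} {P : Form ℚ n} (hP : coef (Fin.last n) P = 0) (z : ℂ) :
    ev P z = ∑ μ : Fin n, ((coef μ.castSucc P : ℚ) : ℂ) * z ^ (μ : ℕ) := by
  rw [ev_eq_sum, Fin.sum_univ_castSucc, hP]
  simp

/-- The defining property of †, by linearity from monomials. The coefficient of X₁^n must vanish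
because † drops it. -/
lemma ev_dagger_add_one {n : ℕ} {P : Form ℚ n} (hP : coef (Fin.last n) P = 0) (z : ℂ) :
    ev (dagger P) (z + 1) - ev (dagger P) z = ev P z := by
  rw [ev_dagger, ev_dagger, ev_eq_sum_of_coef_last hP, ← Finset.sum_sub_distrib]
  apply Finset.sum_congr rfl
  intro μ _
  rw [aeval_bernTilde_succ]
  ring

lemma segInt_ev_dagger {n : ℕ} (P : Form ℚ n) {w : ℂ} (hw : 0 < w.im) :
    segInt (ev (dagger P)) w (w + 1) = ∑ μ : Fin n, ((coef μ.castSucc P : ℚ) : ℂ) *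
      ((w ^ ((μ : ℕ) + 1) - (bernoulli (μ + 1) : ℚ)) / (μ + 1)) := by
  have : ev (dagger P) = fun z => ∑ μ : Fin n, ((coef μ.castSucc P : ℚ) : ℂ) *
      Polynomial.aeval z (bernTilde (μ + 1)) := funext (ev_dagger P)
  rw [this, segInt_finset_sum]
  · apply Finset.sum_congr rfl
    intro μ _
    rw [segInt_const_mul, segInt_bernTilde]
  · intro μ _
    apply Continuous.continuousOn
    fun_prop
  · exact hw
  · simpa using hw

/-- A form is determined by its values P(z, 1), so coefficients can be read off from any formula for
these values. -/
lemma coef_eq_of_ev {n : ℕ} (P : Form ℚ n) (F : Polynomial ℚ)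
    (h : ∀ z : ℂ, ev P z = Polynomial.aeval z F) (ν : Fin (n + 1)) : coef ν P = F.coeff ν := by
  have h1 : (∑ κ : Fin (n + 1), Polynomial.monomial κ (coef κ P)) = F := by
    apply Polynomial.map_injective (algebraMap ℚ ℂ) (algebraMap ℚ ℂ).injective
    apply Polynomial.funext
    intro z
    rw [Polynomial.eval_map_algebraMap, Polynomial.eval_map_algebraMap, ← h, ev_eq_sum, map_sum]
    apply Finset.sum_congr rfl
    intro κ _
    rw [Polynomial.aeval_monomial]
    rfl
  rw [← h1, Polynomial.finsetSum_coeff]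
  simp only [Polynomial.coeff_monomial, Fin.val_inj, Finset.sum_ite_eq', Finset.mem_univ, if_true]

lemma coeff_linear_pow (a b : ℚ) (r i : ℕ) :
    ((Polynomial.C a * Polynomial.X + Polynomial.C b) ^ r).coeff i =
      a ^ i * b ^ (r - i) * r.choose i := by
  rw [add_pow, Polynomial.finsetSum_coeff]
  have h : ∀ m ∈ Finset.range (r + 1), ((Polynomial.C a * Polynomial.X) ^ m * Polynomial.C b ^ (r - m) *
      (r.choose m : Polynomial ℚ)).coeff i = if i = m then a ^ i * b ^ (r - i) * r.choose i else 0 := by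
    intro m _
    rw [mul_pow, ← Polynomial.C_pow, ← Polynomial.C_pow, ← map_natCast Polynomial.C, mul_assoc,
      ← Polynomial.C_mul, mul_assoc, Polynomial.coeff_C_mul, Polynomial.coeff_mul_C,
      Polynomial.coeff_X_pow]
    split_ifs with h
    · subst h; ring
    · ring
  rw [Finset.sum_congr rfl h, Finset.sum_ite_eq]
  split_ifs with h
  · rfl
  · rw [Nat.choose_eq_zero_of_lt (by simpa using h)]
    simp

lemma coef_linear_pow {n r : ℕ} {P : Form ℚ n} {a b c : ℚ}
    (h : ∀ z : ℂ, ev P z = c * (a * z + b) ^ r) (ν : Fin (n + 1)) :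
    coef ν P = c * (a ^ (ν : ℕ) * b ^ (r - ν) * r.choose ν) := by
  rw [coef_eq_of_ev P (Polynomial.C c * (Polynomial.C a * Polynomial.X + Polynomial.C b) ^ r),
    Polynomial.coeff_C_mul, coeff_linear_pow]
  intro z
  rw [h]
  simp

lemma coef_last_linear_pow {n r : ℕ} (hr : r < n) {P : Form ℚ n} {a b c : ℚ}
    (h : ∀ z : ℂ, ev P z = c * (a * z + b) ^ r) : coef (Fin.last n) P = 0 := by
  rw [coef_linear_pow h, Nat.choose_eq_zero_of_lt (by simpa using hr)]
  simp

lemma bernoulli_eval_eq_sum (t : ℕ) (x : ℚ) :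
    (Polynomial.bernoulli t).eval x =
      ∑ i ∈ Finset.range (t + 1), bernoulli i * t.choose i * x ^ (t - i) := by
  rw [Polynomial.bernoulli, Polynomial.eval_finsetSum]
  simp [Polynomial.eval_monomial]

/-- The polynomial part of the integral of `P†` for `P = c (a X₁ + b X₂) ^ r X₂ ^ (n - r)`. -/
lemma segInt_ev_dagger_linear_pow {n r : ℕ} (hr : r < n) {P : Form ℚ n} {a b c : ℚ} (ha : a ≠ 0)
    (h : ∀ z : ℂ, ev P z = c * (a * z + b) ^ r) {w : ℂ} (hw : 0 < w.im) :
    segInt (ev (dagger P)) w (w + 1) = c * (a * w + b) ^ (r + 1) / (a * (r + 1)) -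
      ((c * a ^ r * (Polynomial.bernoulli (r + 1)).eval (b / a) / (r + 1) : ℚ) : ℂ) := by
  have hr1 : ((r : ℂ) + 1) ≠ 0 := by exact_mod_cast Nat.succ_ne_zero r
  have ha' : (a : ℂ) ≠ 0 := by exact_mod_cast ha
  rw [segInt_ev_dagger P hw]
  -- The identity binom(r, μ)/(μ + 1) = binom(r + 1, μ + 1)/(r + 1) produces a binomial expansion of
  -- exponent r + 1.
  have h1 : ∀ μ : Fin n, ((coef μ.castSucc P : ℚ) : ℂ) *
      ((w ^ ((μ : ℕ) + 1) - (bernoulli (μ + 1) : ℚ)) / (μ + 1)) =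
      c / (a * (r + 1)) * ((a : ℂ) ^ ((μ : ℕ) + 1) * (b : ℂ) ^ (r + 1 - ((μ : ℕ) + 1)) *
        ((r + 1).choose (μ + 1) : ℂ) * (w ^ ((μ : ℕ) + 1) - (bernoulli (μ + 1) : ℚ))) := by
    intro μ
    rw [coef_linear_pow h]
    have hμ : ((μ : ℂ) + 1) ≠ 0 := by exact_mod_cast Nat.succ_ne_zero (μ : ℕ)
    have hch : (((r + 1).choose (μ + 1) : ℕ) : ℂ) * (μ + 1) = (r + 1) * (r.choose μ : ℕ) := by
      exact_mod_cast (Nat.add_one_mul_choose_eq r μ).symm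
    simp only [Fin.val_castSucc, Nat.add_sub_add_right]
    push_cast
    field_simp
    linear_combination (-(c : ℂ) * a ^ ((μ : ℕ) + 1) * b ^ (r - (μ : ℕ)) *
      (w ^ ((μ : ℕ) + 1) - (bernoulli ((μ : ℕ) + 1) : ℚ))) * hch
  rw [Finset.sum_congr rfl (fun μ _ => h1 μ), ← Finset.mul_sum,
    ← Finset.sum_range (fun μ => (a : ℂ) ^ (μ + 1) * (b : ℂ) ^ (r + 1 - (μ + 1)) *
        ((r + 1).choose (μ + 1) : ℂ) * (w ^ (μ + 1) - (bernoulli (μ + 1) : ℚ)))]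
  -- The added index i = 0 contributes w^0 - B_0 = 0, and the indices beyond r + 1 have zero
  -- binomial coefficient.
  have h2 : ∑ μ ∈ Finset.range n, ((a : ℂ) ^ (μ + 1) * (b : ℂ) ^ (r + 1 - (μ + 1)) *
        ((r + 1).choose (μ + 1) : ℂ) * (w ^ (μ + 1) - (bernoulli (μ + 1) : ℚ))) =
      ∑ i ∈ Finset.range (r + 1 + 1), ((a : ℂ) ^ i * (b : ℂ) ^ (r + 1 - i) *
        ((r + 1).choose i : ℂ) * (w ^ i - (bernoulli i : ℚ))) := by
    rw [Finset.sum_range_succ' _ (r + 1)]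
    simp only [pow_zero, bernoulli_zero, Rat.cast_one, sub_self, mul_zero, add_zero]
    symm
    apply Finset.sum_subset (Finset.range_mono hr)
    intro i _ hi
    rw [Nat.choose_eq_zero_of_lt (by simp at hi; omega)]
    simp
  rw [h2, bernoulli_eval_eq_sum]
  simp only [mul_sub, Finset.sum_sub_distrib]
  rw [add_pow]
  push_cast
  rw [mul_div_right_comm, Finset.mul_sum]
  simp only [mul_pow]
  rw [show (c : ℂ) * a ^ r * (∑ i ∈ Finset.range (r + 1 + 1), ((bernoulli i : ℚ) : ℂ) *
      ((r + 1).choose i : ℂ) * ((b : ℂ) / a) ^ (r + 1 - i)) / (r + 1) = c / (a * (r + 1)) *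
      ∑ i ∈ Finset.range (r + 1 + 1), (a : ℂ) ^ (r + 1) * (((bernoulli i : ℚ) : ℂ) *
      ((r + 1).choose i : ℂ) * ((b : ℂ) / a) ^ (r + 1 - i)) by
    rw [← Finset.mul_sum, pow_succ]; field_simp]
  rw [← Finset.mul_sum]
  congr 2
  · apply Finset.sum_congr rfl
    intro i _
    ring
  · apply Finset.sum_congr rfl
    intro i hi
    have hi' : i ≤ r + 1 := by simpa [Nat.lt_succ_iff] using hi
    rw [div_pow]
    have : (a : ℂ) ^ (r + 1) = a ^ i * a ^ (r + 1 - i) := by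
      rw [← pow_add, Nat.add_sub_cancel' hi']
    rw [this]
    field_simp

/-! ### The Eisenstein series as a function of a complex variable -/

/-- The Eisenstein series of weight `n + 2` as a function on `ℂ`. -/
noncomputable def eisFun (n : ℕ) (hn : 2 ≤ n) (z : ℂ) : ℂ :=
  ModularForm.E (k := n + 2) (by omega) (UpperHalfPlane.ofComplex z)

section EisensteinFunction

variable {n : ℕ} {hn : 2 ≤ n}

lemma isOpen_im_pos : IsOpen {z : ℂ | 0 < z.im} :=
  isOpen_lt continuous_const Complex.continuous_im

lemma differentiableOn_eisFun : DifferentiableOn ℂ (eisFun n hn) {z | 0 < z.im} :=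
  UpperHalfPlane.mdifferentiable_iff.mp (ModularForm.E (k := n + 2) (by omega)).holo'

lemma eisFun_coe (z : ℍ) : eisFun n hn z = ModularForm.E (k := n + 2) (by omega) z := by
  simp [eisFun]

lemma eisFun_moebius {a b c d : ℤ} (hdet : a * d - b * c = 1) {z w : ℂ} (hz : 0 < z.im)
    (hw : w = (a * z + b) / (c * z + d)) :
    0 < w.im ∧ eisFun n hn w = (c * z + d) ^ (n + 2) * eisFun n hn z := by
  let γ : SL(2, ℤ) := ⟨!![a, b; c, d], by rw [Matrix.det_fin_two_of, hdet]⟩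
  let τ : ℍ := ⟨z, hz⟩
  have hγ : ((γ • τ : ℍ) : ℂ) = w := by
    rw [UpperHalfPlane.coe_specialLinearGroup_apply, hw]
    simp [γ, τ]
  have h := SlashInvariantForm.slash_action_eqn' (Γ := 𝒮ℒ)
    (ModularForm.E (k := n + 2) (by omega)) (γ := (γ : GL (Fin 2) ℝ)) ⟨γ, rfl⟩ τ
  refine ⟨hγ ▸ (γ • τ).im_pos, ?_⟩
  rw [← hγ, eisFun_coe, show z = (τ : ℂ) from rfl, eisFun_coe]
  have e : γ • τ = (γ : GL (Fin 2) ℝ) • τ := rfl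
  have e10 : ((γ : GL (Fin 2) ℝ) 1 0 : ℝ) = c := rfl
  have e11 : ((γ : GL (Fin 2) ℝ) 1 1 : ℝ) = d := rfl
  rw [e, h, zpow_natCast, e10, e11]
  simp

lemma eisFun_add_one {z : ℂ} (hz : 0 < z.im) : eisFun n hn (z + 1) = eisFun n hn z := by
  have h := (eisFun_moebius (n := n) (hn := hn) (a := 1) (b := 1) (c := 0) (d := 1) (by norm_num)
    hz (w := z + 1) (by simp)).2
  simpa using h

lemma valueAtInfty_E (he : Even n) :
    UpperHalfPlane.valueAtInfty (ModularForm.E (k := n + 2) (by omega)) = 1 := by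
  have hk : 3 ≤ n + 2 := by omega
  have h1 : (1 : ℝ) ∈ (𝒮ℒ).strictPeriods := by simp
  rw [← UpperHalfPlane.qExpansion_coeff_zero one_pos
    (ModularFormClass.analyticAt_cuspFunction_zero (ModularForm.E hk) one_pos h1)
    (SlashInvariantFormClass.periodic_comp_ofComplex (ModularForm.E hk) h1),
    EisensteinSeries.E_qExpansion_coeff_zero hk (he.add even_two)]

lemma eisFun_decay (he : Even n) :
    ∃ c > 0, ∃ C A : ℝ, 0 < A ∧ 0 ≤ C ∧
      ∀ z : ℂ, A ≤ z.im → ‖eisFun n hn z - 1‖ ≤ C * Real.exp (-c * z.im) := by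
  obtain ⟨c, hc, h⟩ := ModularFormClass.exp_decay_sub_atImInfty' (Γ := 𝒮ℒ)
    (k := ((n + 2 : ℕ) : ℤ)) (ModularForm.E (k := n + 2) (by omega))
  rw [valueAtInfty_E (hn := hn) he] at h
  obtain ⟨C, hC, h⟩ := h.exists_nonneg
  have h2 := h.bound
  rw [Filter.Eventually, UpperHalfPlane.atImInfty_mem] at h2
  obtain ⟨A, hA⟩ := h2
  refine ⟨c, hc, C, max A 1, by positivity, hC, fun z hz => ?_⟩
  have hz0 : 0 < z.im := by linarith [le_max_right A 1]
  have h3 := hA ⟨z, hz0⟩ (by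
    change A ≤ z.im
    linarith [le_max_left A 1])
  simp only [Set.mem_ofPred_eq, Real.norm_eq_abs, Real.abs_exp] at h3
  rw [eisFun, UpperHalfPlane.ofComplex_apply_of_im_pos hz0]
  exact h3

/-! ### Integrals of the Eisenstein series over a period -/

/-- The integral of `E(z) P†(z, 1)` from `w` to `w + 1`. -/
noncomputable def unitPeriod (n : ℕ) (hn : 2 ≤ n) (P : Form ℚ n) (w : ℂ) : ℂ :=
  segInt (fun z => eisFun n hn z * ev (dagger P) z) w (w + 1)

/-- The integral of `(E(z) - 1) P†(z, 1)` from `w` to `w + 1`. -/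
noncomputable def unitPeriodTail (n : ℕ) (hn : 2 ≤ n) (P : Form ℚ n) (w : ℂ) : ℂ :=
  segInt (fun z => (eisFun n hn z - 1) * ev (dagger P) z) w (w + 1)

lemma im_add_one {w : ℂ} (hw : 0 < w.im) : 0 < (w + 1).im := by simpa using hw

lemma hasDerivAt_segInt_add_one {g : ℂ → ℂ} (hg : DifferentiableOn ℂ g {z | 0 < z.im}) {w : ℂ}
    (hw : 0 < w.im) :
    HasDerivAt (fun w => segInt g w (w + 1)) (g (w + 1) - g w) w := by
  obtain ⟨G, hG, hG'⟩ := exists_primitive hg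
  have h1 : HasDerivAt (fun w => G (w + 1) - G w) (g (w + 1) - g w) w :=
    ((hG _ (im_add_one hw)).comp_add_const w 1).sub (hG w hw)
  apply h1.congr_of_eventuallyEq
  filter_upwards [isOpen_im_pos.mem_nhds hw] with z hz
  exact hG' z (z + 1) hz (im_add_one hz)

lemma differentiableOn_eisFun_mul_ev (P : Form ℚ n) :
    DifferentiableOn ℂ (fun z => eisFun n hn z * ev P z) {z | 0 < z.im} :=
  differentiableOn_eisFun.mul (differentiable_ev P).differentiableOn

lemma differentiableOn_eisFun_sub_mul_ev (P : Form ℚ n) :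
    DifferentiableOn ℂ (fun z => (eisFun n hn z - 1) * ev P z) {z | 0 < z.im} :=
  (differentiableOn_eisFun.sub_const 1).mul (differentiable_ev P).differentiableOn

/-- Since E has period 1, differentiating at both ends gives E(w)(P†(w + 1) - P†(w)). The unit
period is thus a primitive of E P normalized at i∞, where it is a polynomial up to a decaying term.
-/
lemma hasDerivAt_unitPeriod {P : Form ℚ n} (hP : coef (Fin.last n) P = 0) {w : ℂ}
    (hw : 0 < w.im) : HasDerivAt (unitPeriod n hn P) (eisFun n hn w * ev P w) w := by
  have h := hasDerivAt_segInt_add_one (differentiableOn_eisFun_mul_ev (hn := hn) (dagger P)) hw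
  rw [eisFun_add_one hw, ← mul_sub, ev_dagger_add_one hP] at h
  exact h

lemma hasDerivAt_unitPeriodTail {P : Form ℚ n} (hP : coef (Fin.last n) P = 0) {w : ℂ}
    (hw : 0 < w.im) : HasDerivAt (unitPeriodTail n hn P) ((eisFun n hn w - 1) * ev P w) w := by
  have h := hasDerivAt_segInt_add_one (differentiableOn_eisFun_sub_mul_ev (hn := hn) (dagger P)) hw
  rw [eisFun_add_one hw, ← mul_sub, ev_dagger_add_one hP] at h
  exact h

/-- The first summand comes from the constant term 1 of E and is a polynomial in w; the second
decays towards i∞. -/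
lemma unitPeriod_eq (P : Form ℚ n) {w : ℂ} (hw : 0 < w.im) :
    unitPeriod n hn P w = segInt (ev (dagger P)) w (w + 1) + unitPeriodTail n hn P w := by
  have h := segInt_sub (differentiableOn_eisFun_mul_ev (hn := hn) (dagger P)).continuousOn
    (differentiable_ev (dagger P)).continuous.continuousOn hw (im_add_one hw)
  rw [unitPeriod, unitPeriodTail]
  simp only [sub_mul, one_mul]
  rw [h]
  ring

/-- The integral of `E(z) P(z, 1)` along a segment. -/
lemma segInt_eisFun_mul_ev {P : Form ℚ n} (hP : coef (Fin.last n) P = 0) {a b : ℂ}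
    (ha : 0 < a.im) (hb : 0 < b.im) :
    segInt (fun z => eisFun n hn z * ev P z) a b = unitPeriod n hn P b - unitPeriod n hn P a := by
  obtain ⟨G, hG, hG'⟩ := exists_primitive (differentiableOn_eisFun_mul_ev (hn := hn) P)
  have hd : ∀ z ∈ {z : ℂ | 0 < z.im}, HasDerivAt (fun z => G z - unitPeriod n hn P z) 0 z := by
    intro z hz
    have h := (hG z hz).sub (hasDerivAt_unitPeriod (hn := hn) hP hz)
    rw [sub_self] at h
    exact h
  have h := isOpen_im_pos.is_const_of_deriv_eq_zero (convex_halfSpace_im_gt 0).isPreconnected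
    (fun z hz => (hd z hz).differentiableAt.differentiableWithinAt) (fun z hz => (hd z hz).deriv)
    ha hb
  rw [hG' a b ha hb]
  linear_combination -h

lemma norm_ev_le (P : Form ℚ n) {z : ℂ} {x : ℝ} (hz : ‖z‖ ≤ x) :
    ‖ev P z‖ ≤ ∑ i : Fin (n + 1), ‖((coef i P : ℚ) : ℂ)‖ * x ^ (i : ℕ) := by
  rw [ev_eq_sum]
  refine (norm_sum_le _ _).trans (Finset.sum_le_sum fun i _ => ?_)
  rw [norm_mul, norm_pow]
  gcongr

/-- Polynomial growth of P† against exponential decay of E - 1. Arbitrary abscissa b and speed a are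
needed because the points (u + j)/p^k and w₀ run along different vertical rays. -/
lemma tendsto_unitPeriodTail (he : Even n) (P : Form ℚ n) (b : ℝ) {a : ℝ} (ha : 0 < a) :
    Filter.Tendsto (fun y : ℝ => unitPeriodTail n hn P (b + a * y * Complex.I)) Filter.atTop
      (nhds 0) := by
  obtain ⟨c, hc, C, A, hA, hC, hE⟩ := eisFun_decay (hn := hn) he
  -- On the unit segment starting at b + iay one has |z| ≤ B + ay; the estimates below are expressed
  -- in x = B + ay.
  set B : ℝ := |b| + 1 with hB
  let F : ℝ → ℝ := fun x => ∑ i : Fin (n + 1), ‖((coef i (dagger P) : ℚ) : ℂ)‖ * x ^ (i : ℕ)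
  have hF : Filter.Tendsto (fun x => C * Real.exp (c * B) * (F x / Real.exp (c * x)))
      Filter.atTop (nhds 0) := by
    have h1 : ∀ i : Fin (n + 1), Filter.Tendsto
        (fun x : ℝ => ‖((coef i (dagger P) : ℚ) : ℂ)‖ * (x ^ (i : ℕ) / Real.exp (c * x)))
        Filter.atTop (nhds (‖((coef i (dagger P) : ℚ) : ℂ)‖ * 0)) := fun i =>
      (isLittleO_pow_exp_pos_mul_atTop (i : ℕ) hc).tendsto_div_nhds_zero.const_mul _
    have h2 := (tendsto_finsetSum Finset.univ fun i _ => h1 i).const_mul (C * Real.exp (c * B))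
    simp only [mul_zero, Finset.sum_const_zero] at h2
    refine h2.congr fun x => ?_
    simp only [F, Finset.sum_div, mul_div_assoc]
  have hlin : Filter.Tendsto (fun y : ℝ => B + a * y) Filter.atTop Filter.atTop :=
    Filter.tendsto_atTop_add_const_left _ _ (Filter.tendsto_id.const_mul_atTop ha)
  refine squeeze_zero_norm' ?_ (hF.comp hlin)
  filter_upwards [Filter.eventually_ge_atTop (A / a), Filter.eventually_ge_atTop 0] with y hy hy0
  have hAy : A ≤ a * y := by rwa [div_le_iff₀' ha] at hy
  rw [unitPeriodTail, segInt]
  simp only [add_sub_cancel_left, mul_one, one_mul, Function.comp_apply]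
  have hbound : ∀ t ∈ Set.uIoc (0 : ℝ) 1,
      ‖(eisFun n hn (b + a * y * Complex.I + t) - 1) *
        ev (dagger P) (b + a * y * Complex.I + t)‖ ≤
        C * Real.exp (-c * (a * y)) * F (B + a * y) := by
    intro t ht
    rw [Set.uIoc_of_le zero_le_one] at ht
    have him : ((b : ℂ) + a * y * Complex.I + t).im = a * y := by simp
    have hnorm : ‖(b : ℂ) + a * y * Complex.I + t‖ ≤ B + a * y := by
      refine (norm_add_le _ _).trans ?_
      have h1 := norm_add_le (b : ℂ) (a * y * Complex.I)
      have h2 : ‖(t : ℂ)‖ ≤ 1 := by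
        rw [Complex.norm_real, Real.norm_eq_abs, abs_of_pos ht.1]; exact ht.2
      have h3 : ‖(a : ℂ) * y * Complex.I‖ = a * y := by
        rw [norm_mul, Complex.norm_I, mul_one, ← Complex.ofReal_mul, Complex.norm_real,
          Real.norm_eq_abs, abs_of_nonneg (by positivity)]
      rw [h3, Complex.norm_real, Real.norm_eq_abs] at h1
      linarith
    rw [norm_mul]
    have h1 := hE ((b : ℂ) + a * y * Complex.I + t) (by rw [him]; exact hAy)
    rw [him] at h1
    have h2 := norm_ev_le (dagger P) hnorm
    gcongr
  have h := intervalIntegral.norm_integral_le_of_norm_le_const hbound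
  simp only [sub_zero, abs_one, mul_one] at h
  refine h.trans (le_of_eq ?_)
  have e1 : Real.exp (-c * (a * y)) = Real.exp (c * B) / Real.exp (c * (B + a * y)) := by
    rw [← Real.exp_sub]; ring_nf
  rw [e1]
  ring

/-- The pairing of the Eisenstein class with a modular symbol. -/
lemma pairing_Eis (he : Even n) (α β : ℍ) (P : Form ℚ n) :
    pairing (Eis n hn) (symb α β ⊗ₜ P) = segInt (fun z => eisFun n hn z * ev P z) α β := by
  have h : pairing (Eis n hn) (symb α β ⊗ₜ P) = formPairing n (Eis n hn (symb α β)) P :=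
    TensorProduct.lift.tmul _ _
  rw [h, Eis, eichlerShimura_symb, formPairing_formIntegral he
    (differentiableOn_eisFun (hn := hn))]
  rfl

end EisensteinFunction

/-! ### The operator `U` on the Eisenstein series -/

/-- The p-part of the Hecke relation for divisor sums: for q = p^s these geometric sums are the
values of σ_s at powers of p. -/
lemma geom_sum_mul_geom_sum (q k a : ℕ) :
    (∑ i ∈ Finset.range (k + a + 1), q ^ i) +
        q * (∑ i ∈ Finset.range k, q ^ i) * ∑ i ∈ Finset.range a, q ^ i =
      (∑ i ∈ Finset.range (k + 1), q ^ i) * ∑ i ∈ Finset.range (a + 1), q ^ i := by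
  induction a with
  | zero => simp
  | succ a ih =>
    rw [← add_assoc, Finset.sum_range_succ _ (k + a + 1), Finset.sum_range_succ _ (a + 1), mul_add,
      ← ih, Finset.sum_range_succ _ a, Finset.sum_range_succ _ k]
    ring

/-- Write r = p^a m with p ∤ m. Multiplicativity splits off σ_s(m) and leaves the preceding identity
on powers of p; for a = 0 there is no correction term. -/
lemma sigma_prime_pow_mul (s : ℕ) {p : ℕ} (hp : p.Prime) (k r : ℕ) :
    ArithmeticFunction.sigma s (p ^ k * r) + p ^ s * (∑ i ∈ Finset.range k, (p ^ s) ^ i) *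
        (if p ∣ r then ArithmeticFunction.sigma s (r / p) else 0) =
      (∑ i ∈ Finset.range (k + 1), (p ^ s) ^ i) * ArithmeticFunction.sigma s r := by
  rcases Nat.eq_zero_or_pos r with rfl | hr
  · simp
  obtain ⟨a, m, hm, rfl⟩ := Nat.exists_eq_pow_mul_and_not_dvd hr.ne' p hp.ne_one
  have hcop : ∀ i, Nat.Coprime (p ^ i) m := fun i =>
    Nat.Coprime.pow_left i ((Nat.Prime.coprime_iff_not_dvd hp).2 hm)
  have hs : ∀ i, ArithmeticFunction.sigma s (p ^ i * m) =
      (∑ j ∈ Finset.range (i + 1), (p ^ s) ^ j) * ArithmeticFunction.sigma s m := by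
    intro i
    rw [ArithmeticFunction.isMultiplicative_sigma.map_mul_of_coprime (hcop i),
      ArithmeticFunction.sigma_apply_prime_pow hp]
    simp only [pow_mul, mul_comm _ s]
  rw [← mul_assoc, ← pow_add, hs, hs]
  rcases a with _ | a
  · rw [if_neg (by simpa using hm)]
    simp
  · have h1 : p ^ (a + 1) * m / p = p ^ a * m := by
      rw [pow_succ, mul_right_comm, Nat.mul_div_cancel _ hp.pos]
    rw [if_pos (Dvd.dvd.mul_right (dvd_pow_self p (Nat.succ_ne_zero a)) m), h1, hs,
      ← mul_assoc (∑ i ∈ Finset.range (k + 1), (p ^ s) ^ i), ← geom_sum_mul_geom_sum]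
    ring

section Period

variable {n : ℕ} {hn : 2 ≤ n}

/-- `∑ σ_{n+1}(r) exp(2πirz)`. -/
noncomputable def sigmaSeries (n : ℕ) (z : ℂ) : ℂ :=
  ∑' r : ℕ, (ArithmeticFunction.sigma (n + 1) r : ℂ) *
    Complex.exp (2 * Real.pi * Complex.I * z) ^ r

lemma hasSum_sigmaSeries (n : ℕ) {z : ℂ} (hz : 0 < z.im) :
    HasSum (fun r : ℕ => (ArithmeticFunction.sigma (n + 1) r : ℂ) *
      Complex.exp (2 * Real.pi * Complex.I * z) ^ r) (sigmaSeries n z) :=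
  (EisensteinSeries.summable_sigma_mul_cexp_pow (k := n + 2) (by omega) ⟨z, hz⟩).hasSum

lemma eisFun_sub_one (he : Even n) {z : ℂ} (hz : 0 < z.im) :
    eisFun n hn z - 1 = 2 / riemannZeta (-1 - (n : ℂ)) * sigmaSeries n z := by
  rw [eisFun, UpperHalfPlane.ofComplex_apply_of_im_pos hz, eisenstein_qExpansion n hn he,
    add_sub_cancel_left, sigmaSeries]
  congr 1
  rw [tsum_pnat_eq_tsum_succ (f := fun r : ℕ => (ArithmeticFunction.sigma (n + 1) r : ℂ) *
    Complex.exp (2 * Real.pi * Complex.I * z) ^ r), (hasSum_sigmaSeries n hz).summable.tsum_eq_zero_add]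
  simp

/-- Orthogonality of roots of unity keeps only the exponents divisible by p^k. The Hecke relation
then rewrites σ(p^k r) through σ(r) and σ(r/p), and the latter coefficients are those of the series
at pu. -/
lemma sum_sigmaSeries (n : ℕ) {p : ℕ} (hp : p.Prime) (k : ℕ) {u : ℂ} (hu : 0 < u.im) :
    ∑ j ∈ Finset.range (p ^ k), sigmaSeries n ((u + j) / (p : ℂ) ^ k) =
      (p : ℂ) ^ k * ((∑ i ∈ Finset.range (k + 1), ((p : ℂ) ^ (n + 1)) ^ i) * sigmaSeries n u -
        (p : ℂ) ^ (n + 1) * (∑ i ∈ Finset.range k, ((p : ℂ) ^ (n + 1)) ^ i) *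
          sigmaSeries n (p * u)) := by
  set N : ℕ := p ^ k with hN
  have hNpos : 0 < N := pow_pos hp.pos k
  have hN0 : (N : ℂ) ≠ 0 := by exact_mod_cast hNpos.ne'
  have hNp : (p : ℂ) ^ k = N := by rw [hN]; push_cast; rfl
  have hp0 : (0 : ℝ) < p := by exact_mod_cast hp.pos
  rw [hNp]
  have him : ∀ j : ℕ, 0 < ((u + j) / (N : ℂ)).im := by
    intro j
    have h : ((u + j) / (N : ℂ)).im = u.im / N := by
      rw [← Complex.ofReal_natCast N, Complex.div_ofReal_im]; simp
    rw [h]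
    exact div_pos hu (by exact_mod_cast hNpos)
  have himp : 0 < ((p : ℂ) * u).im := by
    have h : ((p : ℂ) * u).im = p * u.im := by simp
    rw [h]; positivity
  set x : ℂ := Complex.exp (2 * Real.pi * Complex.I * u) with hx
  -- the left side
  have h1 := hasSum_sum (s := Finset.range N) fun j _ => hasSum_sigmaSeries n (him j)
  have hprim := Complex.isPrimitiveRoot_exp N hNpos.ne'
  have hterm : ∀ r : ℕ, ∑ j ∈ Finset.range N, (ArithmeticFunction.sigma (n + 1) r : ℂ) *
      Complex.exp (2 * Real.pi * Complex.I * ((u + j) / N)) ^ r =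
      (ArithmeticFunction.sigma (n + 1) r : ℂ) * Complex.exp (2 * Real.pi * Complex.I * (u / N)) ^ r *
        ∑ j ∈ Finset.range N, (Complex.exp (2 * Real.pi * Complex.I / N) ^ r) ^ j := by
    intro r
    rw [Finset.mul_sum]
    apply Finset.sum_congr rfl
    intro j _
    rw [mul_assoc (ArithmeticFunction.sigma (n + 1) r : ℂ), ← pow_mul, mul_comm r j, pow_mul,
      ← mul_pow, ← Complex.exp_nat_mul _ j, ← Complex.exp_add]
    congr 3
    field_simp
  have hzero : ∀ r ∉ Set.range (fun r : ℕ => N * r),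
      ∑ j ∈ Finset.range N, (ArithmeticFunction.sigma (n + 1) r : ℂ) *
      Complex.exp (2 * Real.pi * Complex.I * ((u + j) / N)) ^ r = 0 := by
    intro r hr
    have hr' : ¬ N ∣ r := fun ⟨c, hc⟩ => hr ⟨c, hc.symm⟩
    have hne : Complex.exp (2 * Real.pi * Complex.I / N) ^ r ≠ 1 := by
      rwa [Ne, hprim.pow_eq_one_iff_dvd]
    rw [hterm, geom_sum_eq hne, ← pow_mul, mul_comm r N, pow_mul, hprim.pow_eq_one, one_pow,
      sub_self, zero_div, mul_zero]
  have hinj : ∀ m : ℕ, 0 < m → Function.Injective (fun r : ℕ => m * r) := fun m hm a b h =>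
    Nat.eq_of_mul_eq_mul_left hm h
  rw [← (hinj N hNpos).hasSum_iff hzero] at h1
  have h1' : HasSum (fun r : ℕ => (N : ℂ) * ((ArithmeticFunction.sigma (n + 1) (N * r) : ℂ) * x ^ r))
      (∑ j ∈ Finset.range N, sigmaSeries n ((u + j) / N)) := by
    refine h1.congr_fun ?_
    intro r
    simp only [Function.comp_apply]
    rw [hterm, pow_mul (Complex.exp (2 * Real.pi * Complex.I / N)), hprim.pow_eq_one, one_pow]
    simp only [one_pow, Finset.sum_const, Finset.card_range, nsmul_eq_mul, mul_one]
    rw [pow_mul, ← Complex.exp_nat_mul _ N, show (N : ℂ) * (2 * Real.pi * Complex.I * (u / N)) =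
      2 * Real.pi * Complex.I * u by field_simp]
    ring
  -- the series at `p * u`
  have h2 := hasSum_sigmaSeries n himp
  have h2' : HasSum (fun r : ℕ => (((if p ∣ r then ArithmeticFunction.sigma (n + 1) (r / p) else 0 : ℕ)
      : ℂ)) * x ^ r) (sigmaSeries n (p * u)) := by
    rw [← (hinj p hp.pos).hasSum_iff]
    · refine h2.congr_fun ?_
      intro r
      simp only [Function.comp_apply, dvd_mul_right, if_true, Nat.mul_div_cancel_left r hp.pos]
      rw [pow_mul, hx, ← Complex.exp_nat_mul]
      congr 3
      ring
    · intro r hr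
      have hr' : ¬ p ∣ r := fun ⟨c, hc⟩ => hr ⟨c, hc.symm⟩
      simp [hr']
  have h3 := hasSum_sigmaSeries n hu
  have h4 := (((h3.mul_left (∑ i ∈ Finset.range (k + 1), ((p : ℂ) ^ (n + 1)) ^ i)).sub
    (h2'.mul_left ((p : ℂ) ^ (n + 1) * ∑ i ∈ Finset.range k, ((p : ℂ) ^ (n + 1)) ^ i))).mul_left
    (N : ℂ))
  refine h1'.unique (h4.congr_fun ?_)
  intro r
  have h5 : ((ArithmeticFunction.sigma (n + 1) (p ^ k * r) + p ^ (n + 1) *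
      (∑ i ∈ Finset.range k, (p ^ (n + 1)) ^ i) *
      (if p ∣ r then ArithmeticFunction.sigma (n + 1) (r / p) else 0) : ℕ) : ℂ) =
      (((∑ i ∈ Finset.range (k + 1), (p ^ (n + 1)) ^ i) * ArithmeticFunction.sigma (n + 1) r : ℕ) : ℂ) :=
    congrArg Nat.cast (sigma_prime_pow_mul (n + 1) hp k r)
  rw [Nat.cast_add, Nat.cast_mul, Nat.cast_mul, Nat.cast_mul] at h5
  push_cast at h5 ⊢
  rw [← hx]
  linear_combination (N : ℂ) * x ^ r * h5

lemma sum_eisFun_sub_one (he : Even n) {p : ℕ} (hp : p.Prime) (k : ℕ) {u : ℂ} (hu : 0 < u.im) :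
    ∑ j ∈ Finset.range (p ^ k), (eisFun n hn ((u + j) / (p : ℂ) ^ k) - 1) =
      (p : ℂ) ^ k * ((∑ i ∈ Finset.range (k + 1), ((p : ℂ) ^ (n + 1)) ^ i) * (eisFun n hn u - 1) -
        (p : ℂ) ^ (n + 1) * (∑ i ∈ Finset.range k, ((p : ℂ) ^ (n + 1)) ^ i) *
          (eisFun n hn (p * u) - 1)) := by
  have hp0 : (0 : ℝ) < p := by exact_mod_cast hp.pos
  have him : ∀ j : ℕ, 0 < ((u + j) / (p : ℂ) ^ k).im := by
    intro j
    have h : ((u + j) / (p : ℂ) ^ k).im = u.im / (p : ℝ) ^ k := by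
      rw [← Complex.ofReal_natCast p, ← Complex.ofReal_pow, Complex.div_ofReal_im]; simp
    rw [h]
    positivity
  have himp : 0 < ((p : ℂ) * u).im := by
    have h : ((p : ℂ) * u).im = p * u.im := by simp
    rw [h]; positivity
  rw [Finset.sum_congr rfl fun j _ => eisFun_sub_one he (him j), ← Finset.mul_sum,
    sum_sigmaSeries n hp k hu, eisFun_sub_one he hu, eisFun_sub_one he himp]
  ring

end Period

/-! ### The pairing of the Eisenstein class with the corrected chains -/

section Chain

variable {n : ℕ} {hn : 2 ≤ n} {p : ℕ} {ν : Fin (n + 1)}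

lemma ev_E1 (k j : ℕ) (z : ℂ) :
    ev (E1 p n ν k j) z = ((1 : ℚ) : ℂ) * ((((p : ℚ) ^ k : ℚ) : ℂ) * z + ((-(j : ℚ) : ℚ) : ℂ)) ^
      (ν : ℕ) := by
  simp [ev, E1, sub_eq_add_neg]

lemma ev_E0 (k j : ℕ) (z : ℂ) :
    ev (E0 p n ν k j) z =
      (((-1 : ℚ) ^ ((ν : ℕ) + 1) * ((p : ℚ) ^ ell p k j) ^ (ν : ℕ) : ℚ) : ℂ) *
      ((((p : ℚ) ^ (k - ell p k j) : ℚ) : ℂ) * z + ((dd p k j : ℚ) : ℂ)) ^ (n - ν : ℕ) := by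
  rw [E0, ev_smul]
  simp [ev, mul_assoc]

lemma coef_last_E1 (hν : (ν : ℕ) < n) (k j : ℕ) : coef (Fin.last n) (E1 p n ν k j) = 0 :=
  coef_last_linear_pow hν (ev_E1 k j)

lemma coef_last_E0 (hν : 1 ≤ (ν : ℕ)) (k j : ℕ) : coef (Fin.last n) (E0 p n ν k j) = 0 :=
  coef_last_linear_pow (by have := ν.2; omega) (ev_E0 k j)

lemma ell_le (k j : ℕ) : ell p k j ≤ k := by
  rw [ell]; split_ifs
  · exact le_rfl
  · exact min_le_right _ _

lemma pow_ell_dvd (k j : ℕ) : p ^ ell p k j ∣ j := by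
  rw [ell]; split_ifs with h
  · rw [h]; exact dvd_zero _
  · exact (pow_dvd_pow p (min_le_left _ _)).trans pow_padicValNat_dvd

lemma im_div_pow (k : ℕ) (z : ℂ) : (z / (p : ℂ) ^ k).im = z.im / (p : ℝ) ^ k := by
  rw [← Complex.ofReal_natCast p, ← Complex.ofReal_pow, Complex.div_ofReal_im]

variable [Fact p.Prime]

lemma ev_act_tri (k j : ℕ) (z : ℂ) : ev (act (tri p 0 j k) (e ℚ n ν)) z = ev (E1 p n ν k j) z := by
  rw [ev_E1]
  simp [ev, act, tri, e, MvPolynomial.aeval_def]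
  simp [sub_eq_add_neg]

/-- Provides the matrix (a, b; p^(k-l), d) of SL(2, ℤ), with a = j/p^l, that sends w₀ to (-1/τ₀ +
j)/p^k. -/
lemma exists_bezout (k j : ℕ) :
    ∃ a b : ℤ, (j : ℤ) = (p : ℤ) ^ ell p k j * a ∧
      a * dd p k j - b * (p : ℤ) ^ (k - ell p k j) = 1 := by
  obtain ⟨a, ha⟩ := pow_ell_dvd (p := p) k j
  have hp : p.Prime := Fact.out
  have hq : j / p ^ ell p k j = a := Nat.div_eq_of_eq_mul_right (pow_pos hp.pos _) ha
  rcases Nat.eq_zero_or_pos (k - ell p k j) with h0 | h0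
  · refine ⟨a, a * dd p k j - 1, by exact_mod_cast ha, ?_⟩
    rw [h0]; ring
  · have hj0 : j ≠ 0 := by
      rintro rfl
      simp [ell] at h0
    have hl : ell p k j = padicValNat p j := by
      rw [ell, if_neg hj0] at h0 ⊢
      omega
    have hpa : ¬ p ∣ a := by
      rintro ⟨c, rfl⟩
      apply pow_succ_padicValNat_not_dvd (p := p) hj0
      rw [← hl]
      exact ⟨c, by rw [pow_succ, mul_assoc]; exact ha⟩
    obtain ⟨-, -, hd⟩ := dInv_spec h0 hpa
    have h := Nat.modEq_iff_dvd.1 hd.symm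
    obtain ⟨b, hb⟩ := h
    refine ⟨a, b, by exact_mod_cast ha, ?_⟩
    rw [dd, hq]
    push_cast at hb
    linear_combination hb

/-- Minus the pairing of the Eisenstein class with `C̃_{ν,k,j}(τ, ·)`. -/
noncomputable def chainPeriod (p n : ℕ) [Fact p.Prime] (hn : 2 ≤ n) (ν : Fin (n + 1)) (k j : ℕ)
    (τ : ℂ) : ℂ :=
  unitPeriod n hn (E1 p n ν k j) ((-1 / τ + j) / (p : ℂ) ^ k) +
    unitPeriod n hn (E0 p n ν k j)
      (((p : ℂ) ^ ell p k j * τ - dd p k j) / (p : ℂ) ^ (k - ell p k j))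

lemma im_div_pow_pos (k : ℕ) {z : ℂ} (hz : 0 < z.im) : 0 < (z / (p : ℂ) ^ k).im := by
  have hp0 : (0 : ℝ) < p := by exact_mod_cast (Fact.out : p.Prime).pos
  rw [im_div_pow]
  positivity

lemma im_neg_inv_add (j : ℕ) {z : ℂ} (hz : 0 < z.im) : 0 < (-1 / z + j).im := by
  have h : (-1 / z + j).im = z.im / Complex.normSq z := by
    rw [neg_div, one_div]
    simp [neg_div]
  rw [h]
  exact div_pos hz (Complex.normSq_pos.2 (by rintro rfl; simp at hz))

lemma im_pow_mul_sub (l d : ℕ) {z : ℂ} (hz : 0 < z.im) : 0 < ((p : ℂ) ^ l * z - d).im := by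
  have hp0 : (0 : ℝ) < p := by exact_mod_cast (Fact.out : p.Prime).pos
  have h : ((p : ℂ) ^ l * z - d).im = (p : ℝ) ^ l * z.im := by
    rw [← Complex.ofReal_natCast p, ← Complex.ofReal_pow, Complex.sub_im, Complex.im_ofReal_mul]
    simp
  rw [h]
  positivity

/-- The two summands are primitives evaluated at points related by SL(2, ℤ), with automorphy factor
p^l τ. At these points E⁽¹⁾ is (-1/τ)^ν and E⁽⁰⁾ is, up to sign, p^(lν) (p^l τ)^(n-ν); the weight n
+ 2 law makes the derivatives opposite. -/
lemma hasDerivAt_chainPeriod (hν₁ : 1 ≤ (ν : ℕ)) (hν₂ : (ν : ℕ) < n) (k j : ℕ) {τ : ℂ} (hτ : 0 < τ.im) :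
    HasDerivAt (chainPeriod p n hn ν k j) 0 τ := by
  have hp0 : (p : ℂ) ≠ 0 := by exact_mod_cast (Fact.out : p.Prime).ne_zero
  have hτ0 : τ ≠ 0 := by rintro rfl; simp at hτ
  obtain ⟨a, b, hja, hab⟩ := exists_bezout (p := p) k j
  set l := ell p k j with hl
  set d := dd p k j with hd
  have hkl : k = l + (k - l) := (Nat.add_sub_cancel' (ell_le k j)).symm
  set r := k - l with hr
  -- In contrast to the definition of the chains, w₁ denotes here the starting point of the path.
  set w₁ : ℂ := (-1 / τ + j) / (p : ℂ) ^ k with hw₁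
  set w₀ : ℂ := ((p : ℂ) ^ l * τ - d) / (p : ℂ) ^ r with hw₀
  have hw₁' : 0 < w₁.im := im_div_pow_pos k (im_neg_inv_add j hτ)
  have hw₀' : 0 < w₀.im := im_div_pow_pos r (im_pow_mul_sub l d hτ)
  have hpk : (p : ℂ) ^ k ≠ 0 := pow_ne_zero _ hp0
  have hpl : (p : ℂ) ^ l ≠ 0 := pow_ne_zero _ hp0
  have hpr : (p : ℂ) ^ r ≠ 0 := pow_ne_zero _ hp0
  have hkC : (p : ℂ) ^ k = (p : ℂ) ^ l * (p : ℂ) ^ r := by rw [← pow_add, ← hkl]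
  have hjC : (j : ℂ) = (p : ℂ) ^ l * a := by exact_mod_cast congrArg (Int.cast : ℤ → ℂ) hja
  have habC : (a : ℂ) * d - b * (p : ℂ) ^ r = 1 := by
    exact_mod_cast congrArg (Int.cast : ℤ → ℂ) hab
  have hden : (p : ℂ) ^ r * w₀ + d = (p : ℂ) ^ l * τ := by
    rw [hw₀]; field_simp; ring
  have hmoeb := eisFun_moebius (n := n) (hn := hn) (a := a) (b := b) (c := (p : ℤ) ^ r) (d := d)
    (by linear_combination hab) hw₀' (w := w₁) (by
      push_cast
      rw [hden, eq_div_iff (mul_ne_zero hpl hτ0), hw₁, hw₀, hkC, hjC]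
      field_simp
      linear_combination habC)
  have h1 : HasDerivAt (fun τ : ℂ => (-1 / τ + j) / (p : ℂ) ^ k) (1 / τ ^ 2 / (p : ℂ) ^ k) τ := by
    have := ((hasDerivAt_inv hτ0).const_mul (-1)).add_const (j : ℂ) |>.div_const ((p : ℂ) ^ k)
    simpa [div_eq_mul_inv] using this
  have h0 : HasDerivAt (fun τ : ℂ => ((p : ℂ) ^ l * τ - d) / (p : ℂ) ^ r)
      ((p : ℂ) ^ l / (p : ℂ) ^ r) τ := by
    have := ((hasDerivAt_id τ).const_mul ((p : ℂ) ^ l)).sub_const (d : ℂ) |>.div_const ((p : ℂ) ^ r)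
    simpa using this
  have H := ((hasDerivAt_unitPeriod (hn := hn) (coef_last_E1 (p := p) hν₂ k j) hw₁').comp τ h1).add
    ((hasDerivAt_unitPeriod (hn := hn) (coef_last_E0 (p := p) hν₁ k j) hw₀').comp τ h0)
  refine H.congr_deriv ?_
  rw [ev_E1, ev_E0, hmoeb.2]
  push_cast
  rw [hden]
  have e1 : (p : ℂ) ^ k * w₁ + -(j : ℂ) = -1 / τ := by
    rw [hw₁]; field_simp; ring
  rw [e1]
  obtain ⟨s, hs⟩ : ∃ s, n = ν + s := ⟨n - ν, by omega⟩
  have hs' : n - (ν : ℕ) = s := by omega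
  have hs₂ : n + 2 = ν + s + 2 := by omega
  rw [hs', div_pow, hkC, hs₂, ← hl]
  simp only [one_mul, mul_pow, pow_succ, pow_add, pow_zero]
  field_simp
  ring

lemma chainPeriod_const (hν₁ : 1 ≤ (ν : ℕ)) (hν₂ : (ν : ℕ) < n) (k j : ℕ) {τ τ' : ℂ} (hτ : 0 < τ.im) (hτ' : 0 < τ'.im) :
    chainPeriod p n hn ν k j τ = chainPeriod p n hn ν k j τ' :=
  isOpen_im_pos.is_const_of_deriv_eq_zero (convex_halfSpace_im_gt 0).isPreconnected
    (fun _ hz => (hasDerivAt_chainPeriod hν₁ hν₂ k j hz).differentiableAt.differentiableWithinAt)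
    (fun _ hz => (hasDerivAt_chainPeriod hν₁ hν₂ k j hz).deriv) hτ hτ'

/-- The path contributes the difference of the unit periods of E⁽¹⁾ at its end points; the
correction at w₁ cancels the end point, and with it all dependence on τ₁. -/
lemma pairing_C1Tilde (he : Even n) (hν₂ : (ν : ℕ) < n) (k j : ℕ) (τ₀ τ₁ : ℍ) :
    pairing (Eis n hn) (C1Tilde p n ν k j τ₀ τ₁) = -chainPeriod p n hn ν k j τ₀ := by
  have hact : act (tri p 0 j k) (e ℚ n ν) = E1 p n ν k j := by
    rw [form_eq_sum (act (tri p 0 j k) (e ℚ n ν)), form_eq_sum (E1 p n ν k j)]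
    apply Finset.sum_congr rfl
    intro κ _
    rw [coef_linear_pow (fun z => (ev_act_tri (p := p) k j z).trans (ev_E1 k j z)),
      coef_linear_pow (ev_E1 k j)]
  have hT : ∀ w : ℍ, ((move matT w : ℍ) : ℂ) = w + 1 := by
    intro w
    rw [coe_move]
    simp [matT]
  have hS : ((move (tri p 0 j k) (move matS τ₀) : ℍ) : ℂ) = (-1 / τ₀ + j) / (p : ℂ) ^ k := by
    rw [coe_move, coe_move]
    simp [matS, tri]
  have h0 : ((move (tri p (ell p k j) (-(dd p k j : ℤ)) (k - ell p k j)) τ₀ : ℍ) : ℂ) =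
      ((p : ℂ) ^ ell p k j * τ₀ - dd p k j) / (p : ℂ) ^ (k - ell p k j) := by
    rw [coe_move]
    simp [tri, sub_eq_add_neg]
  simp only [C1Tilde, map_sub, C1, hact, pairing_Eis he, hT]
  rw [segInt_eisFun_mul_ev (coef_last_E1 hν₂ k j) (UpperHalfPlane.im_pos _)
    (UpperHalfPlane.im_pos _), hS, ← unitPeriod, ← unitPeriod, h0, chainPeriod]
  ring

end Chain

/-! ### Summation over j and passage to the cusp -/

section Sum

variable {n : ℕ} {hn : 2 ≤ n} {p : ℕ} [Fact p.Prime] {ν : Fin (n + 1)}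

/-- The value is independent of j, so the sum over j acts on the Eisenstein series alone. -/
lemma ev_E1_div (k j : ℕ) (u : ℂ) : ev (E1 p n ν k j) ((u + j) / (p : ℂ) ^ k) = u ^ (ν : ℕ) := by
  have hp0 : (p : ℂ) ^ k ≠ 0 := pow_ne_zero _ (by exact_mod_cast (Fact.out : p.Prime).ne_zero)
  rw [ev_E1]
  push_cast
  rw [one_mul, mul_div_cancel₀ _ hp0]
  ring

lemma coef_last_e (hν : (ν : ℕ) < n) : coef (Fin.last n) (e ℚ n ν) = 0 := by
  rw [coef_e, if_neg]
  rintro rfl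
  simp at hν

/-- The operator `U` on the Eisenstein series, in terms of periods. -/
lemma sum_unitPeriodTail (he : Even n) (hν : (ν : ℕ) < n) (k : ℕ) {u : ℂ} (hu : 0 < u.im) :
    ∑ j ∈ Finset.range (p ^ k), unitPeriodTail n hn (E1 p n ν k j) ((u + j) / (p : ℂ) ^ k) =
      (∑ i ∈ Finset.range (k + 1), ((p : ℂ) ^ (n + 1)) ^ i) * unitPeriodTail n hn (e ℚ n ν) u -
        (p : ℂ) ^ (n - ν : ℕ) * (∑ i ∈ Finset.range k, ((p : ℂ) ^ (n + 1)) ^ i) *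
          unitPeriodTail n hn (e ℚ n ν) (p * u) := by
  have hp : p.Prime := Fact.out
  have hp0 : (p : ℂ) ≠ 0 := by exact_mod_cast hp.ne_zero
  have hpR : (0 : ℝ) < p := by exact_mod_cast hp.pos
  have hpk : (p : ℂ) ^ k ≠ 0 := pow_ne_zero _ hp0
  set g₁ := ∑ i ∈ Finset.range (k + 1), ((p : ℂ) ^ (n + 1)) ^ i with hg₁
  set g₀ := ∑ i ∈ Finset.range k, ((p : ℂ) ^ (n + 1)) ^ i with hg₀
  -- The difference of the two sides. Its derivative vanishes by the relation for the sum of E - 1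
  -- over j, and both sides tend to 0 at i∞.
  let D : ℂ → ℂ := fun u =>
    ∑ j ∈ Finset.range (p ^ k), unitPeriodTail n hn (E1 p n ν k j) ((u + j) / (p : ℂ) ^ k) -
      (g₁ * unitPeriodTail n hn (e ℚ n ν) u -
        (p : ℂ) ^ (n - ν : ℕ) * g₀ * unitPeriodTail n hn (e ℚ n ν) (p * u))
  have himj : ∀ {z : ℂ} (j : ℕ), 0 < z.im → 0 < ((z + j) / (p : ℂ) ^ k).im := fun j hz =>
    im_div_pow_pos k (by simpa using hz)
  have himp : ∀ {z : ℂ}, 0 < z.im → 0 < ((p : ℂ) * z).im := by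
    intro z hz
    have h : ((p : ℂ) * z).im = p * z.im := by simp
    rw [h]; positivity
  have hD : ∀ z ∈ {z : ℂ | 0 < z.im}, HasDerivAt D 0 z := by
    intro z hz
    have h1 : HasDerivAt (fun u => ∑ j ∈ Finset.range (p ^ k),
        unitPeriodTail n hn (E1 p n ν k j) ((u + j) / (p : ℂ) ^ k))
        (∑ j ∈ Finset.range (p ^ k), (eisFun n hn ((z + j) / (p : ℂ) ^ k) - 1) * z ^ (ν : ℕ) *
          (1 / (p : ℂ) ^ k)) z := by
      apply HasDerivAt.fun_sum
      intro j _
      have h := (hasDerivAt_unitPeriodTail (hn := hn) (coef_last_E1 (p := p) hν k j)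
        (himj j hz)).comp z (((hasDerivAt_id z).add_const (j : ℂ)).div_const ((p : ℂ) ^ k))
      simp only [id] at h
      rw [ev_E1_div] at h
      exact h
    have h2 := (hasDerivAt_unitPeriodTail (hn := hn) (coef_last_e hν) hz).const_mul g₁
    have h3 := ((hasDerivAt_unitPeriodTail (hn := hn) (coef_last_e hν) (himp hz)).comp z
      ((hasDerivAt_id z).const_mul (p : ℂ))).const_mul ((p : ℂ) ^ (n - ν : ℕ) * g₀)
    refine (h1.sub (h2.sub h3)).congr_deriv ?_
    rw [← Finset.sum_mul, ← Finset.sum_mul, sum_eisFun_sub_one he hp k hz, ← hg₁, ← hg₀, ev_e, ev_e]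
    have hpow : (p : ℂ) ^ (n + 1) = (p : ℂ) ^ (n - ν : ℕ) * (p : ℂ) ^ (ν : ℕ) * p := by
      rw [← pow_add, ← pow_succ, Nat.sub_add_cancel hν.le]
    rw [hpow]
    field_simp
    ring
  have hconst : ∀ y : ℝ, 0 < y → D (0 + 1 * y * Complex.I) = D u := by
    intro y hy
    refine isOpen_im_pos.is_const_of_deriv_eq_zero (convex_halfSpace_im_gt 0).isPreconnected
      (fun z hz => (hD z hz).differentiableAt.differentiableWithinAt)
      (fun z hz => (hD z hz).deriv) ?_ hu
    simpa using hy
  have hlim : Filter.Tendsto (fun y : ℝ => D (0 + 1 * y * Complex.I)) Filter.atTop (nhds 0) := by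
    have h1 : Filter.Tendsto (fun y : ℝ => ∑ j ∈ Finset.range (p ^ k),
        unitPeriodTail n hn (E1 p n ν k j) ((0 + 1 * y * Complex.I + j) / (p : ℂ) ^ k))
        Filter.atTop (nhds (∑ j ∈ Finset.range (p ^ k), 0)) := by
      apply tendsto_finsetSum
      intro j _
      refine (tendsto_unitPeriodTail (hn := hn) he (E1 p n ν k j) ((j : ℝ) / (p : ℝ) ^ k)
        (a := 1 / (p : ℝ) ^ k) (by positivity)).congr fun y => ?_
      congr 1
      push_cast
      field_simp
      ring
    have h2 := (tendsto_unitPeriodTail (hn := hn) he (e ℚ n ν) 0 one_pos).const_mul g₁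
    have h3 := (tendsto_unitPeriodTail (hn := hn) he (e ℚ n ν) 0 hpR).const_mul
      ((p : ℂ) ^ (n - ν : ℕ) * g₀)
    have h4 := h1.sub (h2.sub h3)
    simp only [Finset.sum_const_zero, mul_zero, sub_zero] at h4
    refine h4.congr fun y => ?_
    simp only [D]
    push_cast
    rw [show (p : ℂ) * (0 + 1 * (y : ℂ) * Complex.I) = 0 + p * y * Complex.I by ring]
  have h0 : D u = 0 := by
    refine tendsto_nhds_unique (tendsto_const_nhds.congr' ?_) hlim
    filter_upwards [Filter.eventually_gt_atTop 0] with y hy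
    rw [hconst y hy]
  exact sub_eq_zero.1 h0

/-- Comparing y with 2y eliminates A: 2^t f(y) - f(2y) is the constant (2^t - 1) D. Hence the
coefficients of divergent powers need not be evaluated. -/
lemma eq_zero_of_tendsto_add_mul_pow {D A : ℂ} {t : ℕ} (ht : 1 ≤ t)
    (h : Filter.Tendsto (fun y : ℝ => D + A * (y : ℂ) ^ t) Filter.atTop (nhds 0)) : D = 0 := by
  have h2 : Filter.Tendsto (fun y : ℝ => D + A * ((2 * y : ℝ) : ℂ) ^ t) Filter.atTop (nhds 0) :=
    h.comp (Filter.tendsto_id.const_mul_atTop two_pos)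
  have h3 := (h.const_mul ((2 : ℂ) ^ t)).sub h2
  simp only [mul_zero, sub_zero] at h3
  have h4 : ((2 : ℂ) ^ t - 1) * D = 0 := by
    refine tendsto_nhds_unique (tendsto_const_nhds.congr fun y => ?_) h3
    push_cast
    rw [mul_pow]
    ring
  rcases mul_eq_zero.1 h4 with h5 | h5
  · exfalso
    have h6 : (2 : ℕ) ^ t = 1 := by
      have : (2 : ℂ) ^ t = 1 := sub_eq_zero.1 h5
      exact_mod_cast this
    have := Nat.one_lt_two_pow (n := t) (by omega)
    omega
  · exact h5

/-- The contribution of the polynomial parts of the terms `{w₁, w₁ + 1} ⊗ (E⁽¹⁾)†`. -/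
noncomputable def bernSum₁ (p ν k : ℕ) : ℚ :=
  ∑ j ∈ Finset.range (p ^ k), ((p : ℚ) ^ k) ^ ν *
    (Polynomial.bernoulli (ν + 1)).eval (-(j : ℚ) / (p : ℚ) ^ k) / (ν + 1)

/-- The contribution of the polynomial parts of the terms `{w₀, w₀ + 1} ⊗ (E⁽⁰⁾)†`. -/
noncomputable def bernSum₀ (p ν s k : ℕ) [Fact p.Prime] : ℚ :=
  ∑ j ∈ Finset.range (p ^ k), (-1 : ℚ) ^ (ν + 1) * ((p : ℚ) ^ ell p k j) ^ ν *
    ((p : ℚ) ^ (k - ell p k j)) ^ s *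
      (Polynomial.bernoulli (s + 1)).eval ((dd p k j : ℚ) / (p : ℚ) ^ (k - ell p k j)) / (s + 1)

/-- The leading term of each polynomial part is independent of j, so the p^k copies cancel the
denominator p^k. -/
lemma sum_unitPeriod_E1 (he : Even n) (hν : (ν : ℕ) < n) (k : ℕ) {u : ℂ} (hu : 0 < u.im) :
    ∑ j ∈ Finset.range (p ^ k), unitPeriod n hn (E1 p n ν k j) ((u + j) / (p : ℂ) ^ k) =
      u ^ ((ν : ℕ) + 1) / ((ν : ℂ) + 1) - (bernSum₁ p ν k : ℚ) +
      ((∑ i ∈ Finset.range (k + 1), ((p : ℂ) ^ (n + 1)) ^ i) * unitPeriodTail n hn (e ℚ n ν) u -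
        (p : ℂ) ^ (n - ν : ℕ) * (∑ i ∈ Finset.range k, ((p : ℂ) ^ (n + 1)) ^ i) *
          unitPeriodTail n hn (e ℚ n ν) (p * u)) := by
  have hp0 : (p : ℚ) ≠ 0 := by exact_mod_cast (Fact.out : p.Prime).ne_zero
  have hp0' : (p : ℂ) ≠ 0 := by exact_mod_cast (Fact.out : p.Prime).ne_zero
  have hν0 : ((ν : ℕ) : ℂ) + 1 ≠ 0 := by exact_mod_cast Nat.succ_ne_zero (ν : ℕ)
  have him : ∀ j : ℕ, 0 < ((u + j) / (p : ℂ) ^ k).im := fun j =>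
    im_div_pow_pos k (by simpa using hu)
  rw [← sum_unitPeriodTail he hν k hu]
  have h : ∀ j ∈ Finset.range (p ^ k),
      unitPeriod n hn (E1 p n ν k j) ((u + j) / (p : ℂ) ^ k) =
      u ^ ((ν : ℕ) + 1) / ((p : ℂ) ^ k * ((ν : ℂ) + 1)) -
        ((((p : ℚ) ^ k) ^ (ν : ℕ) *
          (Polynomial.bernoulli (ν + 1)).eval (-(j : ℚ) / (p : ℚ) ^ k) / ((ν : ℕ) + 1) : ℚ) : ℂ) +
        unitPeriodTail n hn (E1 p n ν k j) ((u + j) / (p : ℂ) ^ k) := by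
    intro j _
    rw [unitPeriod_eq _ (him j), segInt_ev_dagger_linear_pow hν (pow_ne_zero k hp0)
      (ev_E1 (p := p) k j) (him j), one_mul]
    congr 2
    push_cast
    rw [one_mul, mul_div_cancel₀ _ (pow_ne_zero k hp0')]
    ring
  rw [Finset.sum_congr rfl h, Finset.sum_add_distrib, Finset.sum_sub_distrib, Finset.sum_const,
    Finset.card_range, nsmul_eq_mul, bernSum₁, Rat.cast_sum]
  congr 2
  push_cast
  field_simp

lemma unitPeriod_E0 (hν₁ : 1 ≤ (ν : ℕ)) (k j : ℕ) {τ : ℂ} (hτ : 0 < τ.im) :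
    unitPeriod n hn (E0 p n ν k j)
      (((p : ℂ) ^ ell p k j * τ - dd p k j) / (p : ℂ) ^ (k - ell p k j)) =
    (-1) ^ ((ν : ℕ) + 1) * ((p : ℂ) ^ ell p k j) ^ (ν : ℕ) *
        ((p : ℂ) ^ ell p k j * τ) ^ (n - ν + 1 : ℕ) /
        ((p : ℂ) ^ (k - ell p k j) * ((n - ν : ℕ) + 1)) -
      (((-1 : ℚ) ^ ((ν : ℕ) + 1) * ((p : ℚ) ^ ell p k j) ^ (ν : ℕ) *
        ((p : ℚ) ^ (k - ell p k j)) ^ (n - ν : ℕ) *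
        (Polynomial.bernoulli (n - ν + 1)).eval ((dd p k j : ℚ) / (p : ℚ) ^ (k - ell p k j)) /
          ((n - ν : ℕ) + 1) : ℚ) : ℂ) +
      unitPeriodTail n hn (E0 p n ν k j)
        (((p : ℂ) ^ ell p k j * τ - dd p k j) / (p : ℂ) ^ (k - ell p k j)) := by
  have hp0 : (p : ℚ) ≠ 0 := by exact_mod_cast (Fact.out : p.Prime).ne_zero
  have hp0' : (p : ℂ) ≠ 0 := by exact_mod_cast (Fact.out : p.Prime).ne_zero
  have him := im_div_pow_pos (p := p) (k - ell p k j) (im_pow_mul_sub (p := p) (ell p k j) (dd p k j) hτ)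
  have hr : n - (ν : ℕ) < n := by have := ν.2; omega
  rw [unitPeriod_eq _ him, segInt_ev_dagger_linear_pow hr (pow_ne_zero (k - ell p k j) hp0)
    (ev_E0 (p := p) k j) him]
  congr 2
  push_cast
  rw [mul_div_cancel₀ _ (pow_ne_zero (k - ell p k j) hp0')]
  ring

/-- The sum over `j` of the pairings of the Eisenstein class with the chains `C̃_{ν,k,j}`, in terms
of the regularized period `R` of the Eisenstein series. -/
theorem sum_pairing_C1Tilde (he : Even n) (hν₁ : 1 ≤ (ν : ℕ)) (hν₂ : (ν : ℕ) < n) {R κ : ℂ}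
    (hR : Filter.Tendsto (fun y : ℝ => unitPeriodTail n hn (e ℚ n ν) (Complex.I / y) +
      κ * (y : ℂ) ^ (n - ν + 1 : ℕ)) Filter.atTop (nhds (-R))) (k : ℕ) (τ₀ τ₁ : ℍ) :
    ∑ j ∈ Finset.range (p ^ k), pairing (Eis n hn) (C1Tilde p n ν k j τ₀ τ₁) =
      (bernSum₁ p ν k : ℚ) + (bernSum₀ p ν (n - ν) k : ℚ) +
        ((∑ i ∈ Finset.range (k + 1), ((p : ℂ) ^ (n + 1)) ^ i) -
          (p : ℂ) ^ (n - ν : ℕ) * (∑ i ∈ Finset.range k, ((p : ℂ) ^ (n + 1)) ^ i)) * R := by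
  have hp : p.Prime := Fact.out
  have hp0 : (p : ℂ) ≠ 0 := by exact_mod_cast hp.ne_zero
  have hpR : (0 : ℝ) < p := by exact_mod_cast hp.pos
  set t := n - (ν : ℕ) + 1 with ht
  set g₁ := ∑ i ∈ Finset.range (k + 1), ((p : ℂ) ^ (n + 1)) ^ i with hg₁
  set g₀ := ∑ i ∈ Finset.range k, ((p : ℂ) ^ (n + 1)) ^ i with hg₀
  have hpair : ∑ j ∈ Finset.range (p ^ k), pairing (Eis n hn) (C1Tilde p n ν k j τ₀ τ₁) =
      -∑ j ∈ Finset.range (p ^ k), chainPeriod p n hn ν k j τ₀ := by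
    rw [← Finset.sum_neg_distrib]
    exact Finset.sum_congr rfl fun j _ => pairing_C1Tilde he hν₂ k j τ₀ τ₁
  rw [hpair]
  set K := ∑ j ∈ Finset.range (p ^ k), chainPeriod p n hn ν k j τ₀ with hK
  -- the coefficient of `y ^ t` contributed by the terms at `w₀`
  let c : ℕ → ℂ := fun j => (-1) ^ ((ν : ℕ) + 1) * ((p : ℂ) ^ ell p k j) ^ (ν : ℕ) *
        ((p : ℂ) ^ ell p k j * Complex.I) ^ t / ((p : ℂ) ^ (k - ell p k j) * ((n - ν : ℕ) + 1))
  let T : ℝ → ℂ := fun y => ∑ j ∈ Finset.range (p ^ k), unitPeriodTail n hn (E0 p n ν k j)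
        (((p : ℂ) ^ ell p k j * (y * Complex.I) - dd p k j) / (p : ℂ) ^ (k - ell p k j))
  -- By `chainPeriod_const` the base point may be moved to iy, so that -1/τ₀ becomes i/y; the
  -- argument pu of the second tail then amounts to replacing y by y/p.
  have hval : ∀ y : ℝ, 0 < y → K =
      (Complex.I / y) ^ ((ν : ℕ) + 1) / ((ν : ℂ) + 1) - (bernSum₁ p ν k : ℚ) +
      (g₁ * unitPeriodTail n hn (e ℚ n ν) (Complex.I / y) -
        (p : ℂ) ^ (n - ν : ℕ) * g₀ * unitPeriodTail n hn (e ℚ n ν) (Complex.I / (y / p : ℝ))) +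
      ((∑ j ∈ Finset.range (p ^ k), c j) * (y : ℂ) ^ t - (bernSum₀ p ν (n - ν) k : ℚ) + T y) := by
    intro y hy
    have hy0 : (y : ℂ) ≠ 0 := by exact_mod_cast hy.ne'
    have hyI : 0 < ((y : ℂ) * Complex.I).im := by simpa using hy
    have hIy : 0 < (Complex.I / (y : ℂ)).im := by
      rw [Complex.div_ofReal_im]; simpa using hy
    have h1 : K = ∑ j ∈ Finset.range (p ^ k), chainPeriod p n hn ν k j (y * Complex.I) :=
      Finset.sum_congr rfl fun j _ => chainPeriod_const hν₁ hν₂ k j τ₀.im_pos hyI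
    have h2 : -1 / ((y : ℂ) * Complex.I) = Complex.I / y := by
      field_simp
      simp
    have h3 : (p : ℂ) * (Complex.I / y) = Complex.I / (y / p : ℝ) := by
      push_cast; field_simp
    rw [h1]
    simp only [chainPeriod]
    rw [Finset.sum_add_distrib, h2, sum_unitPeriod_E1 he hν₂ k hIy, h3]
    congr 1
    rw [Finset.sum_congr rfl fun j _ => unitPeriod_E0 (hn := hn) hν₁ k j hyI,
      Finset.sum_add_distrib, Finset.sum_sub_distrib, bernSum₀, Rat.cast_sum, Finset.sum_mul]
    congr 2
    apply Finset.sum_congr rfl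
    intro j _
    simp only [c]
    rw [← mul_assoc, mul_right_comm _ (y : ℂ), mul_pow _ (y : ℂ)]
    ring
  have hT : Filter.Tendsto T Filter.atTop (nhds 0) := by
    have h1 : Filter.Tendsto T Filter.atTop (nhds (∑ j ∈ Finset.range (p ^ k), 0)) := by
      apply tendsto_finsetSum
      intro j _
      refine (tendsto_unitPeriodTail (hn := hn) he (E0 p n ν k j)
        (-(dd p k j : ℝ) / (p : ℝ) ^ (k - ell p k j))
        (a := (p : ℝ) ^ ell p k j / (p : ℝ) ^ (k - ell p k j)) (by positivity)).congr fun y => ?_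
      congr 1
      push_cast
      ring
    simpa using h1
  have hI : Filter.Tendsto (fun y : ℝ => (Complex.I / (y : ℂ)) ^ ((ν : ℕ) + 1) / ((ν : ℂ) + 1))
      Filter.atTop (nhds 0) := by
    have h1 : Filter.Tendsto (fun y : ℝ => Complex.I / (y : ℂ)) Filter.atTop (nhds 0) := by
      have h2 := (Complex.continuous_ofReal.tendsto 0).comp tendsto_inv_atTop_zero
      have h3 := h2.const_mul Complex.I
      rw [Complex.ofReal_zero, mul_zero] at h3
      refine h3.congr fun y => ?_
      simp [div_eq_mul_inv]
    have h2 := (h1.pow ((ν : ℕ) + 1)).div_const ((ν : ℂ) + 1)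
    simpa using h2
  have hRp : Filter.Tendsto (fun y : ℝ => unitPeriodTail n hn (e ℚ n ν) (Complex.I / (y / p : ℝ)) +
      κ * ((y / p : ℝ) : ℂ) ^ t) Filter.atTop (nhds (-R)) :=
    hR.comp (Filter.tendsto_id.atTop_div_const hpR)
  have hlim := ((hI.add ((hR.const_mul g₁).sub (hRp.const_mul ((p : ℂ) ^ (n - ν : ℕ) * g₀)))).add
    hT).sub_const (g₁ * -R - (p : ℂ) ^ (n - ν : ℕ) * g₀ * -R)
  have hzero : K + (bernSum₁ p ν k : ℚ) + (bernSum₀ p ν (n - ν) k : ℚ) -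
      (g₁ * -R - (p : ℂ) ^ (n - ν : ℕ) * g₀ * -R) = 0 := by
    -- A collects the multiples of y^t from the counterterms of the two tails and from the
    -- polynomial parts at w₀. Only its independence of y matters.
    refine eq_zero_of_tendsto_add_mul_pow (t := t) (A := g₁ * κ -
      (p : ℂ) ^ (n - ν : ℕ) * g₀ * (κ * (1 / (p : ℂ) ^ t)) - ∑ j ∈ Finset.range (p ^ k), c j)
      (by omega) ?_
    have hz : (0 : ℂ) + (g₁ * -R - (p : ℂ) ^ (n - ν : ℕ) * g₀ * -R) + 0 -
      (g₁ * -R - (p : ℂ) ^ (n - ν : ℕ) * g₀ * -R) = 0 := by ring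
    rw [hz] at hlim
    refine hlim.congr' ?_
    filter_upwards [Filter.eventually_gt_atTop 0] with y hy
    rw [hval y hy]
    push_cast
    rw [div_pow]
    ring
  linear_combination -hzero

end Sum

/-! ### Regularized Mellin transforms -/

section Mellin

open MeasureTheory Set Filter Topology

/-- The function `P.f_modif` is f - f₀ beyond 1 and f - ε t^(-k) g₀ on (0, 1). On (x, 1) it differs
from f - f₀ by elementary powers, whose Mellin integral is explicit. -/
lemma weakFEPair_integrableOn_and_integral (P : WeakFEPair ℂ) {s : ℂ} (hs : s ≠ 0)
    (hsk : s ≠ P.k) {x : ℝ} (hx : 0 < x) (hx1 : x < 1) :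
    IntegrableOn (fun t : ℝ => (t : ℂ) ^ (s - 1) * (P.f t - P.f₀)) (Ioi x) ∧
    ∫ t in Ioi x, (t : ℂ) ^ (s - 1) * (P.f t - P.f₀) =
      (∫ t in Ioi x, (t : ℂ) ^ (s - 1) * P.f_modif t) -
        (P.f₀ * ((1 - (x : ℂ) ^ s) / s) -
          P.ε * P.g₀ * ((1 - (x : ℂ) ^ (s - P.k)) / (s - P.k))) := by
  have hI : Ioi x ⊆ Ioi (0 : ℝ) := Ioi_subset_Ioi hx.le
  have hm : IntegrableOn (fun t : ℝ => (t : ℂ) ^ (s - 1) * P.f_modif t) (Ioi x) :=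
    ((P.isStrongFEPair_toStrongFEPair.hasMellin s).1).mono_set hI
  set φ : ℝ → ℂ := fun t => P.f₀ * (t : ℂ) ^ (s - 1) -
    P.ε * P.g₀ * (t : ℂ) ^ (s - P.k - 1) with hφ
  have h0 : (0 : ℝ) ∉ uIcc x 1 := by
    rw [uIcc_of_le hx1.le]; exact fun h => absurd h.1 (not_le.2 hx)
  have hi1 : IntervalIntegrable (fun t : ℝ => (t : ℂ) ^ (s - 1)) volume x 1 :=
    intervalIntegral.intervalIntegrable_cpow (Or.inr h0)
  have hi2 : IntervalIntegrable (fun t : ℝ => (t : ℂ) ^ (s - P.k - 1)) volume x 1 :=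
    intervalIntegral.intervalIntegrable_cpow (Or.inr h0)
  have hφi : IntervalIntegrable φ volume x 1 := (hi1.const_mul _).sub (hi2.const_mul _)
  have hφint : ∫ t in x..1, φ t = P.f₀ * ((1 - (x : ℂ) ^ s) / s) -
      P.ε * P.g₀ * ((1 - (x : ℂ) ^ (s - P.k)) / (s - P.k)) := by
    rw [intervalIntegral.integral_sub (hi1.const_mul _) (hi2.const_mul _),
      intervalIntegral.integral_const_mul, intervalIntegral.integral_const_mul,
      integral_cpow (Or.inr ⟨by simpa [sub_eq_iff_eq_add] using hs, h0⟩),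
      integral_cpow (Or.inr ⟨by
        intro h
        apply hsk
        linear_combination h, h0⟩)]
    simp
  have hφs : IntegrableOn ((Ioo x 1).indicator φ) (Ioi x) := by
    rw [integrableOn_indicator_iff measurableSet_Ioo]
    rw [intervalIntegrable_iff_integrableOn_Ioo_of_le hx1.le] at hφi
    exact hφi.mono_set inter_subset_left
  -- The point t = 1 belongs to neither piece of `P.f_modif` and is discarded as a null set.
  have hae : (fun t : ℝ => (t : ℂ) ^ (s - 1) * P.f_modif t - (Ioo x 1).indicator φ t)
      =ᵐ[volume.restrict (Ioi x)] fun t : ℝ => (t : ℂ) ^ (s - 1) * (P.f t - P.f₀) := by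
    rw [EventuallyEq, ae_restrict_iff' measurableSet_Ioi]
    filter_upwards [compl_mem_ae_iff.mpr (Set.subsingleton_singleton.measure_zero
      (s := ({1} : Set ℝ)) volume)] with t ht1 htx
    have ht1 : t ≠ 1 := ht1
    have ht0 : 0 < t := hx.trans htx
    rcases lt_or_gt_of_ne ht1 with h | h
    · rw [indicator_of_mem (show t ∈ Ioo x 1 from ⟨htx, h⟩), WeakFEPair.f_modif, Pi.add_apply,
        indicator_of_notMem (by simpa using h.le), indicator_of_mem (show t ∈ Ioo 0 1 from ⟨ht0, h⟩)]
      have e1 : (t : ℂ) ^ (s - P.k - 1) = (t : ℂ) ^ (s - 1) * ((t ^ (-P.k) : ℝ) : ℂ) := by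
        rw [Complex.ofReal_cpow ht0.le, Complex.ofReal_neg,
          ← Complex.cpow_add _ _ (Complex.ofReal_ne_zero.2 ht0.ne')]
        ring_nf
      rw [hφ]
      simp only
      rw [e1, smul_eq_mul]
      ring
    · rw [indicator_of_notMem (fun h' => absurd h'.2 (not_lt.2 h.le)), WeakFEPair.f_modif,
        Pi.add_apply, indicator_of_mem (show t ∈ Ioi 1 from h),
        indicator_of_notMem (fun h' => absurd h'.2 (not_lt.2 h.le))]
      ring
  refine ⟨(hm.sub hφs).congr hae, ?_⟩
  rw [← integral_congr_ae hae, integral_sub hm hφs, setIntegral_indicator measurableSet_Ioo,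
    inter_eq_right.2 Ioo_subset_Ioi_self, ← integral_Ioc_eq_integral_Ioo,
    ← intervalIntegral.integral_of_le hx1.le, hφint]

lemma weakFEPair_integrableOn (P : WeakFEPair ℂ) {s : ℂ} (hs : s ≠ 0)
    (hsk : s ≠ P.k) {x : ℝ} (hx : 0 < x) :
    IntegrableOn (fun t : ℝ => (t : ℂ) ^ (s - 1) * (P.f t - P.f₀)) (Ioi x) := by
  have h : 0 < min x (1 / 2) := lt_min hx (by norm_num)
  exact (weakFEPair_integrableOn_and_integral P hs hsk h
    ((min_le_right _ _).trans_lt (by norm_num))).1.mono_set (Ioi_subset_Ioi (min_le_left _ _))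

/-- The value of the completed `L`-function as a regularized Mellin integral. -/
lemma weakFEPair_tendsto (P : WeakFEPair ℂ) {s : ℂ} (hs : 0 < s.re) (hsk : s ≠ P.k) :
    Tendsto (fun x : ℝ => (∫ t in Ioi x, (t : ℂ) ^ (s - 1) * (P.f t - P.f₀)) +
      P.ε * P.g₀ / (s - P.k) * (x : ℂ) ^ (s - P.k)) (𝓝[>] 0) (𝓝 (P.Λ s)) := by
  have hs0 : s ≠ 0 := by rintro rfl; simp at hs
  have h1 : Tendsto (fun x : ℝ => ∫ t in Ioi x, (t : ℂ) ^ (s - 1) * P.f_modif t) (𝓝[>] 0)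
      (𝓝 (P.Λ₀ s)) := by
    have hc : AECover (volume.restrict (Ioi (0 : ℝ))) (𝓝[>] (0 : ℝ)) (fun x : ℝ => Ioi x) :=
      aecover_Ioi_of_Ioi (tendsto_id.mono_left nhdsWithin_le_nhds)
    have h := hc.integral_tendsto_of_countably_generated
      (P.isStrongFEPair_toStrongFEPair.hasMellin s).1
    refine h.congr' ?_
    filter_upwards [self_mem_nhdsWithin] with x hx
    rw [Measure.restrict_restrict measurableSet_Ioi,
      inter_eq_left.2 (Ioi_subset_Ioi (le_of_lt hx))]
    rfl
  -- The boundary term in x^s disappears because Re s > 0; the one in x^(s-k) is the counterterm of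
  -- the statement.
  have h2 : Tendsto (fun x : ℝ => (x : ℂ) ^ s) (𝓝[>] 0) (𝓝 0) := by
    have h3 := (Complex.continuous_ofReal_cpow_const hs).tendsto 0
    rw [Complex.ofReal_zero, Complex.zero_cpow hs0] at h3
    exact h3.mono_left nhdsWithin_le_nhds
  have h4 := h1.sub (((h2.const_sub 1).div_const s).const_mul P.f₀)
  have h5 := h4.add_const (P.ε * P.g₀ / (s - P.k))
  have hval : P.Λ₀ s - P.f₀ * ((1 - 0) / s) + P.ε * P.g₀ / (s - P.k) = P.Λ s := by
    rw [WeakFEPair.Λ, smul_eq_mul, smul_eq_mul, ← neg_sub s, div_neg]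
    ring
  rw [hval] at h5
  refine h5.congr' ?_
  have hev : Ioo (0 : ℝ) 1 ∈ 𝓝[>] (0 : ℝ) := Ioo_mem_nhdsGT one_pos
  filter_upwards [hev] with x hx
  rw [(weakFEPair_integrableOn_and_integral P hs0 hsk hx.1 hx.2).2]
  ring

end Mellin

/-! ### The completed `L`-function of the Eisenstein series -/

/-- The function σ_m is the Dirichlet convolution of the constant 1 with r ↦ r^m. -/
lemma LSeriesHasSum_sigma (m : ℕ) {s : ℂ} (hs : (m : ℝ) + 1 < s.re) :
    LSeriesHasSum (fun r => (ArithmeticFunction.sigma m r : ℂ)) s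
      (riemannZeta s * riemannZeta (s - m)) := by
  have hs1 : 1 < s.re := by
    have : (0 : ℝ) ≤ m := Nat.cast_nonneg m
    linarith
  have h1 := ArithmeticFunction.LSeriesHasSum_zeta hs1
  have hpow : LSeriesHasSum (fun r => ((ArithmeticFunction.pow m : ArithmeticFunction ℕ) r : ℂ)) s
      (riemannZeta (s - m)) := by
    have h2 := ArithmeticFunction.LSeriesHasSum_zeta (s := s - m) (by simp; linarith)
    refine HasSum.congr_fun h2 fun r => ?_
    rcases Nat.eq_zero_or_pos r with rfl | hr
    · simp
    · have hr0 : (r : ℂ) ≠ 0 := by exact_mod_cast hr.ne'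
      rw [LSeries.term_of_ne_zero hr.ne', LSeries.term_of_ne_zero hr.ne',
        ArithmeticFunction.pow_apply, ArithmeticFunction.zeta_apply_ne hr.ne', if_neg (by omega),
        Complex.cpow_sub _ _ hr0, Complex.cpow_natCast]
      push_cast
      field_simp
  have h3 := ArithmeticFunction.LSeriesHasSum_mul (f := ((ArithmeticFunction.zeta :
    ArithmeticFunction ℕ) : ArithmeticFunction ℂ)) (g := ((ArithmeticFunction.pow m :
    ArithmeticFunction ℕ) : ArithmeticFunction ℂ)) (by simpa using h1) (by simpa using hpow)
  refine HasSum.congr_fun h3 fun r => ?_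
  congr 1
  funext r
  rw [← ArithmeticFunction.natCoe_mul, ArithmeticFunction.zeta_mul_pow_eq_sigma,
    ArithmeticFunction.natCoe_apply]

/-- The Mellin pair attached to the Eisenstein series. -/
noncomputable def eisPair (n : ℕ) (hn : 2 ≤ n) : WeakFEPair ℂ :=
  ModularForm.weakFEPair (Γ := 𝒮ℒ) (k := ((n + 2 : ℕ) : ℤ)) (by positivity)
    (ModularForm.E (k := n + 2) (by omega))

section Eisenstein

variable {n : ℕ} {hn : 2 ≤ n}

lemma eisPair_k : (eisPair n hn).k = (n : ℝ) + 2 := by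
  simp [eisPair]

lemma eisPair_f₀ (he : Even n) : (eisPair n hn).f₀ = 1 := valueAtInfty_E (hn := hn) he

lemma eisPair_f (t : ℝ) : (eisPair n hn).f t = eisFun n hn (Complex.I * t) := rfl

lemma eisenstein_coeff (he : Even n) (r : ℕ) :
    (PowerSeries.coeff r) (UpperHalfPlane.qExpansion 1 (ModularForm.E (k := n + 2) (by omega))) =
      if r = 0 then 1 else 2 / riemannZeta (-1 - (n : ℂ)) * (ArithmeticFunction.sigma (n + 1) r) := by
  have hk : 3 ≤ n + 2 := by omega
  rw [EisensteinSeries.E_qExpansion_coeff hk (he.add even_two)]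
  have hz : riemannZeta (-1 - (n : ℂ)) = -(bernoulli (n + 2) : ℂ) / (n + 2) := by
    have h := riemannZeta_neg_nat_eq_bernoulli (n + 1)
    have hs : (-1 - (n : ℂ)) = -((n + 1 : ℕ) : ℂ) := by push_cast; ring
    rw [hs, h]
    have : Odd (n + 1) := he.add_one
    push_cast
    rw [this.neg_one_pow]
    ring_nf
  rw [hz]
  congr 1
  have : (n : ℂ) + 2 ≠ 0 := by exact_mod_cast (by omega : n + 2 ≠ 0)
  rw [div_div_eq_mul_div]
  push_cast
  rw [div_neg]

lemma eisPair_Λ_of_re (he : Even n) {s : ℂ} (hs : (n : ℝ) + 3 < s.re) :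
    (eisPair n hn).Λ s = (2 * Real.pi : ℂ) ^ (-s) * Complex.Gamma s *
      (2 / riemannZeta (-1 - (n : ℂ)) * (riemannZeta s * riemannZeta (s - (n + 1)))) := by
  have h1 := ModularForm.hasSum_Λ (Γ := 𝒮ℒ) (k := ((n + 2 : ℕ) : ℤ)) (by positivity)
    (ModularForm.E (k := n + 2) (by omega)) (s := s) (by push_cast; linarith)
  have h2 := LSeriesHasSum_sigma (n + 1) (s := s) (by push_cast; linarith)
  have h3 := (h2.mul_left (2 / riemannZeta (-1 - (n : ℂ)))).mul_left
    ((2 * Real.pi : ℂ) ^ (-s) * Complex.Gamma s)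
  push_cast at h3
  refine h1.unique (h3.congr_fun fun r => ?_)
  rw [Subgroup.strictWidthInfty_SL2Z, eisenstein_coeff (hn := hn) he]
  rcases Nat.eq_zero_or_pos r with rfl | hr
  · have hs0 : s ≠ 0 := by
      rintro rfl
      rw [Complex.zero_re] at hs
      have : (0 : ℝ) ≤ n := Nat.cast_nonneg n
      linarith
    simp [hs0]
  · have hr0 : (r : ℂ) ≠ 0 := by exact_mod_cast hr.ne'
    have hpi : (Real.pi : ℂ) ≠ 0 := by exact_mod_cast Real.pi_ne_zero
    have e1 : (((2 * r / 1 : ℝ) : ℝ) : ℂ) ^ s = 2 ^ s * (r : ℂ) ^ s := by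
      rw [div_one, Complex.ofReal_mul, Complex.mul_cpow_ofReal_nonneg zero_le_two
        (Nat.cast_nonneg r)]
      simp
    have e2 : (2 * Real.pi : ℂ) ^ (-s) = 2 ^ (-s) * (Real.pi : ℂ) ^ (-s) := by
      have := Complex.mul_cpow_ofReal_nonneg zero_le_two Real.pi_pos.le (-s)
      simpa using this
    rw [if_neg hr.ne', LSeries.term_of_ne_zero hr.ne', e2, Complex.cpow_neg 2]
    have e3 := e1
    push_cast at e3 ⊢
    rw [e3]
    have h4 : (2 : ℂ) ^ s ≠ 0 := by simp [Complex.cpow_eq_zero_iff]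
    have h5 : (r : ℂ) ^ s ≠ 0 := by simp [Complex.cpow_eq_zero_iff, hr0]
    field_simp

/-- Analytic continuation of the preceding formula, needed at s = ν + 1, outside its half plane.
After division by Γ both sides are holomorphic off {0, 1, n + 2}, and the complement of a countable
set in the plane is connected. -/
lemma eisPair_Λ (he : Even n) {s : ℂ} (hs : 1 < s.re) (hsk : s ≠ n + 2) :
    (eisPair n hn).Λ s = (2 * Real.pi : ℂ) ^ (-s) * Complex.Gamma s *
      (2 / riemannZeta (-1 - (n : ℂ)) * (riemannZeta s * riemannZeta (s - (n + 1)))) := by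
  set F : ℂ → ℂ := fun s => (eisPair n hn).Λ s * (Complex.Gamma s)⁻¹ with hF
  set G : ℂ → ℂ := fun s => (2 * Real.pi : ℂ) ^ (-s) *
    (2 / riemannZeta (-1 - (n : ℂ)) * (riemannZeta s * riemannZeta (s - (n + 1)))) with hG
  set U : Set ℂ := ({0, 1, (n : ℂ) + 2} : Set ℂ)ᶜ with hU
  have hUo : IsOpen U := (Set.toFinite _).isClosed.isOpen_compl
  have hUc : IsPreconnected U := ((Set.Countable.isConnected_compl_of_one_lt_rank (by simp)
    (Set.toFinite _).countable)).isPreconnected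
  have hmem : ∀ {s : ℂ}, s ∈ U ↔ s ≠ 0 ∧ s ≠ 1 ∧ s ≠ n + 2 := by
    intro s; simp [hU]
  have hFd : DifferentiableOn ℂ F U := by
    intro s hs
    obtain ⟨h0, -, h2⟩ := hmem.1 hs
    refine DifferentiableAt.differentiableWithinAt (DifferentiableAt.mul ?_ ?_)
    · refine (eisPair n hn).differentiableAt_Λ (Or.inl h0) (Or.inl ?_)
      rw [eisPair_k]
      push_cast
      exact h2
    · exact Complex.differentiable_one_div_Gamma s
  have h2pi : (2 * Real.pi : ℂ) ≠ 0 := by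
    exact_mod_cast (by positivity : (2 * Real.pi : ℝ) ≠ 0)
  have hGd : DifferentiableOn ℂ G U := by
    intro s hs
    obtain ⟨-, h1, h2⟩ := hmem.1 hs
    refine DifferentiableAt.differentiableWithinAt (DifferentiableAt.mul ?_ (DifferentiableAt.mul
      (differentiableAt_const _) (DifferentiableAt.mul (differentiableAt_riemannZeta h1) ?_)))
    · exact (differentiable_neg s).const_cpow (Or.inl h2pi)
    · refine DifferentiableAt.comp s (differentiableAt_riemannZeta ?_) (by fun_prop)
      intro h
      apply h2
      linear_combination h
  have hz₀ : ((n + 4 : ℕ) : ℂ) ∈ U := by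
    rw [hmem]
    refine ⟨by exact_mod_cast (by omega : n + 4 ≠ 0), by exact_mod_cast (by omega : n + 4 ≠ 1),
      by exact_mod_cast (by omega : n + 4 ≠ n + 2)⟩
  have hev : F =ᶠ[nhds ((n + 4 : ℕ) : ℂ)] G := by
    have ho : IsOpen {s : ℂ | (n : ℝ) + 3 < s.re} := isOpen_lt continuous_const Complex.continuous_re
    filter_upwards [ho.mem_nhds (show (n : ℝ) + 3 < ((n + 4 : ℕ) : ℂ).re by
      rw [Complex.natCast_re]; push_cast; linarith)] with s hs
    have hs' : (n : ℝ) + 3 < s.re := hs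
    have hG0 : Complex.Gamma s ≠ 0 := Complex.Gamma_ne_zero_of_re_pos (by
      have : (0 : ℝ) ≤ n := Nat.cast_nonneg n
      linarith)
    simp only [hF, hG]
    rw [eisPair_Λ_of_re he hs']
    field_simp
  have hEq := (hFd.analyticOnNhd hUo).eqOn_of_preconnected_of_eventuallyEq
    (hGd.analyticOnNhd hUo) hUc hz₀ hev
  have hsU : s ∈ U := by
    rw [hmem]
    refine ⟨?_, ?_, hsk⟩
    · rintro rfl; simp at hs; linarith
    · rintro rfl; simp at hs
  have h := hEq hsU
  have hG0 : Complex.Gamma s ≠ 0 := Complex.Gamma_ne_zero_of_re_pos (by linarith)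
  simp only [hF, hG] at h
  rw [mul_inv_eq_iff_eq_mul₀ hG0] at h
  rw [h]
  ring

end Eisenstein

/-! ### The regularized period of the Eisenstein series as an L-value -/

section Period

variable {n : ℕ} {hn : 2 ≤ n} {ν : Fin (n + 1)}

/-- Along the imaginary axis the tail is a primitive of I^(ν+1) times the Mellin integrand at s = ν
+ 1, and it vanishes at i∞. -/
lemma unitPeriodTail_eq_integral (he : Even n) (hν₂ : (ν : ℕ) < n) {x : ℝ}
    (hx : 0 < x) :
    unitPeriodTail n hn (e ℚ n ν) (Complex.I * x) = -(Complex.I ^ ((ν : ℕ) + 1) *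
      ∫ t in Set.Ioi x, (t : ℂ) ^ ((((ν : ℕ) + 1 : ℕ) : ℂ) - 1) *
        ((eisPair n hn).f t - (eisPair n hn).f₀)) := by
  have hs0 : (((ν : ℕ) + 1 : ℕ) : ℂ) ≠ 0 := by exact_mod_cast Nat.succ_ne_zero (ν : ℕ)
  have hsk : (((ν : ℕ) + 1 : ℕ) : ℂ) ≠ (eisPair n hn).k := by
    rw [eisPair_k]
    exact_mod_cast (by omega : (ν : ℕ) + 1 ≠ n + 2)
  have hint := weakFEPair_integrableOn (eisPair n hn) hs0 hsk hx
  have hder : ∀ t ∈ Set.Ici x, HasDerivAt (fun t : ℝ => unitPeriodTail n hn (e ℚ n ν) (Complex.I * t))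
      (Complex.I ^ ((ν : ℕ) + 1) * ((t : ℂ) ^ ((((ν : ℕ) + 1 : ℕ) : ℂ) - 1) *
        ((eisPair n hn).f t - (eisPair n hn).f₀))) t := by
    intro t ht
    have ht0 : 0 < t := hx.trans_le ht
    have him : 0 < (Complex.I * (t : ℂ)).im := by simpa using ht0
    have h1 : HasDerivAt (fun t : ℝ => Complex.I * (t : ℂ)) Complex.I t := by
      simpa using (Complex.ofRealCLM.hasDerivAt (x := t)).const_mul Complex.I
    have h2 := (hasDerivAt_unitPeriodTail (hn := hn) (coef_last_e hν₂) him).comp t h1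
    refine h2.congr_deriv ?_
    rw [ev_e, eisPair_f, eisPair_f₀ he, mul_pow, Nat.cast_add, Nat.cast_one, add_sub_cancel_right,
      Complex.cpow_natCast]
    ring
  have hlim : Filter.Tendsto (fun t : ℝ => unitPeriodTail n hn (e ℚ n ν) (Complex.I * t))
      Filter.atTop (nhds 0) := by
    refine (tendsto_unitPeriodTail (hn := hn) he (e ℚ n ν) 0 one_pos).congr fun y => ?_
    congr 1
    push_cast
    ring
  have h := MeasureTheory.integral_Ioi_of_hasDerivAt_of_tendsto' hder (hint.const_mul _) hlim
  rw [MeasureTheory.integral_const_mul] at h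
  rw [h]
  ring

/-- The regularized period of the Eisenstein series. -/
lemma I_pow_mul_Λ (he : Even n) (hν₁ : 1 ≤ (ν : ℕ)) (hν₂ : (ν : ℕ) < n) :
    Complex.I ^ ((ν : ℕ) + 1) * (eisPair n hn).Λ (((ν : ℕ) + 1 : ℕ) : ℂ) =
      riemannZeta (-((ν : ℕ) : ℂ)) * riemannZeta (((ν : ℕ) : ℂ) - n) /
        riemannZeta (-1 - (n : ℂ)) := by
  have hre : 1 < ((((ν : ℕ) + 1 : ℕ) : ℂ)).re := by
    rw [Complex.natCast_re]
    exact_mod_cast (by omega : 1 < (ν : ℕ) + 1)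
  rw [eisPair_Λ he hre (by exact_mod_cast (by omega : (ν : ℕ) + 1 ≠ n + 2))]
  have e1 : (((ν : ℕ) + 1 : ℕ) : ℂ) - (n + 1) = ((ν : ℕ) : ℂ) - n := by push_cast; ring
  rw [e1]
  -- For ν even, n - ν is even and positive, and the trivial zero ζ(ν - n) = 0 kills both sides. For
  -- ν odd, the functional equation at ν + 1 applies, with cosine factor I^(ν+1).
  rcases Nat.even_or_odd (ν : ℕ) with hpar | hpar
  · have hz : riemannZeta (((ν : ℕ) : ℂ) - n) = 0 := by
      obtain ⟨a, ha⟩ := he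
      obtain ⟨b, hb⟩ := hpar
      obtain ⟨c, rfl⟩ : ∃ c, a = b + c + 1 := ⟨a - b - 1, by omega⟩
      have : ((ν : ℕ) : ℂ) - n = -2 * ((c : ℂ) + 1) := by
        rw [hb, ha]; push_cast; ring
      rw [this]
      exact riemannZeta_neg_two_mul_nat_add_one c
    rw [hz]
    simp
  · have hfe := riemannZeta_one_sub (s := (((ν : ℕ) + 1 : ℕ) : ℂ)) (by
      intro m h
      have h1 := congrArg Complex.re h
      rw [Complex.neg_re, Complex.natCast_re, Complex.natCast_re] at h1
      have h2 : (0 : ℝ) ≤ m := Nat.cast_nonneg m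
      have h3 : (0 : ℝ) < ((ν : ℕ) + 1 : ℕ) := by positivity
      linarith) (by exact_mod_cast (by omega : (ν : ℕ) + 1 ≠ 1))
    have hcos : Complex.cos (Real.pi * (((ν : ℕ) + 1 : ℕ) : ℂ) / 2) = Complex.I ^ ((ν : ℕ) + 1) := by
      obtain ⟨m, hm⟩ := hpar
      rw [show (ν : ℕ) + 1 = 2 * (m + 1) by omega, pow_mul, Complex.I_sq]
      have : (Real.pi : ℂ) * ((2 * (m + 1) : ℕ) : ℂ) / 2 = ((m + 1 : ℕ) : ℂ) * Real.pi := by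
        push_cast; ring
      rw [this]
      exact_mod_cast congrArg ((↑) : ℝ → ℂ) (Real.cos_nat_mul_pi (m + 1))
    rw [hcos] at hfe
    have e2 : (1 : ℂ) - (((ν : ℕ) + 1 : ℕ) : ℂ) = -((ν : ℕ) : ℂ) := by push_cast; ring
    rw [e2] at hfe
    rw [hfe]
    ring

/-- The regularized integral of the Eisenstein series from `0` to `i∞`. -/
theorem tendsto_unitPeriodTail_zero (he : Even n) (hν₁ : 1 ≤ (ν : ℕ)) (hν₂ : (ν : ℕ) < n) :
    ∃ κ : ℂ, Filter.Tendsto (fun y : ℝ => unitPeriodTail n hn (e ℚ n ν) (Complex.I / y) +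
      κ * (y : ℂ) ^ (n - ν + 1 : ℕ)) Filter.atTop
      (nhds (-(riemannZeta (-((ν : ℕ) : ℂ)) * riemannZeta (((ν : ℕ) : ℂ) - n) /
        riemannZeta (-1 - (n : ℂ))))) := by
  set s : ℂ := (((ν : ℕ) + 1 : ℕ) : ℂ) with hs
  have hsre : 0 < s.re := by
    rw [hs, Complex.natCast_re]
    positivity
  have hsk : s ≠ (eisPair n hn).k := by
    rw [eisPair_k, hs]
    exact_mod_cast (by omega : (ν : ℕ) + 1 ≠ n + 2)
  set P := eisPair n hn with hP
  have h1 := ((weakFEPair_tendsto P hsre hsk).comp tendsto_inv_atTop_nhdsGT_zero).const_mul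
    (-Complex.I ^ ((ν : ℕ) + 1))
  rw [neg_mul, I_pow_mul_Λ he hν₁ hν₂] at h1
  -- The counterterm of the regularized Mellin integral at x = 1/y; as s - k = -(n - ν + 1), it is a
  -- positive power of y.
  refine ⟨-Complex.I ^ ((ν : ℕ) + 1) * (P.ε * P.g₀ / (s - P.k)), h1.congr' ?_⟩
  filter_upwards [Filter.eventually_gt_atTop 0] with y hy
  have hy0 : (y : ℂ) ≠ 0 := by exact_mod_cast hy.ne'
  have e1 : (Complex.I : ℂ) / y = Complex.I * ((y⁻¹ : ℝ) : ℂ) := by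
    push_cast; rw [div_eq_mul_inv]
  have e2 : (((y⁻¹ : ℝ) : ℂ)) ^ (s - P.k) = (y : ℂ) ^ (n - ν + 1 : ℕ) := by
    have : s - P.k = -((n - ν + 1 : ℕ) : ℂ) := by
      rw [hP, eisPair_k, hs]
      push_cast [Nat.cast_sub hν₂.le]
      ring
    rw [this, Complex.cpow_neg, Complex.cpow_natCast]
    push_cast
    rw [inv_pow, inv_inv]
  rw [e1, unitPeriodTail_eq_integral he hν₂ (inv_pos.2 hy)]
  simp only [Function.comp_apply]
  rw [e2]
  ring

end Period

/-! ### Distribution relations for Bernoulli polynomials -/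

lemma eq_C_of_comp_add_one {F : Polynomial ℚ} (h : F.comp (Polynomial.X + 1) = F) :
    F = Polynomial.C (F.eval 0) := by
  have h1 : ∀ m : ℕ, F.eval (m : ℚ) = F.eval 0 := by
    intro m
    induction m with
    | zero => simp
    | succ m ih =>
      rw [← ih]
      conv_rhs => rw [← h]
      simp
  apply Polynomial.eq_of_infinite_eval_eq
  refine Set.Infinite.mono ?_ (Set.infinite_range_of_injective (Nat.cast_injective (R := ℚ)))
  rintro _ ⟨m, rfl⟩
  simpa using h1 m

/-- The multiplication theorem for Bernoulli polynomials. -/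
lemma bernoulli_multiplication {N : ℕ} (hN : 0 < N) (t : ℕ) :
    Polynomial.C ((N : ℚ) ^ t) * ∑ j ∈ Finset.range N, (Polynomial.bernoulli t).comp
      (Polynomial.C (1 / (N : ℚ)) * (Polynomial.X + Polynomial.C (j : ℚ))) =
    Polynomial.C (N : ℚ) * Polynomial.bernoulli t := by
  have hN0 : (N : ℚ) ≠ 0 := by exact_mod_cast hN.ne'
  let g : ℕ → Polynomial ℚ := fun t =>
    Polynomial.C ((N : ℚ) ^ t) * ∑ j ∈ Finset.range N, (Polynomial.bernoulli t).comp
      (Polynomial.C (1 / (N : ℚ)) * (Polynomial.X + Polynomial.C (j : ℚ)))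
  -- In degree t + 1 the two sides differ by a polynomial of period 1, hence by a constant.
  -- Differentiating gives t + 1 times the identity in degree t, so the constant is never
  -- determined.
  have hshift : ∀ t, (g (t + 1) - Polynomial.C (N : ℚ) * Polynomial.bernoulli (t + 1)).comp
      (Polynomial.X + 1) = g (t + 1) - Polynomial.C (N : ℚ) * Polynomial.bernoulli (t + 1) := by
    intro t
    apply Polynomial.funext
    intro x
    simp only [g, Polynomial.eval_comp, Polynomial.eval_sub, Polynomial.eval_mul,
      Polynomial.eval_C, Polynomial.eval_finsetSum, Polynomial.eval_add, Polynomial.eval_X,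
      Polynomial.eval_one]
    have h1 : ∑ j ∈ Finset.range N, (Polynomial.bernoulli (t + 1)).eval (1 / (N : ℚ) * (x + 1 + j)) =
        ∑ j ∈ Finset.range N, (Polynomial.bernoulli (t + 1)).eval (1 / (N : ℚ) * (x + j)) +
        ((Polynomial.bernoulli (t + 1)).eval (1 / (N : ℚ) * (x + N)) -
          (Polynomial.bernoulli (t + 1)).eval (1 / (N : ℚ) * x)) := by
      have h2 := Finset.sum_range_succ (fun j : ℕ =>
        (Polynomial.bernoulli (t + 1)).eval (1 / (N : ℚ) * (x + j))) N
      rw [Finset.sum_range_succ'] at h2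
      simp only [Nat.cast_add, Nat.cast_one, Nat.cast_zero, add_zero] at h2
      have h3 : ∀ j : ℕ, x + 1 + (j : ℚ) = x + (j + 1) := fun j => by ring
      simp only [h3]
      linear_combination h2
    rw [h1, show 1 / (N : ℚ) * (x + N) = 1 + 1 / (N : ℚ) * x by field_simp; ring,
      Polynomial.bernoulli_eval_one_add, add_comm x 1, Polynomial.bernoulli_eval_one_add]
    have h2 : (N : ℚ) ^ t * (1 / (N : ℚ) * x) ^ t = x ^ t := by
      rw [← mul_pow]
      congr 1
      field_simp
    simp only [Nat.add_sub_cancel]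
    push_cast
    linear_combination (N : ℚ) * (t + 1) * h2
  have hder : ∀ t, Polynomial.derivative (g (t + 1)) = ((t : Polynomial ℚ) + 1) * g t := by
    intro t
    simp only [g, Polynomial.derivative_mul, Polynomial.derivative_C, zero_mul, zero_add,
      Polynomial.derivative_sum, Polynomial.derivative_comp,
      Polynomial.derivative_bernoulli_add_one, Polynomial.derivative_add, Polynomial.derivative_X,
      add_zero, mul_one, Polynomial.mul_comp, Polynomial.add_comp, Polynomial.natCast_comp,
      Polynomial.one_comp]
    rw [← Finset.mul_sum, ← Finset.mul_sum, pow_succ, Polynomial.C_mul]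
    have hC : Polynomial.C (N : ℚ) * Polynomial.C (1 / (N : ℚ)) = 1 := by
      rw [← Polynomial.C_mul, mul_one_div_cancel hN0, Polynomial.C_1]
    linear_combination (((t : Polynomial ℚ) + 1) * Polynomial.C ((N : ℚ) ^ t) *
      ∑ j ∈ Finset.range N, (Polynomial.bernoulli t).comp
      (Polynomial.C (1 / (N : ℚ)) * (Polynomial.X + Polynomial.C (j : ℚ)))) * hC
  have h := congrArg Polynomial.derivative (eq_C_of_comp_add_one (hshift t))
  rw [Polynomial.derivative_sub, hder, Polynomial.derivative_C, Polynomial.derivative_mul,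
    Polynomial.derivative_C, zero_mul, zero_add, Polynomial.derivative_bernoulli_add_one] at h
  have ht : ((t : Polynomial ℚ) + 1) ≠ 0 := by exact_mod_cast Nat.succ_ne_zero t
  apply mul_left_cancel₀ ht
  linear_combination h

lemma sum_bernoulli_eval_div {N : ℕ} (hN : 0 < N) (s : ℕ) :
    (N : ℚ) ^ s * ∑ j ∈ Finset.range N, (Polynomial.bernoulli (s + 1)).eval ((j : ℚ) / N) =
      bernoulli (s + 1) := by
  have hN0 : (N : ℚ) ≠ 0 := by exact_mod_cast hN.ne'
  have h := congrArg (Polynomial.eval 0) (bernoulli_multiplication hN (s + 1))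
  simp only [Polynomial.eval_mul, Polynomial.eval_C, Polynomial.eval_finsetSum,
    Polynomial.eval_comp, Polynomial.eval_add, Polynomial.eval_X, zero_add,
    Polynomial.bernoulli_eval_zero] at h
  apply mul_left_cancel₀ hN0
  rw [← h, ← mul_assoc, ← pow_succ']
  congr 1
  exact Finset.sum_congr rfl fun j _ => by rw [one_div_mul_eq_div]

lemma sum_range_pow_succ_split {M : Type*} [AddCommMonoid M] {p : ℕ} (hp : 0 < p) (r : ℕ)
    (f : ℕ → M) :
    ∑ j ∈ Finset.range (p ^ (r + 1)), f j =
      ∑ j ∈ (Finset.range (p ^ (r + 1))).filter (fun j => ¬ p ∣ j), f j +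
        ∑ j ∈ Finset.range (p ^ r), f (p * j) := by
  rw [← Finset.sum_filter_add_sum_filter_not _ (fun j => ¬ p ∣ j)]
  congr 1
  symm
  apply Finset.sum_bij (fun j _ => p * j)
  · intro j hj
    simp only [Finset.mem_filter, Finset.mem_range, not_not, dvd_mul_right, and_true] at hj ⊢
    rw [pow_succ']
    exact Nat.mul_lt_mul_of_pos_left hj hp
  · intro a _ b _ h
    exact Nat.eq_of_mul_eq_mul_left hp h
  · intro b hb
    simp only [Finset.mem_filter, Finset.mem_range, not_not] at hb
    obtain ⟨hb, c, rfl⟩ := hb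
    refine ⟨c, ?_, rfl⟩
    rw [pow_succ'] at hb
    exact Finset.mem_range.2 (Nat.lt_of_mul_lt_mul_left hb)
  · intro _ _; rfl

/-- The multiples of p in the distribution relation of level p^(r+1) form the relation of level p^r;
their removal produces the Euler factor. -/
lemma sum_units_bernoulli_eval_div {p : ℕ} (hp : 0 < p) (r s : ℕ) :
    ((p : ℚ) ^ (r + 1)) ^ s * ∑ j ∈ (Finset.range (p ^ (r + 1))).filter (fun j => ¬ p ∣ j),
      (Polynomial.bernoulli (s + 1)).eval ((j : ℚ) / (p : ℚ) ^ (r + 1)) =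
      (1 - (p : ℚ) ^ s) * bernoulli (s + 1) := by
  have hp0 : (p : ℚ) ≠ 0 := by exact_mod_cast hp.ne'
  have h1 := sum_bernoulli_eval_div (pow_pos hp (r + 1)) s
  have h2 := sum_bernoulli_eval_div (pow_pos hp r) s
  rw [sum_range_pow_succ_split hp] at h1
  push_cast at h1 h2
  have h3 : ∀ j : ℕ, (p : ℚ) * j / p ^ (r + 1) = j / p ^ r := by
    intro j
    rw [pow_succ']
    field_simp
  simp only [h3] at h1
  have h4 : ((p : ℚ) ^ (r + 1)) ^ s = (p : ℚ) ^ s * ((p : ℚ) ^ r) ^ s := by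
    rw [← mul_pow, pow_succ']
  rw [mul_add] at h1
  rw [h4] at h1 ⊢
  linear_combination h1 - (p : ℚ) ^ s * h2

/-! ### The Bernoulli sums of the corrected chains -/

/-- The rational value `ζ(-k)`. -/
noncomputable def zetaNeg (k : ℕ) : ℚ := -bernoulli' (k + 1) / (k + 1)

lemma riemannZeta_neg_eq_zetaNeg (k : ℕ) : riemannZeta (-(k : ℂ)) = (zetaNeg k : ℂ) := by
  rw [riemannZeta_neg_nat_eq_bernoulli', zetaNeg]
  push_cast
  rfl

lemma neg_one_pow_mul_bernoulli (k : ℕ) :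
    (-1 : ℚ) ^ (k + 1) * (bernoulli (k + 1) / (k + 1)) = -zetaNeg k := by
  rw [zetaNeg, bernoulli'_eq_bernoulli]
  ring

/-- By reflection, B_{ν+1}(-x) = (-1)^(ν+1) (B_{ν+1}(x) + (ν + 1) x^ν). The first term is summed by
the distribution relation; the second leaves a power sum that tends to 0 p-adically. -/
lemma bernSum₁_eq {p : ℕ} (hp : 0 < p) (ν k : ℕ) :
    bernSum₁ p ν k = -zetaNeg ν + (-1) ^ (ν + 1) * ∑ j ∈ Finset.range (p ^ k), (j : ℚ) ^ ν := by
  have hpk : ((p : ℚ) ^ k) ≠ 0 := pow_ne_zero _ (by exact_mod_cast hp.ne')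
  have hν : (ν : ℚ) + 1 ≠ 0 := by exact_mod_cast Nat.succ_ne_zero ν
  have h := sum_bernoulli_eval_div (pow_pos hp k) ν
  push_cast at h
  have hterm : ∀ j : ℕ, ((p : ℚ) ^ k) ^ ν *
      (Polynomial.bernoulli (ν + 1)).eval (-(j : ℚ) / (p : ℚ) ^ k) / (ν + 1) =
      (-1) ^ (ν + 1) / (ν + 1) * (((p : ℚ) ^ k) ^ ν *
        (Polynomial.bernoulli (ν + 1)).eval ((j : ℚ) / (p : ℚ) ^ k)) +
        (-1) ^ (ν + 1) * (j : ℚ) ^ ν := by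
    intro j
    rw [neg_div, Polynomial.bernoulli_eval_neg]
    simp only [Nat.add_sub_cancel, div_pow]
    push_cast
    field_simp
  rw [bernSum₁, Finset.sum_congr rfl fun j _ => hterm j, Finset.sum_add_distrib, ← Finset.mul_sum,
    ← Finset.mul_sum, ← Finset.mul_sum, h, ← neg_one_pow_mul_bernoulli]
  ring

lemma ell_of_not_dvd {p : ℕ} (k : ℕ) {j : ℕ} (hj : ¬ p ∣ j) : ell p k j = 0 := by
  rw [ell, if_neg (by rintro rfl; exact hj (dvd_zero p)), padicValNat.eq_zero_of_not_dvd hj]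
  simp

section Units

variable {p : ℕ} [Fact p.Prime]

lemma not_dvd_dInv {N j : ℕ} (hN : 0 < N) (hj : ¬ p ∣ j) : ¬ p ∣ dInv p N j := by
  have hp : p.Prime := Fact.out
  obtain ⟨-, -, h⟩ := dInv_spec hN hj
  intro hd
  have h1 : j * dInv p N j ≡ 1 [MOD p] := h.of_dvd (dvd_pow_self p hN.ne')
  have h2 : j * dInv p N j ≡ 0 [MOD p] := (Nat.modEq_zero_iff_dvd).2 (hd.mul_left j)
  have h3 := (Nat.modEq_zero_iff_dvd).1 (h1.symm.trans h2)
  exact hp.one_lt.ne' (Nat.dvd_one.1 h3)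

lemma dInv_dInv {N j : ℕ} (hN : 0 < N) (hj : ¬ p ∣ j) (hlt : j < p ^ N) :
    dInv p N (dInv p N j) = j := by
  obtain ⟨-, -, h⟩ := dInv_spec hN hj
  obtain ⟨-, hlt', h'⟩ := dInv_spec hN (not_dvd_dInv hN hj)
  have h1 : dInv p N (dInv p N j) * (j * dInv p N j) ≡ dInv p N (dInv p N j) * 1 [MOD p ^ N] :=
    h.mul_left _
  have h2 : j * (dInv p N j * dInv p N (dInv p N j)) ≡ j * 1 [MOD p ^ N] := h'.mul_left _
  have h3 : dInv p N (dInv p N j) ≡ j [MOD p ^ N] := by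
    rw [mul_one] at h1 h2
    refine h1.symm.trans ?_
    convert! h2 using 1
    ring
  exact Nat.ModEq.eq_of_lt_of_lt h3 hlt' hlt

/-- Inversion is an involution of the reduced residues modulo p^N. -/
lemma sum_units_dInv {M : Type*} [AddCommMonoid M] {N : ℕ} (hN : 0 < N) (f : ℕ → M) :
    ∑ j ∈ (Finset.range (p ^ N)).filter (fun j => ¬ p ∣ j), f (dInv p N j) =
      ∑ j ∈ (Finset.range (p ^ N)).filter (fun j => ¬ p ∣ j), f j := by
  have hmem : ∀ j ∈ (Finset.range (p ^ N)).filter (fun j => ¬ p ∣ j),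
      dInv p N j ∈ (Finset.range (p ^ N)).filter (fun j => ¬ p ∣ j) := by
    intro j hj
    simp only [Finset.mem_filter, Finset.mem_range] at hj ⊢
    exact ⟨(dInv_spec hN hj.2).2.1, not_dvd_dInv hN hj.2⟩
  have hinv : ∀ j ∈ (Finset.range (p ^ N)).filter (fun j => ¬ p ∣ j),
      dInv p N (dInv p N j) = j := by
    intro j hj
    simp only [Finset.mem_filter, Finset.mem_range] at hj
    exact dInv_dInv hN hj.2 hj.1
  exact Finset.sum_nbij' (dInv p N) (dInv p N) hmem hmem hinv hinv fun _ _ => rfl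

lemma ell_succ_mul (k j : ℕ) : ell p (k + 1) (p * j) = ell p k j + 1 := by
  have hp : p.Prime := Fact.out
  rcases Nat.eq_zero_or_pos j with rfl | hj
  · simp [ell]
  · rw [ell, ell, if_neg (mul_ne_zero hp.ne_zero hj.ne'), if_neg hj.ne',
      padicValNat.mul hp.ne_zero hj.ne', padicValNat_self]
    omega

/-- For j prime to p one has l = 0, and j ↦ d permutes the reduced residues. The index pj at level k
+ 1 has the same d and k - l as j at level k, while l grows by one, whence the factor p^ν. -/
lemma bernSum₀_succ (ν s k : ℕ) :
    bernSum₀ p ν s (k + 1) = (p : ℚ) ^ ν * bernSum₀ p ν s k +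
      (1 - (p : ℚ) ^ s) * ((-1) ^ (ν + 1) * (bernoulli (s + 1) / (s + 1))) := by
  have hp : p.Prime := Fact.out
  rw [bernSum₀, sum_range_pow_succ_split hp.pos, add_comm]
  congr 1
  · rw [bernSum₀, Finset.mul_sum]
    apply Finset.sum_congr rfl
    intro j _
    have hdd : dd p (k + 1) (p * j) = dd p k j := by
      rw [dd, dd, ell_succ_mul, Nat.add_sub_add_right, pow_succ', Nat.mul_div_mul_left _ _ hp.pos]
    rw [hdd, ell_succ_mul, Nat.add_sub_add_right, pow_succ (p : ℚ) (ell p k j), mul_pow]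
    ring
  · have h : ∀ j ∈ (Finset.range (p ^ (k + 1))).filter (fun j => ¬ p ∣ j),
        (-1 : ℚ) ^ (ν + 1) * ((p : ℚ) ^ ell p (k + 1) j) ^ ν *
        ((p : ℚ) ^ (k + 1 - ell p (k + 1) j)) ^ s * (Polynomial.bernoulli (s + 1)).eval
          ((dd p (k + 1) j : ℚ) / (p : ℚ) ^ (k + 1 - ell p (k + 1) j)) / (s + 1) =
        (-1 : ℚ) ^ (ν + 1) / (s + 1) * (((p : ℚ) ^ (k + 1)) ^ s *
          (Polynomial.bernoulli (s + 1)).eval ((dInv p (k + 1) j : ℚ) / (p : ℚ) ^ (k + 1))) := by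
      intro j hj
      have hl := ell_of_not_dvd (k + 1) (Finset.mem_filter.1 hj).2
      rw [dd, hl, pow_zero, pow_zero, Nat.div_one, Nat.sub_zero, one_pow]
      ring
    rw [Finset.sum_congr rfl h, sum_units_dInv (Nat.succ_pos k) (fun d : ℕ =>
      (-1 : ℚ) ^ (ν + 1) / (s + 1) * (((p : ℚ) ^ (k + 1)) ^ s *
          (Polynomial.bernoulli (s + 1)).eval ((d : ℚ) / (p : ℚ) ^ (k + 1)))), ← Finset.mul_sum,
      ← Finset.mul_sum, sum_units_bernoulli_eval_div hp.pos]
    ring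

end Units

/-! ### Values of the Kubota-Leopoldt functions at non-positive integers -/

lemma sum_Icc_units_eq {M : Type*} [AddCommMonoid M] (p c : ℕ) (f : ℕ → M) :
    ∑ a ∈ (Finset.Icc 1 (p ^ (c + 1))).filter (fun a => ¬ p ∣ a), f a =
      ∑ a ∈ (Finset.range (p ^ (c + 1))).filter (fun a => ¬ p ∣ a), f a := by
  apply Finset.sum_congr _ fun _ _ => rfl
  ext a
  simp only [Finset.mem_filter, Finset.mem_Icc, Finset.mem_range, and_congr_left_iff]
  intro ha
  have h0 : a ≠ 0 := by rintro rfl; exact ha (dvd_zero p)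
  have h1 : a ≠ p ^ (c + 1) := by rintro rfl; exact ha (dvd_pow_self p (Nat.succ_ne_zero c))
  omega

lemma exists_condT_eq (p : ℕ) : ∃ c : ℕ, condT p = p ^ (c + 1) := by
  by_cases h : p = 2
  · exact ⟨1, by rw [condT, if_pos h, h]; norm_num⟩
  · exact ⟨0, by rw [condT, if_neg h, zero_add, pow_one]⟩

section KubotaLeopoldt

variable {p : ℕ} [Fact p.Prime]

lemma binom_natCast (t j : ℕ) : binom p (t : ℤ_[p]) j = (t.choose j : ℚ_[p]) := by
  rw [binom, Ring.choose_natCast, PadicInt.coe_natCast]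

lemma unitPow_natCast (x : ℚ_[p]) (t : ℕ) : unitPow p x (t : ℤ_[p]) = x ^ t := by
  rw [unitPow, tsum_eq_sum (s := Finset.range (t + 1))]
  · conv_rhs => rw [← sub_add_cancel x 1, add_pow]
    apply Finset.sum_congr rfl
    intro j _
    rw [binom_natCast, one_pow, mul_one, mul_comm]
  · intro j hj
    rw [binom_natCast, Nat.choose_eq_zero_of_lt (by simpa using hj), Nat.cast_zero, zero_mul]

lemma teich_ne_zero {a : ℕ} (ha : ¬ p ∣ a) : teich p a ≠ 0 := by
  have hp : p.Prime := Fact.out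
  rw [teich, dif_pos ha]
  intro h
  have h1 := (existsUnique_teichmuller p a ha).choose_spec.1.1
  rw [h, zero_pow] at h1
  · exact zero_ne_one h1
  · obtain ⟨c, hc⟩ := exists_condT_eq p
    rw [hc]
    exact (Nat.totient_pos.2 (pow_pos hp.pos _)).ne'

lemma teich_pow_mul_angle_pow {a : ℕ} (ha : ¬ p ∣ a) (t : ℕ) :
    (teich p a : ℚ_[p]) ^ t * angle p a ^ t = (a : ℚ_[p]) ^ t := by
  have h : (teich p a : ℚ_[p]) ≠ 0 := fun h => teich_ne_zero ha (PadicInt.ext h)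
  rw [← mul_pow, angle, mul_div_cancel₀ _ h]

/-- At a natural number t the series stops at j = t and is the expansion of B_t(1/x), scaled by x^t.
-/
lemma tsum_binom_bernoulli (x : ℚ) (hx : x ≠ 0) (t : ℕ) :
    (∑' j : ℕ, binom p (t : ℤ_[p]) j * ((bernoulli j : ℚ) : ℚ_[p]) * (x : ℚ_[p]) ^ j) =
      ((x ^ t * (Polynomial.bernoulli t).eval (1 / x) : ℚ) : ℚ_[p]) := by
  rw [tsum_eq_sum (s := Finset.range (t + 1))]
  · rw [bernoulli_eval_eq_sum, Finset.mul_sum, Rat.cast_sum]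
    apply Finset.sum_congr rfl
    intro j hj
    have h : x ^ t * (1 / x) ^ (t - j) = x ^ j := by
      conv_lhs => rw [← Nat.add_sub_cancel' (Nat.lt_succ_iff.1 (Finset.mem_range.1 hj)), pow_add]
      rw [Nat.add_sub_cancel' (Nat.lt_succ_iff.1 (Finset.mem_range.1 hj)), mul_assoc, ← mul_pow,
        mul_one_div_cancel hx, one_pow, mul_one]
    rw [binom_natCast, mul_left_comm, h]
    push_cast
    ring
  · intro j hj
    rw [binom_natCast, Nat.choose_eq_zero_of_lt (by simpa using hj), Nat.cast_zero, zero_mul,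
      zero_mul]

/-- Here 1 - s = r + 1 is a natural number, so all series are finite, and the exponent of ω is such
that ω(a)^(r+1) ⟨a⟩^(r+1) = a^(r+1). What is left is the distribution relation over residues prime
to p, the conductor being a power of p. -/
lemma Lp_neg_natCast {r : ℕ} (hr : 1 ≤ r) {s : ℤ_[p]} (hs : s = -(r : ℤ_[p])) :
    Lp p (r + 1) s = (((1 - (p : ℚ) ^ r) * zetaNeg r : ℚ) : ℚ_[p]) := by
  have hp : p.Prime := Fact.out
  obtain ⟨c, hc⟩ := exists_condT_eq p
  have hs1 : 1 - s = ((r + 1 : ℕ) : ℤ_[p]) := by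
    rw [hs]
    push_cast
    ring
  have hq : (p : ℚ) ^ (c + 1) ≠ 0 := pow_ne_zero _ (by exact_mod_cast hp.ne_zero)
  have hterm : ∀ a ∈ (Finset.Icc 1 (condT p)).filter (fun a => ¬ p ∣ a),
      (teich p a : ℚ_[p]) ^ (r + 1) * unitPow p (angle p a) (1 - s) *
        ∑' j : ℕ, binom p (1 - s) j * ((bernoulli j : ℚ) : ℚ_[p]) *
          ((condT p : ℚ_[p]) / (a : ℚ_[p])) ^ j =
      ((((p : ℚ) ^ (c + 1)) ^ (r + 1) *
        (Polynomial.bernoulli (r + 1)).eval ((a : ℚ) / (p : ℚ) ^ (c + 1)) : ℚ) : ℚ_[p]) := by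
    intro a ha
    have ha' := (Finset.mem_filter.1 ha).2
    have ha0 : (a : ℚ) ≠ 0 := by
      intro h
      rw [Nat.cast_eq_zero] at h
      exact ha' (h ▸ dvd_zero p)
    have hx : ((condT p : ℚ_[p]) / (a : ℚ_[p])) = (((p : ℚ) ^ (c + 1) / a : ℚ) : ℚ_[p]) := by
      rw [hc]
      push_cast
      rfl
    rw [hs1, unitPow_natCast, teich_pow_mul_angle_pow ha', hx,
      tsum_binom_bernoulli _ (div_ne_zero hq ha0), one_div_div,
      ← Rat.cast_natCast (α := ℚ_[p]) a, ← Rat.cast_pow, ← Rat.cast_mul, ← mul_assoc, ← mul_pow,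
      mul_div_cancel₀ _ ha0]
  rw [Lp, Finset.sum_congr rfl hterm, hc, sum_Icc_units_eq, ← Rat.cast_sum, ← Finset.mul_sum,
    pow_succ ((p : ℚ) ^ (c + 1)) r, mul_right_comm (((p : ℚ) ^ (c + 1)) ^ r), sum_units_bernoulli_eval_div hp.pos, zetaNeg,
    bernoulli_eq_bernoulli'_of_ne_one (by omega), hs]
  have hq' : (p : ℚ_[p]) ^ (c + 1) ≠ 0 := pow_ne_zero _ (by exact_mod_cast hp.ne_zero)
  have hr' : ((r : ℚ_[p]) + 1) ≠ 0 := by exact_mod_cast Nat.succ_ne_zero r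
  have hd : ((-(r : ℤ_[p]) : ℤ_[p]) : ℚ_[p]) - 1 = -((r : ℚ_[p]) + 1) := by
    push_cast
    ring
  rw [hd]
  push_cast
  field_simp

/-- `D_p(n, ν)` in terms of values of the Riemann zeta function. -/
lemma Dp_eq {n ν : ℕ} (hν₁ : 1 ≤ ν) (hν₂ : ν < n) :
    Dp p n ν = (((1 - (p : ℚ) ^ ν) * zetaNeg ν * ((1 - (p : ℚ) ^ (n - ν)) * zetaNeg (n - ν)) /
      ((1 - (p : ℚ) ^ (n + 1)) * zetaNeg (n + 1)) - (1 - (p : ℚ) ^ ν) * zetaNeg ν -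
      (1 - (p : ℚ) ^ (n - ν)) * zetaNeg (n - ν) : ℚ) : ℚ_[p]) := by
  rw [Dp, add_comm 1 ν, Lp_neg_natCast hν₁ rfl,
    Lp_neg_natCast (r := n - ν) (by omega) (by rw [Nat.cast_sub hν₂.le]; ring),
    Lp_neg_natCast (r := n + 1) (by omega) (by push_cast; ring)]
  push_cast
  rfl

end KubotaLeopoldt

/-! ### `p`-adic limits -/

lemma tendsto_zero_of_recursion {K : Type*} [NormedField K] {a : K} (ha : ‖a‖ < 1) {x s : ℕ → K}
    (hx : ∀ k, x (k + 1) = a * x k + s k) (hs : Filter.Tendsto s Filter.atTop (nhds 0)) :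
    Filter.Tendsto x Filter.atTop (nhds 0) := by
  have h1a : 0 < 1 - ‖a‖ := sub_pos.2 ha
  rw [Metric.tendsto_atTop] at hs ⊢
  intro ε hε
  -- With this size of perturbation the bound ε/2 reproduces itself under the recursion.
  obtain ⟨N, hN⟩ := hs (ε / 2 * (1 - ‖a‖)) (by positivity)
  have hb : ∀ m, ‖x (N + m)‖ ≤ ‖a‖ ^ m * ‖x N‖ + ε / 2 := by
    intro m
    induction m with
    | zero => simpa using (half_pos hε).le
    | succ m ih =>
      have h1 := hN (N + m) (Nat.le_add_right _ _)
      rw [dist_zero_right] at h1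
      rw [← add_assoc, hx]
      calc ‖a * x (N + m) + s (N + m)‖ ≤ ‖a‖ * ‖x (N + m)‖ + ‖s (N + m)‖ := by
            rw [← norm_mul]; exact norm_add_le _ _
        _ ≤ ‖a‖ * (‖a‖ ^ m * ‖x N‖ + ε / 2) + ε / 2 * (1 - ‖a‖) := by gcongr
        _ = ‖a‖ ^ (m + 1) * ‖x N‖ + ε / 2 := by ring
  have hlim : Filter.Tendsto (fun m : ℕ => ‖a‖ ^ m * ‖x N‖) Filter.atTop (nhds 0) := by
    simpa using (tendsto_pow_atTop_nhds_zero_of_lt_one (norm_nonneg a) ha).mul_const ‖x N‖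
  obtain ⟨m₀, hm₀⟩ := (hlim.eventually (gt_mem_nhds (half_pos hε))).exists_forall_of_atTop
  refine ⟨N + m₀, fun m hm => ?_⟩
  obtain ⟨l, rfl⟩ := Nat.exists_eq_add_of_le ((Nat.le_add_right N m₀).trans hm)
  rw [dist_zero_right]
  have h2 := hm₀ l (by omega)
  linarith [hb l]

/-- The value σ/(1 - a) is the fixed point of the limiting recursion; subtracting it reduces to
limit 0. -/
lemma tendsto_of_recursion {K : Type*} [NormedField K] {a σ : K} (ha : ‖a‖ < 1) {x s : ℕ → K}
    (hx : ∀ k, x (k + 1) = a * x k + s k) (hs : Filter.Tendsto s Filter.atTop (nhds σ)) :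
    Filter.Tendsto x Filter.atTop (nhds (σ / (1 - a))) := by
  have ha1 : 1 - a ≠ 0 := by
    intro h
    rw [← sub_eq_zero.1 h, norm_one] at ha
    exact lt_irrefl _ ha
  have h := tendsto_zero_of_recursion ha (x := fun k => x k - σ / (1 - a)) (s := fun k => s k - σ)
    (fun k => by
      simp only [hx]
      field_simp
      ring) (by simpa using hs.sub_const σ)
  simpa using h.add_const (σ / (1 - a))

section Padic

variable {p : ℕ} [Fact p.Prime]

lemma norm_natCast_p_pow_lt_one {s : ℕ} (hs : s ≠ 0) : ‖(p : ℚ_[p]) ^ s‖ < 1 := by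
  rw [norm_pow]
  exact pow_lt_one₀ (norm_nonneg _) Padic.norm_p_lt_one hs

lemma one_sub_p_pow_ne_zero {s : ℕ} (hs : s ≠ 0) : 1 - (p : ℚ_[p]) ^ s ≠ 0 := by
  intro h
  have h1 := norm_natCast_p_pow_lt_one (p := p) hs
  rw [← sub_eq_zero.1 h, norm_one] at h1
  exact lt_irrefl _ h1

/-- The power sum up to N is a polynomial in N that vanishes at 0, and p^k tends to 0. -/
lemma tendsto_sum_range_p_pow {r : ℕ} :
    Filter.Tendsto (fun k : ℕ => ∑ j ∈ Finset.range (p ^ k), (j : ℚ_[p]) ^ r) Filter.atTop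
      (nhds 0) := by
  have hp : Filter.Tendsto (fun k : ℕ => (p : ℚ_[p]) ^ k) Filter.atTop (nhds 0) :=
    tendsto_pow_atTop_nhds_zero_of_norm_lt_one Padic.norm_p_lt_one
  have hr : ((r : ℚ_[p]) + 1) ≠ 0 := by exact_mod_cast Nat.succ_ne_zero r
  let F : Polynomial ℚ_[p] := (Polynomial.bernoulli (r + 1)).map (algebraMap ℚ ℚ_[p])
  have hF : ∀ N : ℕ, ∑ j ∈ Finset.range N, (j : ℚ_[p]) ^ r =
      (F.eval (N : ℚ_[p]) - F.eval 0) / (r + 1) := by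
    intro N
    have h1 : F.eval (N : ℚ_[p]) =
        (((Polynomial.bernoulli (r + 1)).eval (N : ℚ) : ℚ) : ℚ_[p]) := by
      have h := Polynomial.eval_map_apply (f := algebraMap ℚ ℚ_[p])
        (p := Polynomial.bernoulli (r + 1)) (N : ℚ)
      rw [map_natCast] at h
      exact h
    have h0 : F.eval 0 = ((bernoulli (r + 1) : ℚ) : ℚ_[p]) := by
      have h := Polynomial.eval_map_apply (f := algebraMap ℚ ℚ_[p])
        (p := Polynomial.bernoulli (r + 1)) (0 : ℚ)
      rw [map_zero, Polynomial.bernoulli_eval_zero] at h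
      exact h
    rw [h1, h0, Polynomial.bernoulli_succ_eval]
    push_cast
    field_simp
    ring
  simp only [hF]
  have h2 := ((F.continuous.tendsto 0).comp hp).sub_const (F.eval 0)
  rw [sub_self] at h2
  simpa using h2.div_const ((r : ℚ_[p]) + 1)

lemma tendsto_natCast_factorial :
    Filter.Tendsto (fun m : ℕ => (m.factorial : ℚ_[p])) Filter.atTop (nhds 0) := by
  have hp : p.Prime := Fact.out
  rw [Metric.tendsto_atTop]
  intro ε hε
  obtain ⟨k, hk⟩ := exists_pow_lt_of_lt_one hε (Padic.norm_p_lt_one (p := p))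
  refine ⟨p ^ k, fun m hm => ?_⟩
  obtain ⟨c, hc⟩ := Nat.dvd_factorial (pow_pos hp.pos k) hm
  rw [dist_zero_right, hc, Nat.cast_mul, Nat.cast_pow, norm_mul, norm_pow]
  have h1 : ‖(c : ℚ_[p])‖ ≤ 1 := by simpa using Padic.norm_int_le_one (p := p) (c : ℤ)
  calc ‖(p : ℚ_[p])‖ ^ k * ‖(c : ℚ_[p])‖ ≤ ‖(p : ℚ_[p])‖ ^ k * 1 := by gcongr
    _ < ε := by rwa [mul_one]

/-- From (A + 1) binom(m!, A + 1) = m! binom(m! - 1, A), where the last factor is a p-adic integer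
and m! tends to 0. This is the role of the factorials in the theorem. -/
lemma tendsto_choose_factorial (A : ℕ) :
    Filter.Tendsto (fun m : ℕ => ((m.factorial.choose (A + 1) : ℕ) : ℚ_[p])) Filter.atTop
      (nhds 0) := by
  have hA : ((A : ℚ_[p]) + 1) ≠ 0 := by exact_mod_cast Nat.succ_ne_zero A
  have h := (tendsto_natCast_factorial (p := p)).norm.mul_const (‖((A : ℚ_[p]) + 1)‖⁻¹)
  rw [norm_zero, zero_mul] at h
  refine squeeze_zero_norm (fun m => ?_) h
  obtain ⟨M, hM⟩ := Nat.exists_eq_succ_of_ne_zero m.factorial_ne_zero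
  have h1 := Nat.add_one_mul_choose_eq M A
  have h2 : ((m.factorial.choose (A + 1) : ℕ) : ℚ_[p]) =
      (m.factorial : ℚ_[p]) * (M.choose A : ℚ_[p]) * ((A : ℚ_[p]) + 1)⁻¹ := by
    rw [eq_mul_inv_iff_mul_eq₀ hA, hM]
    exact_mod_cast h1.symm
  have h3 : ‖(M.choose A : ℚ_[p])‖ ≤ 1 := by
    simpa using Padic.norm_int_le_one (p := p) (M.choose A : ℤ)
  rw [h2, norm_mul, norm_mul, norm_inv]
  gcongr
  exact mul_le_of_le_one_right (norm_nonneg _) h3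

/-- Once A ≤ m!, so that the subtraction is not truncated, this is binom(m!, A) - binom(m!, A - 1).
Only binom(m!, 0) = 1 survives in the limit, positively at A = 0 and negatively at A = 1. -/
lemma tendsto_ballot_factorial (A : ℕ) :
    Filter.Tendsto (fun m : ℕ => ((ballot (m.factorial - A) A : ℤ) : ℚ_[p])) Filter.atTop
      (nhds (if A = 0 then 1 else if A = 1 then -1 else 0)) := by
  have hlarge : ∀ᶠ m : ℕ in Filter.atTop, A ≤ m.factorial :=
    (Filter.eventually_ge_atTop A).mono fun m hm => hm.trans (Nat.self_le_factorial m)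
  rcases A with _ | _ | A
  · simp [ballot]
  · have h := (tendsto_choose_factorial (p := p) 0).sub_const 1
    rw [zero_sub] at h
    simp only [zero_add, one_ne_zero, if_false, if_true]
    refine h.congr' (hlarge.mono fun m hm => ?_)
    simp only [zero_add] at hm
    simp [ballot, Nat.sub_add_cancel hm]
  · have h := (tendsto_choose_factorial (p := p) (A + 1)).sub (tendsto_choose_factorial (p := p) A)
    rw [sub_zero] at h
    rw [if_neg (by omega), if_neg (by omega)]
    refine h.congr' (hlarge.mono fun m hm => ?_)
    simp [ballot, Nat.sub_add_cancel hm]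

/-- The `p`-adic limit of the Hecke combination along the factorials. -/
lemma tendsto_ballot_sum {q σ : ℚ_[p]} (hq : ‖q‖ < 1) {J : ℕ → ℚ_[p]}
    (hJ : Filter.Tendsto J Filter.atTop (nhds σ)) :
    Filter.Tendsto (fun m : ℕ => ∑ A ∈ Finset.range (m.factorial / 2 + 1),
      ((ballot (m.factorial - A) A : ℤ) : ℚ_[p]) * q ^ A * J (m.factorial - 2 * A)) Filter.atTop
      (nhds ((1 - q) * σ)) := by
  obtain ⟨C, hC⟩ := hJ.norm.bddAbove_range
  have hC' : ∀ k, ‖J k‖ ≤ C := fun k => hC ⟨k, rfl⟩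
  have hfac : Filter.Tendsto Nat.factorial Filter.atTop Filter.atTop :=
    Filter.tendsto_atTop_mono Nat.self_le_factorial Filter.tendsto_id
  -- Extension by zero gives series over a fixed index set. Ballot numbers are integers and J is
  -- bounded by C, so ‖q‖^A C dominates and the limit may be taken termwise.
  let F : ℕ → ℕ → ℚ_[p] := fun m A => if A ∈ Finset.range (m.factorial / 2 + 1) then
    ((ballot (m.factorial - A) A : ℤ) : ℚ_[p]) * q ^ A * J (m.factorial - 2 * A) else 0
  let G : ℕ → ℚ_[p] := fun A => (if A = 0 then 1 else if A = 1 then -1 else 0) * q ^ A * σ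
  have hF : ∀ m : ℕ, ∑' A, F m A = ∑ A ∈ Finset.range (m.factorial / 2 + 1),
      ((ballot (m.factorial - A) A : ℤ) : ℚ_[p]) * q ^ A * J (m.factorial - 2 * A) := by
    intro m
    rw [tsum_eq_sum (s := Finset.range (m.factorial / 2 + 1)) fun A hA => if_neg hA]
    exact Finset.sum_congr rfl fun A hA => if_pos hA
  have hG : ∑' A, G A = (1 - q) * σ := by
    rw [tsum_eq_sum (s := Finset.range 2)]
    · simp [Finset.sum_range_succ, G]
      ring
    · intro A hA
      simp only [Finset.mem_range, not_lt] at hA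
      simp [G, show A ≠ 0 by omega, show A ≠ 1 by omega]
  have h := tendsto_tsum_of_dominated_convergence (𝓕 := Filter.atTop) (f := F) (g := G)
    (bound := fun A => ‖q‖ ^ A * C)
    ((summable_geometric_of_lt_one (norm_nonneg q) hq).mul_right C) ?_ ?_
  · rw [hG] at h
    exact h.congr hF
  · intro A
    have hlarge : ∀ᶠ m : ℕ in Filter.atTop, A ∈ Finset.range (m.factorial / 2 + 1) := by
      filter_upwards [hfac.eventually_ge_atTop (2 * A)] with m hm
      rw [Finset.mem_range]
      omega
    have hJA : Filter.Tendsto (fun m : ℕ => J (m.factorial - 2 * A)) Filter.atTop (nhds σ) :=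
      hJ.comp ((Filter.tendsto_sub_atTop_nat (2 * A)).comp hfac)
    refine (((tendsto_ballot_factorial A).mul_const (q ^ A)).mul hJA).congr' ?_
    exact hlarge.mono fun m hm => (if_pos hm).symm
  · refine Filter.Eventually.of_forall fun m A => ?_
    by_cases hA : A ∈ Finset.range (m.factorial / 2 + 1)
    · simp only [F, if_pos hA, norm_mul, norm_pow]
      have h1 : ‖((ballot (m.factorial - A) A : ℤ) : ℚ_[p])‖ ≤ 1 := Padic.norm_int_le_one _
      calc _ ≤ 1 * ‖q‖ ^ A * C := by
            gcongr
            exact hC' _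
        _ = _ := by rw [one_mul]
    · simp only [F, if_neg hA, norm_zero]
      exact mul_nonneg (pow_nonneg (norm_nonneg q) A) ((norm_nonneg _).trans (hC' 0))

end Padic

/-! ### The period of the cycle -/

/-- The rational value of `∑_{j < p ^ k} ⟨Eisₙ, C̃_{ν,k,j}⟩`, with `s = n - ν`. -/
noncomputable def levelPeriod (p ν s k : ℕ) [Fact p.Prime] : ℚ :=
  bernSum₁ p ν k + bernSum₀ p ν s k +
    ((∑ i ∈ Finset.range (k + 1), ((p : ℚ) ^ (ν + s + 1)) ^ i) -
      (p : ℚ) ^ s * ∑ i ∈ Finset.range k, ((p : ℚ) ^ (ν + s + 1)) ^ i) *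
      (zetaNeg ν * zetaNeg s / zetaNeg (ν + s + 1))

/-- The combination of the level periods in `⟨Eisₙ, C⟩` for the cycle `C` lifting `T_p ^ m C_ν`. -/
noncomputable def accumPeriod (p ν s N : ℕ) [Fact p.Prime] : ℚ :=
  ∑ k ∈ Finset.range (N + 1), (p : ℚ) ^ (s * (N - k)) * levelPeriod p ν s k

/-- The rational number `⟨Eisₙ, C⟩` for the cycle `C` lifting `T_p ^ m C_ν`, with `n = ν + s`. -/
noncomputable def cyclePeriod (p ν s m : ℕ) [Fact p.Prime] : ℚ :=
  ∑ A ∈ Finset.range (m / 2 + 1), (ballot (m - A) A : ℚ) * ((p : ℚ) ^ (ν + s + 1)) ^ A *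
    accumPeriod p ν s (m - 2 * A)

section Complex

variable {n : ℕ} {hn : 2 ≤ n} {p : ℕ} [Fact p.Prime] {ν : Fin (n + 1)}

lemma sum_pairing_C1Tilde_eq_levelPeriod (he : Even n) (hν₁ : 1 ≤ (ν : ℕ)) (hν₂ : (ν : ℕ) < n)
    (k : ℕ) (τ₀ τ₁ : ℍ) :
    ∑ j ∈ Finset.range (p ^ k), pairing (Eis n hn) (C1Tilde p n ν k j τ₀ τ₁) =
      (levelPeriod p ν (n - ν) k : ℂ) := by
  obtain ⟨κ, hκ⟩ := tendsto_unitPeriodTail_zero (hn := hn) he hν₁ hν₂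
  have h1 : (((ν : ℕ) : ℂ) - n) = -((n - ν : ℕ) : ℂ) := by
    rw [Nat.cast_sub hν₂.le]
    ring
  have h2 : (-1 - (n : ℂ)) = -((n + 1 : ℕ) : ℂ) := by
    push_cast
    ring
  rw [sum_pairing_C1Tilde he hν₁ hν₂ hκ, h1, h2, riemannZeta_neg_eq_zetaNeg,
    riemannZeta_neg_eq_zetaNeg, riemannZeta_neg_eq_zetaNeg, levelPeriod,
    Nat.add_sub_cancel' hν₂.le]
  push_cast
  ring

/-- The sums over j do not depend on the base points, so the rescalings of τ in the cycle play no
role. -/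
lemma pairing_liftCycle (he : Even n) (hν₁ : 1 ≤ (ν : ℕ)) (hν₂ : (ν : ℕ) < n) (m : ℕ) (τ : ℍ) :
    pairing (Eis n hn) (liftCycle p n ν m τ) = (cyclePeriod p ν (n - ν) m : ℂ) := by
  rw [liftCycle, cyclePeriod, map_sum, Rat.cast_sum]
  apply Finset.sum_congr rfl
  intro A _
  rw [map_zsmul, map_sum, accumPeriod, Nat.add_sub_cancel' hν₂.le]
  simp only [map_zsmul, map_sum, sum_pairing_C1Tilde_eq_levelPeriod he hν₁ hν₂, zsmul_eq_mul]
  push_cast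
  rw [pow_mul]

end Complex

/-! ### The p-adic limits of the periods -/

section Padic

variable {p : ℕ} [Fact p.Prime] {ν s : ℕ}

lemma tendsto_bernSum₁ :
    Filter.Tendsto (fun k : ℕ => (bernSum₁ p ν k : ℚ_[p])) Filter.atTop
      (nhds (-(zetaNeg ν : ℚ_[p]))) := by
  have hp : p.Prime := Fact.out
  have h := ((tendsto_sum_range_p_pow (p := p) (r := ν)).const_mul ((-1 : ℚ_[p]) ^ (ν + 1))).const_add
    (-(zetaNeg ν : ℚ_[p]))
  rw [mul_zero, add_zero] at h
  refine h.congr fun k => ?_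
  rw [bernSum₁_eq hp.pos]
  push_cast
  rfl

/-- A recursion with contraction factor p^ν and constant increment. Evenness of ν + s lets the sign
(-1)^(ν+1) serve as (-1)^(s+1), which makes the increment a multiple of ζ(-s). -/
lemma tendsto_bernSum₀ (hν : ν ≠ 0) (he : Even (ν + s)) :
    Filter.Tendsto (fun k : ℕ => (bernSum₀ p ν s k : ℚ_[p])) Filter.atTop
      (nhds (-((1 - (p : ℚ_[p]) ^ s) * zetaNeg s) / (1 - (p : ℚ_[p]) ^ ν))) := by
  have hsign : (-1 : ℚ) ^ (ν + 1) = (-1) ^ (s + 1) := by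
    rw [pow_succ, pow_succ, neg_one_pow_congr (Nat.even_add.1 he)]
  refine tendsto_of_recursion (norm_natCast_p_pow_lt_one hν)
    (s := fun _ => -((1 - (p : ℚ_[p]) ^ s) * zetaNeg s)) (fun k => ?_) tendsto_const_nhds
  rw [bernSum₀_succ, hsign, neg_one_pow_mul_bernoulli]
  push_cast
  ring

lemma tendsto_levelPeriod (hν : ν ≠ 0) (he : Even (ν + s)) :
    Filter.Tendsto (fun k : ℕ => (levelPeriod p ν s k : ℚ_[p])) Filter.atTop
      (nhds (-(zetaNeg ν : ℚ_[p]) +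
        -((1 - (p : ℚ_[p]) ^ s) * zetaNeg s) / (1 - (p : ℚ_[p]) ^ ν) +
        ((1 - (p : ℚ_[p]) ^ (ν + s + 1))⁻¹ - (p : ℚ_[p]) ^ s * (1 - (p : ℚ_[p]) ^ (ν + s + 1))⁻¹) *
          (zetaNeg ν * zetaNeg s / zetaNeg (ν + s + 1)))) := by
  have hg := (hasSum_geometric_of_norm_lt_one
    (norm_natCast_p_pow_lt_one (p := p) (Nat.succ_ne_zero (ν + s)))).tendsto_sum_nat
  have h := (tendsto_bernSum₁ (p := p) (ν := ν)).add (tendsto_bernSum₀ hν he) |>.add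
    (((hg.comp (Filter.tendsto_add_atTop_nat 1)).sub (hg.const_mul ((p : ℚ_[p]) ^ s))).mul_const
      (zetaNeg ν * zetaNeg s / zetaNeg (ν + s + 1) : ℚ_[p]))
  refine h.congr fun k => ?_
  rw [levelPeriod]
  push_cast
  rfl

lemma accumPeriod_succ (N : ℕ) :
    accumPeriod p ν s (N + 1) = (p : ℚ) ^ s * accumPeriod p ν s N + levelPeriod p ν s (N + 1) := by
  rw [accumPeriod, Finset.sum_range_succ, accumPeriod, Finset.mul_sum, Nat.sub_self, mul_zero,
    pow_zero, one_mul]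
  congr 1
  apply Finset.sum_congr rfl
  intro k hk
  rw [Nat.sub_add_comm (Nat.lt_succ_iff.1 (Finset.mem_range.1 hk)), mul_add, mul_one, pow_add]
  ring

/-- The recursion of the accumulated sums divides the limit of the level periods by 1 - p^s, and the
ballot sum multiplies it by 1 - p^(ν+s+1). -/
lemma tendsto_cyclePeriod (hν : ν ≠ 0) (hs : s ≠ 0) (he : Even (ν + s)) :
    Filter.Tendsto (fun m : ℕ => (cyclePeriod p ν s m.factorial : ℚ_[p])) Filter.atTop
      (nhds (((1 - (p : ℚ) ^ (ν + s + 1)) *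
        (zetaNeg ν * zetaNeg s / ((1 - (p : ℚ) ^ (ν + s + 1)) * zetaNeg (ν + s + 1)) -
          zetaNeg ν / (1 - (p : ℚ) ^ s) - zetaNeg s / (1 - (p : ℚ) ^ ν)) : ℚ) : ℚ_[p])) := by
  have hJ := tendsto_of_recursion (norm_natCast_p_pow_lt_one (p := p) hs)
    (x := fun N => (accumPeriod p ν s N : ℚ_[p]))
    (fun N => by
      rw [accumPeriod_succ]
      push_cast
      rfl)
    ((tendsto_levelPeriod hν he).comp (Filter.tendsto_add_atTop_nat 1))
  have h := tendsto_ballot_sum (norm_natCast_p_pow_lt_one (p := p) (Nat.succ_ne_zero (ν + s))) hJ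
  have hq := one_sub_p_pow_ne_zero (p := p) (Nat.succ_ne_zero (ν + s))
  have hν' := one_sub_p_pow_ne_zero (p := p) hν
  have hs' := one_sub_p_pow_ne_zero (p := p) hs
  convert! h using 2
  · rw [cyclePeriod]
    push_cast
    rfl
  · push_cast
    -- The identity holds for every value of z, including 0 with x/0 = 0, so no nonvanishing of
    -- ζ(-1-n) enters.
    generalize (zetaNeg (ν + s + 1) : ℚ_[p]) = z
    rw [Nat.succ_eq_add_one] at hq
    rw [mul_comm (1 - (p : ℚ_[p]) ^ (ν + s + 1)) z, ← div_div]
    generalize (zetaNeg ν * zetaNeg s / z : ℚ_[p]) = y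
    field_simp
    ring

end Padic

end EisPeriod

/-! ### The limit formula and its expression by p-adic L-values -/

theorem theorem3 (n : ℕ) (hn : 2 ≤ n) (hn_even : Even n) (p : ℕ) [Fact p.Prime]
    (ν : ℕ) (hν₁ : 1 ≤ ν) (hν₂ : ν ≤ n - 1) (τ : UpperHalfPlane) :
    ∃ (c : ℕ → ℚ) (L : ℚ),
      (∀ m : ℕ, (c m : ℂ) = EisPeriod.pairing (EisPeriod.Eis n hn)
        (EisPeriod.liftCycle p n ⟨ν, by omega⟩ (Nat.factorial m) τ)) ∧
      Filter.Tendsto (fun m : ℕ => (c m : ℚ_[p])) Filter.atTop (nhds (L : ℚ_[p])) ∧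
      (L : ℂ) = (1 - (p : ℂ) ^ (n + 1)) *
        (riemannZeta (-(ν : ℂ)) * riemannZeta ((ν : ℂ) - n) /
            ((1 - (p : ℂ) ^ (n + 1)) * riemannZeta (-1 - (n : ℂ)))
          - riemannZeta (-(ν : ℂ)) / (1 - (p : ℂ) ^ (n - ν))
          - riemannZeta ((ν : ℂ) - n) / (1 - (p : ℂ) ^ ν)) ∧
      (L : ℚ_[p]) = (1 - (p : ℚ_[p]) ^ (n + 1)) /
        ((1 - (p : ℚ_[p]) ^ ν) * (1 - (p : ℚ_[p]) ^ (n - ν))) * EisPeriod.Dp p n ν := by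
  have hlt : ν < n := by omega
  have hadd : ν + (n - ν) = n := Nat.add_sub_cancel' hlt.le
  have hs : n - ν ≠ 0 := by omega
  refine ⟨fun m => EisPeriod.cyclePeriod p ν (n - ν) m.factorial, _, fun m => ?_,
    EisPeriod.tendsto_cyclePeriod (by omega) hs (hadd.symm ▸ hn_even), ?_, ?_⟩
  · exact (EisPeriod.pairing_liftCycle (ν := ⟨ν, by omega⟩) hn_even hν₁ hlt _ τ).symm
  · have h1 : ((ν : ℂ) - n) = -((n - ν : ℕ) : ℂ) := by
      rw [Nat.cast_sub hlt.le]
      ring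
    have h2 : (-1 - (n : ℂ)) = -((n + 1 : ℕ) : ℂ) := by
      push_cast
      ring
    rw [h1, h2, EisPeriod.riemannZeta_neg_eq_zetaNeg, EisPeriod.riemannZeta_neg_eq_zetaNeg,
      EisPeriod.riemannZeta_neg_eq_zetaNeg, hadd]
    push_cast
    rfl
  · have hq := EisPeriod.one_sub_p_pow_ne_zero (p := p) (Nat.succ_ne_zero n)
    have hν' := EisPeriod.one_sub_p_pow_ne_zero (p := p) (show ν ≠ 0 by omega)
    have hs' := EisPeriod.one_sub_p_pow_ne_zero (p := p) hs
    rw [EisPeriod.Dp_eq hν₁ hlt, hadd]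
    push_cast
    generalize (EisPeriod.zetaNeg (n + 1) : ℚ_[p]) = z
    -- For z = 0 the quotients by z are 0 on both sides under the convention x/0 = 0, and the
    -- remaining terms still agree.
    rcases eq_or_ne z 0 with rfl | hz
    · simp only [mul_zero, div_zero]
      field_simp
      ring
    · field_simp
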